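/- **Setting.** Fix a countably infinite set $\Delta$ of constants (values). A *TBox* $T$ is a finite set of positive inclusions $B_1\sqsubseteq B_2$, negative inclusions $B_1\sqsubseteq\neg B_2$ and functionality assertions $(\mathsf{funct}\,R)$, where $B::=N\mid\exists R$, $R::=P\mid P^-$, for concept names $N$ and role names $P$. An *ABox* $A$ is a finite set of facts $N(c)$, $P(c,d)$ over $\Delta$, and $\mathrm{adom}(A)$ is the set of constants in it. Models are first-order interpretations in which distinct constants denote distinct objects; $A$ is $T$-consistent if $(T,A)$ has a model. An *ECQ* is built from unions of conjunctive queries $[q]$, evaluated under certain answers over $(T,A)$, by $\neg,\wedge,\exists x$, with quantifiers ranging over $\mathrm{adom}(A)$; answers take values in $\mathrm{adom}(A)$. A *KAB* $K=(T,A_0,\Gamma,\Pi)$ consists of a TBox $T$, a $T$-consistent ABox $A_0$, a finite set $\Gamma$ of actions, each with a list of parameters and finitely many effects $[q^+]\wedge Q^-\rightsquigarrow E$ ($q^+$ a union of conjunctive queries, $Q^-$ an ECQ whose free variables are free in $q^+$, $E$ a finite set of facts over individuals of $A_0$, free variables of $q^+$, and service calls $f(\vec x)$ with arguments $\vec x$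 free in $q^+$), and a finite set $\Pi$ of rules $Q\mapsto\alpha$ with $\alpha\in\Gamma$ and $Q$ an ECQ whose free variables are exactly the parameters of $\alpha$. States are pairs $\langle A,m\rangle$ of an ABox and a partial map $m$ from ground service calls to $\Delta$. Executing $\alpha$ in $\langle A,m\rangle$ with parameters $\sigma$ such that $\sigma$ answers $Q$ over $(T,A)$ for some rule $Q\mapsto\alpha$ of $\Pi$ leads to every $\langle A',m'\rangle$ obtained as follows: let $D$ be the union, over the effects of $\alpha$ and the answers $\rho$ of $([q^+]\wedge Q^-)\sigma$ over $(T,A)$, of $E\sigma\rho$; take any map $\theta$ from the service calls in $D$ to $\Delta$ that agrees with $m$; put $A'=D\theta$ and $m'=m\cup\theta$. A *b-repair* of $A$ is a maximal $T$-consistent subset of $A$; the *c-repair* of $A$ is the intersection of all b-repairs. Let $\mathsf{State}$ be a concept name and $\mathit{temp}$ a constant, neither occurring in $K$. The *b-transition system* (resp. *c-transition system*) of $K$ is generated from $\langle A_0,\emptyset\rangle$ by: *action steps* $\langle A,m\rangle\Rightarrow\langle A'\cup\{\mathsf{State}(\mathit{temp})\},m'\rangle$ if $\mathsf{State}(\mathit{temp})\notin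 A$ and executing an action of $\Gamma$ in $\langle A,m\rangle$ can lead to $\langle A',m'\rangle$; and *repair steps* $\langle A,m\rangle\Rightarrow\langle A',m\rangle$ if $\mathsf{State}(\mathit{temp})\in A$ and $A'$ is a b-repair (resp. the c-repair) of $A\setminus\{\mathsf{State}(\mathit{temp})\}$. A *b-KAB* (resp. *c-KAB*) is a KAB with this transition system. It is *run-bounded* if there is $b\in\mathbb N$ such that, for every (finite or infinite) run from the initial state, fewer than $b$ values occur in the ABoxes of the states of the run. The logic $\mu\mathcal L_A^{IT}$ has the formulae $$\Phi::=Q\mid\neg\Phi\mid\Phi_1\wedge\Phi_2\mid\exists x.\Phi\mid\langle-\rangle[-]\Phi\mid[-][-]\Phi\mid Z\mid\mu Z.\Phi$$ with $Q$ an ECQ and $Z$ occurring only positively in the scope of $\mu Z$. It has the usual $\mu$-calculus semantics, where $Q$ is evaluated over $T$ and the ABox of the state, and $\exists x$ ranges over the active domain of the ABox of the state. **Theorem.** Verification of $\mu\mathcal L_A^{IT}$ properties over run-bounded b-KABs and c-KABs is decidable. That is, there is an algorithm that, given a KAB $K$ whose b-transition system is run-bounded and a closed $\mu\mathcal L_A^{IT}$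 formula $\Phi$ (and the names $\mathsf{State}$, $\mathit{temp}$), halts and decides whether $\Phi$ holds in the initial state of the b-transition system of $K$; and there is such an algorithm for c-transition systems. -/

import Mathlib

namespace KABs

/-! Concept names, role names, service (function) names, action names, variables, and the
countably infinite set of individual constants (values) are all taken to be the natural numbers.
Finite sets that occur in syntax are presented by lists. -/

section DLLite

/-- A role expression `P` or `P⁻`. -/
inductive Role where
  | name (P : ℕ)
  | inv (P : ℕ)

/-- A basic concept `N` or `∃R`. -/
inductive BConcept where
  | name (N : ℕ)
  | ex (R : Role)

/-- A TBox: positive inclusions `B₁ ⊑ B₂`, negative inclusions `B₁ ⊑ ¬B₂`,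
functionality assertions `(funct R)`. -/
structure TBox where
  pos : List (BConcept × BConcept)
  neg : List (BConcept × BConcept)
  funct : List Role

/-- Atoms `N(t)` and `P(t,u)` over a set `τ` of terms.  Used for ABox assertions (terms are
constants), query atoms, effect facts, and facts with service calls. -/
inductive Assertion (τ : Type) where
  | conc (N : ℕ) (t : τ)
  | role (P : ℕ) (t u : τ)
  deriving DecidableEq

def Assertion.map {α β : Type} (f : α → β) : Assertion α → Assertion β
  | .conc N t => .conc N (f t)
  | .role P t u => .role P (f t) (f u)

def Assertion.terms {α : Type} : Assertion α → List α
  | .conc _ t => [t]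
  | .role _ t u => [t, u]

/-- An ABox: a finite set of membership assertions over constants. -/
abbrev ABox := Finset (Assertion ℕ)

/-- The active domain of an ABox. -/
def adom (A : ABox) : Set ℕ := {c | ∃ F ∈ A, c ∈ F.terms}

/-- A first-order interpretation with domain `Δ`; distinct constants denote distinct objects
(unique name assumption). -/
structure Interp (Δ : Type) where
  const : ℕ → Δ
  const_injective : Function.Injective const
  conc : ℕ → Set Δ
  role : ℕ → Δ → Δ → Prop

namespace Interp

variable {Δ : Type}

def roleExt (I : Interp Δ) : Role → Δ → Δ → Prop
  | .name P => fun x y => I.role P x y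
  | .inv P => fun x y => I.role P y x

def concExt (I : Interp Δ) : BConcept → Set Δ
  | .name N => I.conc N
  | .ex R => {x | ∃ y, I.roleExt R x y}

/-- Truth of an atom whose terms have been evaluated in the domain. -/
def HoldsAtom (I : Interp Δ) : Assertion Δ → Prop
  | .conc N x => x ∈ I.conc N
  | .role P x y => I.role P x y

def SatTBox (I : Interp Δ) (T : TBox) : Prop :=
  (∀ i ∈ T.pos, I.concExt i.1 ⊆ I.concExt i.2) ∧
  (∀ i ∈ T.neg, ∀ x, x ∈ I.concExt i.1 → x ∉ I.concExt i.2) ∧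
  (∀ R ∈ T.funct, ∀ x y z, I.roleExt R x y → I.roleExt R x z → y = z)

def SatABox (I : Interp Δ) (A : ABox) : Prop :=
  ∀ F ∈ A, I.HoldsAtom (F.map I.const)

/-- `I` is a model of the knowledge base `(T, A)`. -/
def Model (I : Interp Δ) (T : TBox) (A : ABox) : Prop := I.SatTBox T ∧ I.SatABox A

end Interp

/-- `A` is `T`-consistent. -/
def Consistent (T : TBox) (A : ABox) : Prop :=
  ∃ (Δ : Type) (I : Interp Δ), I.Model T A

end DLLite

section Queries

/-- A term of a query. -/
inductive QTerm where
  | const (c : ℕ)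
  | var (x : ℕ)

def QTerm.eval {Δ : Type} (I : Interp Δ) (μ : ℕ → Δ) : QTerm → Δ
  | .const c => I.const c
  | .var x => μ x

/-- A conjunctive query `∃ y⃗. conj`: `evars` are the variables `y⃗`. -/
structure CQ where
  evars : List ℕ
  atoms : List (Assertion QTerm)

/-- A union of conjunctive queries. -/
abbrev UCQ := List CQ

def CQ.fv (d : CQ) : Set ℕ := {x | x ∉ d.evars ∧ ∃ a ∈ d.atoms, QTerm.var x ∈ a.terms}

def UCQ.fv (q : UCQ) : Set ℕ := {x | ∃ d ∈ q, x ∈ d.fv}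

/-- `qρ` is true in `I`, where `ρ` assigns constants to the free variables of `q`. -/
def Interp.SatUCQ {Δ : Type} (I : Interp Δ) (q : UCQ) (ρ : ℕ → ℕ) : Prop :=
  ∃ d ∈ q, ∃ μ : ℕ → Δ, (∀ x, x ∉ d.evars → μ x = I.const (ρ x)) ∧
    ∀ a ∈ d.atoms, I.HoldsAtom (a.map (QTerm.eval I μ))

/-- `qρ` is true in every model of `(T, A)`. -/
def Certain (T : TBox) (A : ABox) (q : UCQ) (ρ : ℕ → ℕ) : Prop :=
  ∀ (Δ : Type) (I : Interp Δ), I.Model T A → I.SatUCQ q ρ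

/-- EQL queries over UCQs. -/
inductive ECQ where
  | ucq (q : UCQ)
  | neg (Q : ECQ)
  | and (Q₁ Q₂ : ECQ)
  | ex (x : ℕ) (Q : ECQ)

namespace ECQ

def fv : ECQ → Set ℕ
  | .ucq q => UCQ.fv q
  | .neg Q => Q.fv
  | .and Q₁ Q₂ => Q₁.fv ∪ Q₂.fv
  | .ex x Q => Q.fv \ {x}

/-- The closed query `Qρ` evaluates to true over `(T, A)`: UCQs are evaluated by certain answers
and composed by first-order constructs, with quantifiers ranging over the active domain. -/
def Holds (T : TBox) (A : ABox) : ECQ → (ℕ → ℕ) → Prop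
  | .ucq q, ρ => Certain T A q ρ
  | .neg Q, ρ => ¬ Q.Holds T A ρ
  | .and Q₁ Q₂, ρ => Q₁.Holds T A ρ ∧ Q₂.Holds T A ρ
  | .ex x Q, ρ => ∃ d ∈ adom A, Q.Holds T A (Function.update ρ x d)

/-- The answers over `(T, A)` of the query obtained from `Q` by replacing each parameter `p` in
`ps` by `σ p`.  An answer assigns elements of the active domain to the remaining free variables;
the assignments in this set also carry the values of the parameters. -/
def Ans (T : TBox) (A : ABox) (ps : List ℕ) (σ : ℕ → ℕ) (Q : ECQ) : Set (ℕ → ℕ) :=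
  {ρ | (∀ p ∈ ps, ρ p = σ p) ∧ (∀ x ∈ Q.fv, x ∉ ps → ρ x ∈ adom A) ∧ Q.Holds T A ρ}

/-- All atoms that occur in a query. -/
def atoms : ECQ → List (Assertion QTerm)
  | .ucq q => q.flatMap CQ.atoms
  | .neg Q => Q.atoms
  | .and Q₁ Q₂ => Q₁.atoms ++ Q₂.atoms
  | .ex _ Q => Q.atoms

end ECQ

end Queries

section KnowledgeActionBases

/-- Terms in the head of an effect: constants, variables, and Skolem terms `f(x⃗)` that stand for
service calls.  A function symbol is identified by its name and its number of arguments. -/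
inductive ETerm where
  | const (c : ℕ)
  | var (x : ℕ)
  | call (f : ℕ) (xs : List ℕ)

/-- An effect `[q⁺] ∧ Q⁻ ⇝ E`. -/
structure Effect where
  pos : UCQ
  neg : ECQ
  head : List (Assertion ETerm)

structure Action where
  name : ℕ
  params : List ℕ
  effects : List Effect

/-- A condition/action rule `Q ↦ α`. -/
structure Rule where
  cond : ECQ
  action : Action

/-- A (raw) knowledge and action base `(T, A₀, Γ, Π)`. -/
structure KAB where
  tbox : TBox
  abox₀ : List (Assertion ℕ)
  actions : List Action
  process : List Rule

def KAB.initABox (K : KAB) : ABox := K.abox₀.toFinset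

/-- A head term uses only individuals of `A₀` and free variables of `q⁺`. -/
def ETerm.Allowed (A₀ : ABox) (q : UCQ) : ETerm → Prop
  | .const c => c ∈ adom A₀
  | .var x => x ∈ UCQ.fv q
  | .call _ xs => ∀ x ∈ xs, x ∈ UCQ.fv q

/-- The conditions in the definition of a KAB: `A₀` is `T`-consistent, the free variables of each
`Q⁻` are free in `q⁺`, effect heads use only the allowed terms, and each rule is for an action of
`Γ` whose parameters are exactly the free variables of the condition. -/
structure KAB.WellFormed (K : KAB) : Prop where
  consistent : Consistent K.tbox K.initABox
  neg_fv : ∀ α ∈ K.actions, ∀ e ∈ α.effects, e.neg.fv ⊆ UCQ.fv e.pos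
  head_terms : ∀ α ∈ K.actions, ∀ e ∈ α.effects, ∀ F ∈ e.head, ∀ t ∈ F.terms,
    t.Allowed K.initABox e.pos
  rule_action : ∀ r ∈ K.process, r.action ∈ K.actions
  rule_fv : ∀ r ∈ K.process, r.cond.fv = {p | p ∈ r.action.params}

end KnowledgeActionBases

section Execution

/-- A ground service call `f(v₁,…,vₙ)`. -/
structure SCall where
  fn : ℕ
  args : List ℕ

/-- A ground term: a value or a service call. -/
inductive GTerm where
  | val (c : ℕ)
  | call (t : SCall)

/-- A service call map: a partial function from service calls to values. -/
abbrev CallMap := SCall → Option ℕ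

/-- A pair of an ABox and a service call map. -/
structure KState where
  abox : ABox
  calls : CallMap

def ETerm.inst (ρ : ℕ → ℕ) : ETerm → GTerm
  | .const c => .val c
  | .var x => .val (ρ x)
  | .call f xs => .call ⟨f, xs.map ρ⟩

/-- `DO(T, A, ασ)`. -/
def doFacts (T : TBox) (A : ABox) (α : Action) (σ : ℕ → ℕ) : Set (Assertion GTerm) :=
  {g | ∃ e ∈ α.effects, ∃ ρ ∈ ECQ.Ans T A α.params σ (.and (.ucq e.pos) e.neg),
    ∃ F ∈ e.head, g = F.map (ETerm.inst ρ)}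

/-- The service calls in a set of facts. -/
def callsOf (E : Set (Assertion GTerm)) : Set SCall := {t | ∃ g ∈ E, GTerm.call t ∈ g.terms}

/-- Replace service calls by their values (`0` is a dummy for calls outside the domain of `θ`;
it is not used below, as `θ` is there defined on all calls that occur). -/
def GTerm.ground (θ : CallMap) : GTerm → ℕ
  | .val c => c
  | .call t => (θ t).getD 0

/-- `σ` is legal for `α` in a state with ABox `A`. -/
def KAB.Legal (K : KAB) (A : ABox) (α : Action) (σ : ℕ → ℕ) : Prop :=
  ∃ r ∈ K.process, r.action = α ∧ σ ∈ r.cond.Ans K.tbox A [] σ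

/-- `⟨s, ασ, s'⟩ ∈ EXEC_K`. -/
def KAB.Exec (K : KAB) (s : KState) (α : Action) (σ : ℕ → ℕ) (s' : KState) : Prop :=
  K.Legal s.abox α σ ∧
  ∃ θ : CallMap,
    (∀ t, (∃ c, θ t = some c) ↔ t ∈ callsOf (doFacts K.tbox s.abox α σ)) ∧
    (∀ t c d, s.calls t = some c → θ t = some d → c = d) ∧
    (s'.abox : Set (Assertion ℕ)) =
      Assertion.map (GTerm.ground θ) '' doFacts K.tbox s.abox α σ ∧
    (∀ t c, s'.calls t = some c ↔ s.calls t = some c ∨ θ t = some c)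

/-- `A'` is a b-repair of `A` with `T`: a maximal `T`-consistent subset of `A`. -/
def IsBRepair (T : TBox) (A A' : ABox) : Prop :=
  Maximal (fun B : ABox => B ⊆ A ∧ Consistent T B) A'

/-- `A'` is the c-repair of `A` with `T`: the intersection of all b-repairs. -/
def IsCRepair (T : TBox) (A A' : ABox) : Prop :=
  ∀ F, F ∈ A' ↔ ∀ B, IsBRepair T A B → F ∈ B

/-- The action and repair steps, for the notion of repair `rep` and the marker assertion `mk`. -/
inductive KAB.Step (K : KAB) (rep : TBox → ABox → ABox → Prop) (mk : Assertion ℕ) :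
    KState → KState → Prop
  | action (s s' : KState) (α : Action) (σ : ℕ → ℕ) :
      mk ∉ s.abox → α ∈ K.actions → K.Exec s α σ s' →
      KAB.Step K rep mk s ⟨insert mk s'.abox, s'.calls⟩
  | repair (s : KState) (A' : ABox) :
      mk ∈ s.abox → rep K.tbox (s.abox.erase mk) A' →
      KAB.Step K rep mk s ⟨A', s.calls⟩

/-- The concept name `St` does not occur in the atom. -/
def Assertion.AvoidsConc {τ : Type} (St : ℕ) (F : Assertion τ) : Prop := ∀ t, F ≠ .conc St t

/-- The marker `St(tmp)` is made of a concept name and a constant that do not occur in `K`. -/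
structure KAB.FreshMarker (K : KAB) (St tmp : ℕ) : Prop where
  tbox : ∀ i ∈ K.tbox.pos ++ K.tbox.neg, i.1 ≠ .name St ∧ i.2 ≠ .name St
  abox : ∀ F ∈ K.abox₀, F.AvoidsConc St ∧ tmp ∉ F.terms
  pos : ∀ α ∈ K.actions, ∀ e ∈ α.effects, ∀ d ∈ e.pos, ∀ a ∈ d.atoms,
    a.AvoidsConc St ∧ QTerm.const tmp ∉ a.terms
  neg : ∀ α ∈ K.actions, ∀ e ∈ α.effects, ∀ a ∈ e.neg.atoms,
    a.AvoidsConc St ∧ QTerm.const tmp ∉ a.terms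
  head : ∀ α ∈ K.actions, ∀ e ∈ α.effects, ∀ F ∈ e.head,
    F.AvoidsConc St ∧ ETerm.const tmp ∉ F.terms
  cond : ∀ r ∈ K.process, ∀ a ∈ r.cond.atoms, a.AvoidsConc St ∧ QTerm.const tmp ∉ a.terms

end Execution

section TransitionSystems

/-- A transition system whose states carry ABoxes over a TBox. -/
structure TS where
  tbox : TBox
  State : Type
  init : State
  abox : State → ABox
  step : State → State → Prop

/-- The transition system generated from `⟨A₀, ∅⟩` by the action and repair steps; its states are
the states reachable from the initial one. -/
def KAB.repairTS (K : KAB) (rep : TBox → ABox → ABox → Prop) (mk : Assertion ℕ) : TS where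
  tbox := K.tbox
  State := {s : KState // Relation.ReflTransGen (K.Step rep mk) ⟨K.initABox, fun _ => none⟩ s}
  init := ⟨⟨K.initABox, fun _ => none⟩, .refl⟩
  abox s := s.1.abox
  step s s' := K.Step rep mk s.1 s'.1

/-- The b-transition system of `K`, with marker `St(tmp)`. -/
def KAB.bTS (K : KAB) (St tmp : ℕ) : TS := K.repairTS IsBRepair (.conc St tmp)

/-- The c-transition system of `K`, with marker `St(tmp)`. -/
def KAB.cTS (K : KAB) (St tmp : ℕ) : TS := K.repairTS IsCRepair (.conc St tmp)

/-- `τ 0, τ 1, …` is a run with `n` transitions (finite or infinite; `τ i` is irrelevant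
for `i > n`). -/
def TS.IsRun (Υ : TS) (n : ℕ∞) (τ : ℕ → Υ.State) : Prop :=
  τ 0 = Υ.init ∧ ∀ i : ℕ, (i : ℕ∞) < n → Υ.step (τ i) (τ (i + 1))

/-- Some `b` exceeds, for every run, the number of values in the ABoxes along the run. -/
def TS.RunBounded (Υ : TS) : Prop :=
  ∃ b : ℕ, ∀ (n : ℕ∞) (τ : ℕ → Υ.State), Υ.IsRun n τ →
    {c | ∃ i : ℕ, (i : ℕ∞) ≤ n ∧ c ∈ adom (Υ.abox (τ i))}.encard < b

end TransitionSystems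

section Logic

/-- Formulae of `μL_A^EQL`. -/
inductive MuForm where
  | query (Q : ECQ)
  | neg (Φ : MuForm)
  | and (Φ₁ Φ₂ : MuForm)
  | ex (x : ℕ) (Φ : MuForm)
  | dia (Φ : MuForm)
  | pvar (Z : ℕ)
  | mu (Z : ℕ) (Φ : MuForm)

namespace MuForm

/-- `[−]Φ` abbreviates `¬⟨−⟩¬Φ`. -/
def box (Φ : MuForm) : MuForm := .neg (.dia (.neg Φ))

/-- The extension of a formula under an individual and a predicate variable valuation. -/
def ext (Υ : TS) : MuForm → (ℕ → ℕ) → (ℕ → Set Υ.State) → Set Υ.State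
  | .query Q, v, _ => {s | Q.Holds Υ.tbox (Υ.abox s) v}
  | .neg Φ, v, V => (Φ.ext Υ v V)ᶜ
  | .and Φ₁ Φ₂, v, V => Φ₁.ext Υ v V ∩ Φ₂.ext Υ v V
  | .ex x Φ, v, V => {s | ∃ d ∈ adom (Υ.abox s), s ∈ Φ.ext Υ (Function.update v x d) V}
  | .dia Φ, v, V => {s | ∃ s', Υ.step s s' ∧ s' ∈ Φ.ext Υ v V}
  | .pvar Z, _, V => V Z
  | .mu Z Φ, v, V => ⋂₀ {E | Φ.ext Υ v (Function.update V Z E) ⊆ E}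

/-- Free individual variables. -/
def fv : MuForm → Set ℕ
  | .query Q => Q.fv
  | .neg Φ => Φ.fv
  | .and Φ₁ Φ₂ => Φ₁.fv ∪ Φ₂.fv
  | .ex x Φ => Φ.fv \ {x}
  | .dia Φ => Φ.fv
  | .pvar _ => ∅
  | .mu _ Φ => Φ.fv

/-- `Z` has a free occurrence in the scope of an odd (`odd = true`), respectively even
(`odd = false`), number of negations. -/
def FreeIn (Z : ℕ) : MuForm → Bool → Prop
  | .query _, _ => False
  | .neg Φ, odd => Φ.FreeIn Z (!odd)
  | .and Φ₁ Φ₂, odd => Φ₁.FreeIn Z odd ∨ Φ₂.FreeIn Z odd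
  | .ex _ Φ, odd => Φ.FreeIn Z odd
  | .dia Φ, odd => Φ.FreeIn Z odd
  | .pvar Y, odd => Y = Z ∧ odd = false
  | .mu Y Φ, odd => Y ≠ Z ∧ Φ.FreeIn Z odd

/-- Syntactic monotonicity: in each `μZ.Φ`, the free occurrences of `Z` in `Φ` are under an even
number of negations. -/
def Mono : MuForm → Prop
  | .query _ => True
  | .neg Φ => Φ.Mono
  | .and Φ₁ Φ₂ => Φ₁.Mono ∧ Φ₂.Mono
  | .ex _ Φ => Φ.Mono
  | .dia Φ => Φ.Mono
  | .pvar _ => True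
  | .mu Z Φ => ¬ Φ.FreeIn Z true ∧ Φ.Mono

/-- No free individual variable and no free predicate variable. -/
def Closed (Φ : MuForm) : Prop := Φ.fv = ∅ ∧ ∀ Z odd, ¬ Φ.FreeIn Z odd

end MuForm

/-- `Υ ⊨ Φ`, for closed `Φ` (whose extension does not depend on the valuations). -/
def TS.Models (Υ : TS) (Φ : MuForm) : Prop := ∀ v V, Υ.init ∈ Φ.ext Υ v V

/-- Formulae of the fragment `μL_A^IT`. -/
inductive ITForm where
  | query (Q : ECQ)
  | neg (Φ : ITForm)
  | and (Φ₁ Φ₂ : ITForm)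
  | ex (x : ℕ) (Φ : ITForm)
  | diaBox (Φ : ITForm)
  | boxBox (Φ : ITForm)
  | pvar (Z : ℕ)
  | mu (Z : ℕ) (Φ : ITForm)

def ITForm.toMu : ITForm → MuForm
  | .query Q => .query Q
  | .neg Φ => .neg Φ.toMu
  | .and Φ₁ Φ₂ => .and Φ₁.toMu Φ₂.toMu
  | .ex x Φ => .ex x Φ.toMu
  | .diaBox Φ => .dia Φ.toMu.box
  | .boxBox Φ => Φ.toMu.box.box
  | .pvar Z => .pvar Z
  | .mu Z Φ => .mu Z Φ.toMu

end Logic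

section Coding

/-! Gödel numbers of the instances of the verification problem. -/

def listCode {α : Type} (f : α → ℕ) (l : List α) : ℕ := Encodable.encode (l.map f)

def Role.code : Role → ℕ
  | .name P => Nat.pair 0 P
  | .inv P => Nat.pair 1 P

def BConcept.code : BConcept → ℕ
  | .name N => Nat.pair 0 N
  | .ex R => Nat.pair 1 R.code

def inclusionCode (i : BConcept × BConcept) : ℕ := Nat.pair i.1.code i.2.code

def TBox.code (T : TBox) : ℕ :=
  Nat.pair (listCode inclusionCode T.pos)
    (Nat.pair (listCode inclusionCode T.neg) (listCode Role.code T.funct))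

def Assertion.code {τ : Type} (f : τ → ℕ) : Assertion τ → ℕ
  | .conc N t => Nat.pair 0 (Nat.pair N (f t))
  | .role P t u => Nat.pair 1 (Nat.pair P (Nat.pair (f t) (f u)))

def QTerm.code : QTerm → ℕ
  | .const c => Nat.pair 0 c
  | .var x => Nat.pair 1 x

def CQ.code (d : CQ) : ℕ :=
  Nat.pair (listCode id d.evars) (listCode (Assertion.code QTerm.code) d.atoms)

def UCQ.code (q : UCQ) : ℕ := listCode CQ.code q

def ECQ.code : ECQ → ℕ
  | .ucq q => Nat.pair 0 (UCQ.code q)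
  | .neg Q => Nat.pair 1 Q.code
  | .and Q₁ Q₂ => Nat.pair 2 (Nat.pair Q₁.code Q₂.code)
  | .ex x Q => Nat.pair 3 (Nat.pair x Q.code)

def ETerm.code : ETerm → ℕ
  | .const c => Nat.pair 0 c
  | .var x => Nat.pair 1 x
  | .call f xs => Nat.pair 2 (Nat.pair f (listCode id xs))

def Effect.code (e : Effect) : ℕ :=
  Nat.pair (UCQ.code e.pos) (Nat.pair e.neg.code (listCode (Assertion.code ETerm.code) e.head))

def Action.code (α : Action) : ℕ :=
  Nat.pair α.name (Nat.pair (listCode id α.params) (listCode Effect.code α.effects))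

def Rule.code (r : Rule) : ℕ := Nat.pair r.cond.code r.action.code

def KAB.code (K : KAB) : ℕ :=
  Nat.pair K.tbox.code (Nat.pair (listCode (Assertion.code id) K.abox₀)
    (Nat.pair (listCode Action.code K.actions) (listCode Rule.code K.process)))

def ITForm.code : ITForm → ℕ
  | .query Q => Nat.pair 0 Q.code
  | .neg Φ => Nat.pair 1 Φ.code
  | .and Φ₁ Φ₂ => Nat.pair 2 (Nat.pair Φ₁.code Φ₂.code)
  | .ex x Φ => Nat.pair 3 (Nat.pair x Φ.code)
  | .diaBox Φ => Nat.pair 4 Φ.code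
  | .boxBox Φ => Nat.pair 5 Φ.code
  | .pvar Z => Nat.pair 6 Z
  | .mu Z Φ => Nat.pair 7 (Nat.pair Z Φ.code)

/-- An instance of the verification problem: a KAB, the name and the constant that make up the
marker, and a formula. -/
structure Instance where
  kab : KAB
  st : ℕ
  tmp : ℕ
  formula : ITForm

def Instance.code (P : Instance) : ℕ :=
  Nat.pair P.kab.code (Nat.pair P.st (Nat.pair P.tmp P.formula.code))

/-- The instance consists of a KAB, a fresh marker, and a closed syntactically monotone formula
of `μL_A^IT`. -/
def Instance.Valid (P : Instance) : Prop :=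
  P.kab.WellFormed ∧ P.kab.FreshMarker P.st P.tmp ∧
    P.formula.toMu.Closed ∧ P.formula.toMu.Mono

end Coding

/-- On the inputs that satisfy `promise`, the property `yes` is decidable: one algorithm (partial
recursive function) halts with the right answer on every such input. -/
def DecidableOn {α : Type} (code : α → ℕ) (promise yes : α → Prop) : Prop :=
  ∃ f : ℕ →. Bool, Partrec f ∧ ∀ a, promise a → ∃ b ∈ f (code a), (b = true ↔ yes a)

end KABs

/-! A state consists of an ABox and the map of all service calls made so far. Arguments and results
of calls occur in ABoxes along the run, so a bound `b` on the values in the ABoxes of each run also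
bounds the values in every reachable state, call map included (`KAB.encard_values_lt`). Moreover,
steps commute with every permutation of the values that fixes the constants of the KAB and of the
marker (`KAB.Step.rename`). The result of a new call may thus be exchanged for any value that is not
in use, and finitely many values suffice: those below `n + 2 * b + k`, where `n` bounds the
constants of the syntax and `k` the number of values that the formula can remember through its
quantifiers.

The states over such a finite stock of values form an abstraction (`IsAbstraction`,
`exists_isAbstraction`). It is linked to the full system by renamings that respect the remembered
values. Steps can be matched in both directions (`IsAbstraction.forth`, `IsAbstraction.back`), and
induction on the formula shows that truth is preserved (`IsAbstraction.transfer`).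

The algorithm does not know `b`, and `IsAbstraction` does not mention it: this predicate only
demands that in every state enough values below `N` are left for the results of new calls and for
`k` remembered values, which can be checked. The algorithm searches for an abstraction together with
the truth value of the formula in it. Run-boundedness makes the search end, and preservation of
truth makes the answer right.

Checking an abstraction requires consistency, certain answers and repairs to be decidable. Positive
inclusions and ABox have a canonical model, in general infinite, whose elements are constants
followed by words of roles. It decides consistency (`consistent_iff`) and certain answers
(`certain_iff`). The words needed in a match of a query can be bounded by cutting out repetitions
(`IsMatch.exists_bounded`), and consistency reduces to a finite test (`consistent_toFinset_iff`).

Computability is handled by closure properties: a predicate is decidable if it and its complement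
are enumerable, and enumerability is preserved by search, by quantifiers over lists, and by
derivability from rules (`RE.derivable`). Predicates defined by recursion on syntax are decided by
enumerating derivations of their truth values (`Rec.of_rules`). -/

namespace KABs

/-! ### Enumerable and decidable predicates on coded types. -/

section Semidecidable

open Encodable Denumerable

/-- `P` is the projection of a primitive recursive relation. -/
def Sig (P : ℕ → Prop) : Prop :=
  ∃ q : ℕ → ℕ → Prop, PrimrecRel q ∧ ∀ n, P n ↔ ∃ k, q n k

theorem Sig.of_primrec {P : ℕ → Prop} (h : PrimrecPred P) : Sig P :=
  ⟨fun n _ => P n, h.comp Primrec.fst, fun n => by simp⟩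

theorem Sig.of_iff {P Q : ℕ → Prop} (h : Sig P) (e : ∀ n, Q n ↔ P n) : Sig Q := by
  obtain ⟨q, hq, h⟩ := h
  exact ⟨q, hq, fun n => (e n).trans (h n)⟩

theorem Sig.comp {P : ℕ → Prop} (h : Sig P) {f : ℕ → ℕ} (hf : Primrec f) :
    Sig fun n => P (f n) := by
  obtain ⟨q, hq, h⟩ := h
  exact ⟨fun n k => q (f n) k, hq.comp (hf.comp Primrec.fst) Primrec.snd, fun n => h _⟩

theorem primrec_unpair₁ : Primrec fun n : ℕ => n.unpair.1 := Primrec.fst.comp Primrec.unpair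

theorem primrec_unpair₂ : Primrec fun n : ℕ => n.unpair.2 := Primrec.snd.comp Primrec.unpair

theorem Sig.and {P Q : ℕ → Prop} (hP : Sig P) (hQ : Sig Q) : Sig fun n => P n ∧ Q n := by
  obtain ⟨p, hp, hP⟩ := hP
  obtain ⟨q, hq, hQ⟩ := hQ
  refine ⟨fun n k => p n k.unpair.1 ∧ q n k.unpair.2,
    PrimrecPred.and (hp.comp Primrec.fst (primrec_unpair₁.comp Primrec.snd))
    (hq.comp Primrec.fst (primrec_unpair₂.comp Primrec.snd)), fun n => ?_⟩
  simp only [hP, hQ]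
  constructor
  · rintro ⟨⟨a, ha⟩, b, hb⟩
    exact ⟨Nat.pair a b, by simpa using ⟨ha, hb⟩⟩
  · rintro ⟨k, h1, h2⟩
    exact ⟨⟨_, h1⟩, _, h2⟩

theorem Sig.or {P Q : ℕ → Prop} (hP : Sig P) (hQ : Sig Q) : Sig fun n => P n ∨ Q n := by
  obtain ⟨p, hp, hP⟩ := hP
  obtain ⟨q, hq, hQ⟩ := hQ
  refine ⟨fun n k => p n k ∨ q n k, PrimrecPred.or hp hq, fun n => ?_⟩
  simp only [hP, hQ, exists_or]

theorem Sig.ex {P : ℕ → Prop} (hP : Sig P) : Sig fun n => ∃ m, P (Nat.pair n m) := by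
  obtain ⟨p, hp, hP⟩ := hP
  refine ⟨fun n k => p (Nat.pair n k.unpair.1) k.unpair.2,
    hp.comp (Primrec₂.natPair.comp Primrec.fst (primrec_unpair₁.comp Primrec.snd))
      (primrec_unpair₂.comp Primrec.snd), fun n => ?_⟩
  simp only [hP]
  constructor
  · rintro ⟨a, b, h⟩
    exact ⟨Nat.pair a b, by simpa using h⟩
  · rintro ⟨k, h⟩
    exact ⟨_, _, h⟩

/-- Finitely many witnesses have a common bound `K`, and searching below `K` for each element of the
list is primitive recursive. -/
theorem Sig.ball {P : ℕ → Prop} (hP : Sig P) :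
    Sig fun n => ∀ m ∈ ofNat (List ℕ) n.unpair.2, P (Nat.pair n.unpair.1 m) := by
  obtain ⟨p, hp, hP⟩ := hP
  have h1 : PrimrecRel fun (m : ℕ) (y : ℕ × ℕ) => ∃ k < y.2, p (Nat.pair y.1 m) k := by
    have : PrimrecRel fun k y : ℕ => p y k := hp.swap
    exact this.exists_lt.comp (Primrec.snd.comp Primrec.snd)
      (Primrec₂.natPair.comp (Primrec.fst.comp Primrec.snd) Primrec.fst)
  refine ⟨fun n K => ∀ m ∈ ofNat (List ℕ) n.unpair.2, ∃ k < K, p (Nat.pair n.unpair.1 m) k,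
    h1.forall_mem_list.comp ((Primrec.ofNat (List ℕ)).comp (primrec_unpair₂.comp Primrec.fst))
      (Primrec.pair (primrec_unpair₁.comp Primrec.fst) Primrec.snd), fun n => ?_⟩
  simp only [hP]
  generalize ofNat (List ℕ) n.unpair.2 = l
  constructor
  · intro h
    induction l with
    | nil => exact ⟨0, by simp⟩
    | cons a l ih =>
      obtain ⟨K, hK⟩ := ih fun m hm => h m (List.mem_cons_of_mem _ hm)
      obtain ⟨k, hk⟩ := h a List.mem_cons_self
      refine ⟨max K (k + 1), fun m hm => ?_⟩
      rcases List.mem_cons.1 hm with rfl | hm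
      · exact ⟨k, by omega, hk⟩
      · obtain ⟨k', h1, h2⟩ := hK m hm
        exact ⟨k', by omega, h2⟩
  · rintro ⟨K, h⟩ m hm
    obtain ⟨k, _, hk⟩ := h m hm
    exact ⟨k, hk⟩

/-- A type whose elements have Gödel numbers that form a recursively enumerable set. -/
class Numbered (α : Type) where
  code : α → ℕ
  code_injective : Function.Injective code
  range : Sig fun n => ∃ a, code a = n

open Numbered

/-- `f` is primitive recursive on codes. -/
@[fun_prop]
def Eff {α β : Type} [Numbered α] [Numbered β] (f : α → β) : Prop :=
  ∃ F : ℕ → ℕ, Primrec F ∧ ∀ a, F (code a) = code (f a)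

/-- `p` is recursively enumerable on codes. -/
def RE {α : Type} [Numbered α] (p : α → Prop) : Prop :=
  ∃ P : ℕ → Prop, Sig P ∧ ∀ a, p a ↔ P (code a)

/-- `p` and its complement are recursively enumerable on codes. -/
def Rec {α : Type} [Numbered α] (p : α → Prop) : Prop := RE p ∧ RE fun a => ¬ p a

/-- Every number decodes to some list of numbers, and it is the code of a list over `α` exactly if
the entries are codes. This turns the range of list codes into a bounded quantifier. -/
theorem code_list_range {P : ℕ → Prop} {α : Type} (c : α → ℕ) (h : ∀ n, P n ↔ ∃ a, c a = n) (n : ℕ) :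
    (∃ l : List α, encode (l.map c) = n) ↔ ∀ m ∈ ofNat (List ℕ) n, P m := by
  have key : ∀ l' : List ℕ, (∃ l : List α, l.map c = l') ↔ ∀ m ∈ l', P m := by
    intro l'
    induction l' with
    | nil => exact ⟨by simp, fun _ => ⟨[], rfl⟩⟩
    | cons m l' ih =>
      rw [List.forall_mem_cons, ← ih, h]
      constructor
      · rintro ⟨_ | ⟨a, l⟩, hl⟩
        · simp at hl
        · simp only [List.map_cons, List.cons.injEq] at hl
          exact ⟨⟨a, hl.1⟩, l, hl.2⟩
      · rintro ⟨⟨a, rfl⟩, l, rfl⟩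
        exact ⟨a :: l, rfl⟩
  rw [← key]
  refine exists_congr fun l => ?_
  constructor
  · rintro rfl
    simp
  · intro h
    rw [h]
    exact encode_ofNat n

variable {α β γ δ : Type} [Numbered α] [Numbered β] [Numbered γ] [Numbered δ]

@[fun_prop]
theorem Eff.id : Eff fun a : α => a := ⟨_, Primrec.id, fun _ => rfl⟩

@[fun_prop]
theorem Eff.const (b : β) : Eff fun _ : α => b := ⟨_, Primrec.const (code b), fun _ => rfl⟩

@[fun_prop]
theorem Eff.comp {f : β → γ} {g : α → β} (hf : Eff f) (hg : Eff g) : Eff fun a => f (g a) := by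
  obtain ⟨F, hF, hf⟩ := hf
  obtain ⟨G, hG, hg⟩ := hg
  exact ⟨fun n => F (G n), hF.comp hG, fun a => by simp only [hg, hf]⟩

instance : Numbered ℕ where
  code := fun n => n
  code_injective := fun _ _ h => h
  range := Sig.of_primrec ((Primrec.eq (α := ℕ)).comp Primrec.id Primrec.id |>.of_eq (by simp))

instance : Numbered (α × β) where
  code x := Nat.pair (code x.1) (code x.2)
  code_injective := fun x y h => by
    obtain ⟨h1, h2⟩ := Nat.pair_eq_pair.1 h
    exact Prod.ext (code_injective h1) (code_injective h2)
  range := (((range (α := α)).comp primrec_unpair₁).and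
    ((range (α := β)).comp primrec_unpair₂)).of_iff fun n => by
      constructor
      · rintro ⟨a, rfl⟩
        simp
      · rintro ⟨⟨a, ha⟩, b, hb⟩
        exact ⟨(a, b), by simp [ha, hb]⟩

theorem code_prod (x : α × β) : code x = Nat.pair (code x.1) (code x.2) := rfl

@[fun_prop]
theorem Eff.fst {f : α → β × γ} (hf : Eff f) : Eff fun a => (f a).1 :=
  Eff.comp (f := Prod.fst) ⟨_, primrec_unpair₁, fun x => by simp [code_prod]⟩ hf

@[fun_prop]
theorem Eff.snd {f : α → β × γ} (hf : Eff f) : Eff fun a => (f a).2 :=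
  Eff.comp (f := Prod.snd) ⟨_, primrec_unpair₂, fun x => by simp [code_prod]⟩ hf

@[fun_prop]
theorem Eff.pair {f : α → β} {g : α → γ} (hf : Eff f) (hg : Eff g) :
    Eff fun a => (f a, g a) := by
  obtain ⟨F, hF, hf⟩ := hf
  obtain ⟨G, hG, hg⟩ := hg
  exact ⟨fun n => Nat.pair (F n) (G n), Primrec₂.natPair.comp hF hG,
    fun a => by simp [code_prod, hf, hg]⟩

/-- Transfer of a numbering along a bijection. -/
abbrev Numbered.ofEquiv {α : Type} (e : α ≃ β) (c : α → ℕ) (h : ∀ a, c a = code (e a)) :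
    Numbered α where
  code := c
  code_injective := fun a b hab => e.injective (code_injective (by rw [← h, ← h, hab]))
  range := (range (α := β)).of_iff fun n => by
    simp only [h]
    exact e.surjective.exists (p := fun b => code b = n) |>.symm

instance : Numbered (List α) where
  code l := encode (l.map code)
  code_injective := fun _ _ h => code_injective.list_map (encode_injective h)
  range := (((range (α := α)).comp (primrec_unpair₂)).ball.comp
    (Primrec₂.natPair.comp (Primrec.const 0) Primrec.id)).of_iff fun n => by
      rw [code_list_range code (P := fun m => ∃ a : α, code a = m) (fun _ => Iff.rfl)]
      simp

theorem code_list (l : List α) : code l = encode (l.map code) := rfl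

theorem ofNat_code_list (l : List α) : ofNat (List ℕ) (code l) = l.map code := by
  simp [code_list]

instance : Numbered Bool where
  code b := b.toNat
  code_injective := fun a b h => by revert a b; decide
  range := (Sig.of_primrec (P := fun n => n < 2)
    (Primrec.nat_lt.comp Primrec.id (Primrec.const 2))).of_iff fun n => by
      constructor
      · rintro ⟨b, rfl⟩
        exact b.toNat_lt
      · intro h
        interval_cases n
        exacts [⟨false, rfl⟩, ⟨true, rfl⟩]

instance : Numbered (Option α) where
  code o := o.elim 0 fun a => code a + 1
  code_injective := fun a b h => by
    cases a <;> cases b <;> simp at h ⊢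
    exact code_injective h
  range := ((Sig.of_primrec (P := fun n => n = 0)
    (Primrec.eq.comp Primrec.id (Primrec.const 0))).or
    ((Sig.of_primrec (P := fun n => n ≠ 0)
    (Primrec.eq.comp Primrec.id (Primrec.const 0)).not).and
    ((range (α := α)).comp Primrec.pred))).of_iff fun n => by
      constructor
      · rintro ⟨_ | a, rfl⟩ <;> simp
      · rintro (rfl | ⟨h, a, ha⟩)
        · exact ⟨none, rfl⟩
        · refine ⟨some a, ?_⟩
          simp only [Option.elim_some, ha, Nat.pred_eq_sub_one]
          omega

theorem code_none : code (none : Option α) = 0 := rfl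

theorem code_some (a : α) : code (some a) = code a + 1 := rfl

instance : Numbered (α ⊕ β) where
  code x := x.elim (fun a => Nat.pair 0 (code a)) fun b => Nat.pair 1 (code b)
  code_injective := fun a b h => by
    cases a <;> cases b <;> simp [Nat.pair_eq_pair] at h ⊢ <;> exact code_injective h
  range := (((Sig.of_primrec (P := fun n => n = 0)
    (Primrec.eq.comp Primrec.id (Primrec.const 0))).comp primrec_unpair₁ |>.and
      ((range (α := α)).comp primrec_unpair₂)).or
    ((Sig.of_primrec (P := fun n => n = 1)
    (Primrec.eq.comp Primrec.id (Primrec.const 1))).comp primrec_unpair₁ |>.and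
      ((range (α := β)).comp primrec_unpair₂))).of_iff fun n => by
      constructor
      · rintro ⟨_ | a, rfl⟩ <;> simp
      · rintro (⟨h, a, ha⟩ | ⟨h, a, ha⟩)
        · exact ⟨.inl a, by simp [ha, ← h]⟩
        · exact ⟨.inr a, by simp [ha, ← h]⟩

theorem code_inl (a : α) : code (.inl a : α ⊕ β) = Nat.pair 0 (code a) := rfl

theorem code_inr (b : β) : code (.inr b : α ⊕ β) = Nat.pair 1 (code b) := rfl

/-- The bijections behind `Numbered.ofEquiv` act as the identity on codes. Through them, projections
and case distinctions on syntax are computable. -/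
theorem Eff.of_code_eq {f : α → β} (h : ∀ a, code (f a) = code a) : Eff f :=
  ⟨_, Primrec.id, fun a => (h a).symm⟩

@[fun_prop]
theorem Eff.inl {f : α → β} (hf : Eff f) : Eff fun a => (Sum.inl (f a) : β ⊕ γ) :=
  Eff.comp (f := Sum.inl) ⟨_, Primrec₂.natPair.comp (Primrec.const 0) Primrec.id,
    fun _ => rfl⟩ hf

@[fun_prop]
theorem Eff.inr {f : α → γ} (hf : Eff f) : Eff fun a => (Sum.inr (f a) : β ⊕ γ) :=
  Eff.comp (f := Sum.inr) ⟨_, Primrec₂.natPair.comp (Primrec.const 1) Primrec.id,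
    fun _ => rfl⟩ hf

theorem Eff.sum_elim {f : δ → α ⊕ β} {g : δ → α → γ} {h : δ → β → γ} (hf : Eff f)
    (hg : Eff fun x : δ × α => g x.1 x.2) (hh : Eff fun x : δ × β => h x.1 x.2) :
    Eff fun x => (f x).elim (g x) (h x) := by
  obtain ⟨F, hF, hf⟩ := hf
  obtain ⟨G, hG, hg⟩ := hg
  obtain ⟨H, hH, hh⟩ := hh
  refine ⟨fun n => if (F n).unpair.1 = 0 then G (Nat.pair n (F n).unpair.2)
    else H (Nat.pair n (F n).unpair.2), Primrec.ite (Primrec.eq.comp (primrec_unpair₁.comp hF)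
      (Primrec.const 0)) (hG.comp (Primrec₂.natPair.comp Primrec.id (primrec_unpair₂.comp hF)))
      (hH.comp (Primrec₂.natPair.comp Primrec.id (primrec_unpair₂.comp hF))), fun x => ?_⟩
  simp only [hf]
  cases h : f x with
  | inl a => simpa [code_inl, code_prod] using hg (x, a)
  | inr b => simpa [code_inr, code_prod] using hh (x, b)

@[fun_prop]
theorem Eff.succ {f : α → ℕ} (hf : Eff f) : Eff fun a => f a + 1 :=
  Eff.comp (f := Nat.succ) ⟨_, Primrec.succ, fun _ => rfl⟩ hf

@[fun_prop]
theorem Eff.add {f g : α → ℕ} (hf : Eff f) (hg : Eff g) : Eff fun a => f a + g a :=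
  Eff.comp (f := fun x : ℕ × ℕ => x.1 + x.2) ⟨fun n => n.unpair.1 + n.unpair.2,
    Primrec.nat_add.comp primrec_unpair₁ primrec_unpair₂,
    fun x => by simp [code_prod, show ∀ n : ℕ, code n = n from fun _ => rfl]⟩ (hf.pair hg)

@[fun_prop]
theorem Eff.some {f : α → β} (hf : Eff f) : Eff fun a => Option.some (f a) :=
  Eff.comp (f := Option.some) ⟨_, Primrec.succ, fun _ => rfl⟩ hf

@[fun_prop]
theorem Eff.getD {f : α → Option β} {g : α → β} (hf : Eff f) (hg : Eff g) :
    Eff fun a => (f a).getD (g a) := by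
  obtain ⟨F, hF, hf⟩ := hf
  obtain ⟨G, hG, hg⟩ := hg
  refine ⟨fun n => if F n = 0 then G n else (F n).pred, Primrec.ite (Primrec.eq.comp hF
    (Primrec.const 0)) hG (Primrec.pred.comp hF), fun a => ?_⟩
  simp only [hf, hg]
  cases f a <;> simp [code_none, code_some]

theorem Eff.ite_eq [DecidableEq β] {f g : α → β} {h k : α → γ} (hf : Eff f) (hg : Eff g)
    (hh : Eff h) (hk : Eff k) : Eff fun a => if f a = g a then h a else k a := by
  obtain ⟨F, hF, hf⟩ := hf
  obtain ⟨G, hG, hg⟩ := hg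
  obtain ⟨H, hH, hh⟩ := hh
  obtain ⟨K, hK, hk⟩ := hk
  refine ⟨fun n => if F n = G n then H n else K n, Primrec.ite (Primrec.eq.comp hF hG) hH hK,
    fun a => ?_⟩
  simp only [hf, hg, hh, hk, code_injective.eq_iff]
  split <;> rfl

@[fun_prop]
theorem Eff.cons {f : α → β} {g : α → List β} (hf : Eff f) (hg : Eff g) :
    Eff fun a => f a :: g a := by
  obtain ⟨F, hF, hf⟩ := hf
  obtain ⟨G, hG, hg⟩ := hg
  refine ⟨fun n => encode (F n :: ofNat (List ℕ) (G n)), Primrec.encode.comp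
    (Primrec.list_cons.comp hF ((Primrec.ofNat _).comp hG)), fun a => ?_⟩
  simp only [hf, hg, ofNat_code_list]
  rfl

@[fun_prop]
theorem Eff.append {f g : α → List β} (hf : Eff f) (hg : Eff g) :
    Eff fun a => f a ++ g a := by
  obtain ⟨F, hF, hf⟩ := hf
  obtain ⟨G, hG, hg⟩ := hg
  refine ⟨fun n => encode (ofNat (List ℕ) (F n) ++ ofNat (List ℕ) (G n)), Primrec.encode.comp
    (Primrec.list_append.comp ((Primrec.ofNat _).comp hF) ((Primrec.ofNat _).comp hG)),
    fun a => ?_⟩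
  simp only [hf, hg, ofNat_code_list, ← List.map_append]
  rfl

theorem Eff.map {f : α → List β} {g : α → β → γ} (hf : Eff f)
    (hg : Eff fun x : α × β => g x.1 x.2) : Eff fun a => (f a).map (g a) := by
  obtain ⟨F, hF, hf⟩ := hf
  obtain ⟨G, hG, hg⟩ := hg
  refine ⟨fun n => encode ((ofNat (List ℕ) (F n)).map fun m => G (Nat.pair n m)),
    Primrec.encode.comp (Primrec.list_map ((Primrec.ofNat _).comp hF)
    (hG.comp Primrec₂.natPair)), fun a => ?_⟩
  simp only [hf, ofNat_code_list, List.map_map]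
  rw [code_list, List.map_map]
  congr 1
  exact List.map_congr_left fun b _ => hg (a, b)

theorem Eff.flatMap {f : α → List β} {g : α → β → List γ} (hf : Eff f)
    (hg : Eff fun x : α × β => g x.1 x.2) : Eff fun a => (f a).flatMap (g a) := by
  obtain ⟨F, hF, hf⟩ := hf
  obtain ⟨G, hG, hg⟩ := hg
  refine ⟨fun n => encode ((ofNat (List ℕ) (F n)).flatMap fun m =>
    ofNat (List ℕ) (G (Nat.pair n m))), Primrec.encode.comp (Primrec.list_flatMap
    ((Primrec.ofNat _).comp hF) ((Primrec.ofNat _).comp (hG.comp Primrec₂.natPair))),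
    fun a => ?_⟩
  simp only [hf, ofNat_code_list]
  rw [code_list, List.map_flatMap, List.flatMap_map]
  congr 2
  funext b
  rw [← ofNat_code_list]
  exact congrArg _ (hg (a, b))

theorem Eff.foldr {f : α → List β} {z : α → γ} {g : α → β → γ → γ} (hf : Eff f) (hz : Eff z)
    (hg : Eff fun x : α × β × γ => g x.1 x.2.1 x.2.2) :
    Eff fun a => (f a).foldr (g a) (z a) := by
  obtain ⟨F, hF, hf⟩ := hf
  obtain ⟨Z, hZ, hz⟩ := hz
  obtain ⟨G, hG, hg⟩ := hg
  refine ⟨fun n => (ofNat (List ℕ) (F n)).foldr (fun b s => G (Nat.pair n (Nat.pair b s))) (Z n),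
    Primrec.list_foldr (h := fun n x => G (Nat.pair n (Nat.pair x.1 x.2)))
      ((Primrec.ofNat _).comp hF) hZ (hG.comp (Primrec₂.natPair.comp
      Primrec.fst (Primrec₂.natPair.comp (Primrec.fst.comp Primrec.snd)
      (Primrec.snd.comp Primrec.snd)))), fun a => ?_⟩
  simp only [hf, hz, ofNat_code_list]
  induction f a with
  | nil => rfl
  | cons b l ih =>
    simp only [List.map_cons, List.foldr_cons, ih]
    exact hg (a, b, _)

@[fun_prop]
theorem Eff.length {f : α → List β} (hf : Eff f) : Eff fun a => (f a).length :=
  Eff.comp (f := List.length) ⟨fun n => (ofNat (List ℕ) n).length, Primrec.list_length.comp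
    (Primrec.ofNat _), fun l => by simp only [ofNat_code_list, List.length_map]; rfl⟩ hf

@[fun_prop]
theorem Eff.range {f : α → ℕ} (hf : Eff f) : Eff fun a => List.range (f a) :=
  Eff.comp (f := List.range) ⟨fun n => encode (List.range n), Primrec.encode.comp
    Primrec.list_range, fun n => by
      rw [code_list, show (code : ℕ → ℕ) = fun n => n from rfl, List.map_id']⟩ hf

theorem RE.of_iff {p q : α → Prop} (h : RE p) (e : ∀ a, q a ↔ p a) : RE q := by
  obtain ⟨P, hP, h⟩ := h
  exact ⟨P, hP, fun a => (e a).trans (h a)⟩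

theorem RE.comp {p : β → Prop} (h : RE p) {f : α → β} (hf : Eff f) : RE fun a => p (f a) := by
  obtain ⟨P, hP, h⟩ := h
  obtain ⟨F, hF, hf⟩ := hf
  exact ⟨fun n => P (F n), hP.comp hF, fun a => by simp only [h, hf]⟩

theorem RE.and {p q : α → Prop} (hp : RE p) (hq : RE q) : RE fun a => p a ∧ q a := by
  obtain ⟨P, hP, hp⟩ := hp
  obtain ⟨Q, hQ, hq⟩ := hq
  exact ⟨_, hP.and hQ, fun a => by simp only [hp, hq]⟩

theorem RE.or {p q : α → Prop} (hp : RE p) (hq : RE q) : RE fun a => p a ∨ q a := by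
  obtain ⟨P, hP, hp⟩ := hp
  obtain ⟨Q, hQ, hq⟩ := hq
  exact ⟨_, hP.or hQ, fun a => by simp only [hp, hq]⟩

theorem RE.ex {p : α → β → Prop} (h : RE fun x : α × β => p x.1 x.2) :
    RE fun a => ∃ b, p a b := by
  obtain ⟨P, hP, h⟩ := h
  refine ⟨_, (((Numbered.range (α := β)).comp primrec_unpair₂).and hP).ex, fun a => ?_⟩
  simp only [Nat.unpair_pair]
  constructor
  · rintro ⟨b, hb⟩
    exact ⟨code b, ⟨b, rfl⟩, (h (a, b)).1 hb⟩
  · rintro ⟨_, ⟨b, rfl⟩, hb⟩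
    exact ⟨b, (h (a, b)).2 hb⟩

theorem RE.const (p : Prop) : RE fun _ : α => p :=
  ⟨fun _ => p, Sig.of_primrec (by
    by_cases h : p
    · exact (Primrec.eq.comp (Primrec.const 0) (Primrec.const 0)).of_eq (by simp [h])
    · exact (Primrec.eq.comp (Primrec.const 0) (Primrec.const 1)).of_eq (by simp [h])),
    fun _ => Iff.rfl⟩

theorem RE.ball {f : α → List β} (hf : Eff f) {p : α → β → Prop}
    (h : RE fun x : α × β => p x.1 x.2) : RE fun a => ∀ b ∈ f a, p a b := by
  obtain ⟨P, hP, h⟩ := h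
  obtain ⟨F, hF, hf⟩ := hf
  refine ⟨_, hP.ball.comp (Primrec₂.natPair.comp Primrec.id hF), fun a => ?_⟩
  simp only [Nat.unpair_pair, hf, ofNat_code_list, List.forall_mem_map, id]
  exact forall₂_congr fun b _ => h (a, b)

theorem Rec.eq {f g : α → β} (hf : Eff f) (hg : Eff g) : Rec fun a => f a = g a := by
  obtain ⟨F, hF, hf⟩ := hf
  obtain ⟨G, hG, hg⟩ := hg
  exact ⟨⟨fun n => F n = G n, Sig.of_primrec (Primrec.eq.comp hF hG), fun a => by
    simp only [hf, hg, code_injective.eq_iff]⟩, ⟨fun n => ¬ F n = G n, Sig.of_primrec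
    (Primrec.eq.comp hF hG).not, fun a => by simp only [hf, hg, code_injective.eq_iff]⟩⟩

theorem Rec.lt {f g : α → ℕ} (hf : Eff f) (hg : Eff g) : Rec fun a => f a < g a := by
  obtain ⟨F, hF, hf⟩ := hf
  obtain ⟨G, hG, hg⟩ := hg
  exact ⟨⟨fun n => F n < G n, Sig.of_primrec (Primrec.nat_lt.comp hF hG), fun a => by
    simp only [hf, hg]; rfl⟩, ⟨fun n => ¬ F n < G n, Sig.of_primrec
    (Primrec.nat_lt.comp hF hG).not, fun a => by simp only [hf, hg]; rfl⟩⟩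

theorem Rec.re {p : α → Prop} (h : Rec p) : RE p := h.1

theorem Rec.of_iff {p q : α → Prop} (h : Rec p) (e : ∀ a, q a ↔ p a) : Rec q :=
  ⟨h.1.of_iff e, h.2.of_iff fun a => not_congr (e a)⟩

theorem Rec.comp {p : β → Prop} (h : Rec p) {f : α → β} (hf : Eff f) : Rec fun a => p (f a) :=
  ⟨h.1.comp hf, h.2.comp hf⟩

theorem Rec.not {p : α → Prop} (h : Rec p) : Rec fun a => ¬ p a :=
  ⟨h.2, h.1.of_iff fun _ => not_not⟩

theorem Rec.and {p q : α → Prop} (hp : Rec p) (hq : Rec q) : Rec fun a => p a ∧ q a :=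
  ⟨hp.1.and hq.1, (hp.2.or hq.2).of_iff fun _ => not_and_or⟩

theorem Rec.or {p q : α → Prop} (hp : Rec p) (hq : Rec q) : Rec fun a => p a ∨ q a :=
  ⟨hp.1.or hq.1, (hp.2.and hq.2).of_iff fun _ => not_or⟩

theorem Rec.imp {p q : α → Prop} (hp : Rec p) (hq : Rec q) : Rec fun a => p a → q a :=
  (hp.not.or hq).of_iff fun _ => imp_iff_not_or

theorem Rec.iff {p q : α → Prop} (hp : Rec p) (hq : Rec q) : Rec fun a => p a ↔ q a :=
  ((hp.imp hq).and (hq.imp hp)).of_iff fun _ => iff_iff_implies_and_implies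

theorem Rec.const (p : Prop) : Rec fun _ : α => p := ⟨RE.const _, RE.const _⟩

/-- The premise has to be decidable because its failure is one of the two things searched for. -/
theorem RE.imp {p q : α → Prop} (hp : Rec p) (hq : RE q) : RE fun a => p a → q a :=
  (hp.2.or hq).of_iff fun _ => imp_iff_not_or

theorem Rec.of_primrecPred {p : α → Prop} {P : ℕ → Prop} (hP : PrimrecPred P)
    (h : ∀ a, p a ↔ P (code a)) : Rec p :=
  ⟨⟨P, Sig.of_primrec hP, h⟩, ⟨_, Sig.of_primrec hP.not, fun a => not_congr (h a)⟩⟩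

theorem Rec.mem {f : α → β} {g : α → List β} (hf : Eff f) (hg : Eff g) :
    Rec fun a => f a ∈ g a := by
  obtain ⟨F, hF, hf⟩ := hf
  obtain ⟨G, hG, hg⟩ := hg
  refine Rec.of_primrecPred (P := fun n => ∃ m ∈ ofNat (List ℕ) (G n), m = F n)
    ((PrimrecRel.exists_mem_list (R := fun m n => m = n) Primrec.eq).comp
      ((Primrec.ofNat _).comp hG) hF) fun a => ?_
  simp only [hf, hg, ofNat_code_list, exists_eq_right, List.mem_map_of_injective code_injective]

theorem RE.bex {f : α → List β} (hf : Eff f) {p : α → β → Prop}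
    (h : RE fun x : α × β => p x.1 x.2) : RE fun a => ∃ b ∈ f a, p a b :=
  RE.ex ((Rec.mem (by fun_prop) (by fun_prop)).re.and h)

theorem Rec.ball {f : α → List β} (hf : Eff f) {p : α → β → Prop}
    (h : Rec fun x : α × β => p x.1 x.2) : Rec fun a => ∀ b ∈ f a, p a b :=
  ⟨RE.ball hf h.1, (RE.bex (p := fun a b => ¬ p a b) hf h.2).of_iff fun _ => by simp⟩

theorem Rec.bex {f : α → List β} (hf : Eff f) {p : α → β → Prop}
    (h : Rec fun x : α × β => p x.1 x.2) : Rec fun a => ∃ b ∈ f a, p a b :=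
  ⟨RE.bex hf h.1, (RE.ball (p := fun a b => ¬ p a b) hf h.2).of_iff fun _ => by simp⟩

theorem RE.sum_elim {f : δ → α ⊕ β} {g : δ → α → Prop} {h : δ → β → Prop} (hf : Eff f)
    (hg : RE fun x : δ × α => g x.1 x.2) (hh : RE fun x : δ × β => h x.1 x.2) :
    RE fun x => (f x).elim (g x) (h x) :=
  ((RE.ex (p := fun x a => f x = .inl a ∧ g x a)
    ((Rec.eq (by fun_prop) (by fun_prop)).re.and hg)).or
    (RE.ex (p := fun x b => f x = .inr b ∧ h x b)
    ((Rec.eq (by fun_prop) (by fun_prop)).re.and hh))).of_iff fun x => by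
      cases f x <;> simp

theorem Rec.sum_elim {f : δ → α ⊕ β} {g : δ → α → Prop} {h : δ → β → Prop} (hf : Eff f)
    (hg : Rec fun x : δ × α => g x.1 x.2) (hh : Rec fun x : δ × β => h x.1 x.2) :
    Rec fun x => (f x).elim (g x) (h x) :=
  ⟨RE.sum_elim hf hg.1 hh.1, (RE.sum_elim (g := fun x a => ¬ g x a) (h := fun x b => ¬ h x b)
    hf hg.2 hh.2).of_iff fun x => by beta_reduce; cases f x <;> simp⟩

end Semidecidable

/-! ### Derivations by rules, and reachability. -/

section Derivations

open Numbered

/-- Derivability by the rules `R`, where `R y ps` allows to infer `y` from the premises `ps`. -/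
inductive Derivable {J : Type} (R : J → List J → Prop) : J → Prop
  | intro (y : J) (ps : List J) : R y ps → (∀ x ∈ ps, Derivable R x) → Derivable R y

/-- `l` lists judgements with ranks, each inferred from judgements in `l` of lower rank. -/
def IsDerivation {J : Type} (R : J → List J → Prop) (l : List (J × ℕ)) : Prop :=
  ∀ y ∈ l, ∃ ps : List J, R y.1 ps ∧ ∀ x ∈ ps, ∃ z ∈ l, z.1 = x ∧ z.2 < y.2

/-- Induction on the rank, which drops from a conclusion to its premises and so excludes circular
inferences. -/
theorem IsDerivation.derivable {J : Type} {R : J → List J → Prop} {l : List (J × ℕ)}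
    (h : IsDerivation R l) {y : J × ℕ} (hy : y ∈ l) : Derivable R y.1 := by
  induction hr : y.2 using Nat.strong_induction_on generalizing y with
  | _ n ih =>
    obtain ⟨ps, h1, h2⟩ := h y hy
    refine ⟨_, ps, h1, fun x hx => ?_⟩
    obtain ⟨z, hz, rfl, hlt⟩ := h2 x hx
    exact ih _ (hr ▸ hlt) hz rfl

/-- Concatenation keeps each entry supported, since premises are sought in the whole list. The
number `m` exceeds the ranks of the entries chosen for `ps` and can be the rank of a conclusion from
them. -/
theorem exists_isDerivation_of_forall {J : Type} {R : J → List J → Prop} (ps : List J)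
    (h : ∀ x ∈ ps, ∃ l n, IsDerivation R l ∧ (x, n) ∈ l) :
    ∃ l m, IsDerivation R l ∧ ∀ x ∈ ps, ∃ n < m, (x, n) ∈ l := by
  induction ps with
  | nil => exact ⟨[], 0, by simp [IsDerivation], by simp⟩
  | cons x ps ih =>
    obtain ⟨l, m, hl, hm⟩ := ih fun y hy => h y (List.mem_cons_of_mem _ hy)
    obtain ⟨l', n, hl', hn⟩ := h x List.mem_cons_self
    refine ⟨l' ++ l, max m (n + 1), fun y hy => ?_, fun y hy => ?_⟩
    · rcases List.mem_append.1 hy with hy | hy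
      · obtain ⟨qs, h1, h2⟩ := hl' y hy
        refine ⟨qs, h1, fun z hz => ?_⟩
        obtain ⟨w, hw, h⟩ := h2 z hz
        exact ⟨w, List.mem_append_left _ hw, h⟩
      · obtain ⟨qs, h1, h2⟩ := hl y hy
        refine ⟨qs, h1, fun z hz => ?_⟩
        obtain ⟨w, hw, h⟩ := h2 z hz
        exact ⟨w, List.mem_append_right _ hw, h⟩
    · rcases List.mem_cons.1 hy with rfl | hy
      · exact ⟨n, by omega, List.mem_append_left _ hn⟩
      · obtain ⟨k, hk, h⟩ := hm y hy
        exact ⟨k, by omega, List.mem_append_right _ h⟩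

theorem Derivable.exists_isDerivation {J : Type} {R : J → List J → Prop} {y : J}
    (h : Derivable R y) : ∃ l n, IsDerivation R l ∧ (y, n) ∈ l := by
  induction h with
  | intro y ps hR _ ih =>
    obtain ⟨l, m, hl, hm⟩ := exists_isDerivation_of_forall ps ih
    refine ⟨(y, m) :: l, m, fun z hz => ?_, List.mem_cons_self⟩
    rcases List.mem_cons.1 hz with rfl | hz
    · refine ⟨ps, hR, fun x hx => ?_⟩
      obtain ⟨n, hn, h⟩ := hm x hx
      exact ⟨(x, n), List.mem_cons_of_mem _ h, rfl, hn⟩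
    · obtain ⟨qs, h1, h2⟩ := hl z hz
      refine ⟨qs, h1, fun x hx => ?_⟩
      obtain ⟨w, hw, h⟩ := h2 x hx
      exact ⟨w, List.mem_cons_of_mem _ hw, h⟩

variable {γ J α : Type} [Numbered γ] [Numbered J] [Numbered α]

/-- A derivation is a finite object that can be guessed and then checked. -/
theorem RE.derivable {R : γ → J → List J → Prop}
    (hR : RE fun x : γ × J × List J => R x.1 x.2.1 x.2.2) :
    RE fun x : γ × J => Derivable (R x.1) x.2 := by
  refine RE.of_iff (p := fun x : γ × J => ∃ l : List (J × ℕ), (∃ y ∈ l, y.1 = x.2) ∧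
    ∀ y ∈ l, ∃ ps : List J, R x.1 y.1 ps ∧ ∀ w ∈ ps, ∃ z ∈ l, z.1 = w ∧ z.2 < y.2) ?_ fun x => ?_
  · refine RE.ex (RE.and (RE.bex (by fun_prop) (Rec.eq (by fun_prop) (by fun_prop)).re)
      (RE.ball (by fun_prop) (RE.ex (RE.and
      (hR.comp (show Eff fun x : (((γ × J) × List (J × ℕ)) × (J × ℕ)) × List J =>
        (x.1.1.1.1, x.1.2.1, x.2) by fun_prop)) (RE.ball (by fun_prop)
      (RE.bex (by fun_prop) (RE.and (Rec.eq (by fun_prop) (by fun_prop)).re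
        (Rec.lt (by fun_prop) (by fun_prop)).re)))))))
  · constructor
    · intro h
      obtain ⟨l, n, hl, hy⟩ := h.exists_isDerivation
      exact ⟨l, ⟨_, hy, rfl⟩, hl⟩
    · rintro ⟨l, ⟨y, hy, h⟩, hl⟩
      exact h ▸ IsDerivation.derivable hl hy

/-- Recursive predicates by recursion along rules: if the truth values `R c a b ps` says that the
truth value of `p c a` is `b` provided those of `p c` at the premises are as listed in `ps`. -/
theorem Rec.of_rules {p : γ → α → Prop} (R : γ → α → Bool → List (α × Bool) → Prop)
    (size : α → ℕ) (hR : RE fun x : γ × (α × Bool) × List (α × Bool) => R x.1 x.2.1.1 x.2.1.2 x.2.2)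
    (sound : ∀ c a b ps, R c a b ps → (∀ x ∈ ps, (p c x.1 ↔ x.2 = true)) → (p c a ↔ b = true))
    (total : ∀ c a b, (p c a ↔ b = true) →
      ∃ ps, R c a b ps ∧ ∀ x ∈ ps, (p c x.1 ↔ x.2 = true) ∧ size x.1 < size a) :
    Rec fun x : γ × α => p x.1 x.2 := by
  have h1 := RE.derivable (R := fun c (y : α × Bool) ps => R c y.1 y.2 ps) hR
  -- By `sound`, derivable judgements are true; by `total` and induction on `size`, true judgements
  -- are derivable. The judgements with value `false` therefore enumerate the complement.
  have h2 : ∀ c y, Derivable (fun (y : α × Bool) ps => R c y.1 y.2 ps) y ↔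
      (p c y.1 ↔ y.2 = true) := by
    intro c y
    constructor
    · intro h
      induction h with
      | intro y ps hR _ ih => exact sound c _ _ ps hR ih
    · intro h
      induction hn : size y.1 using Nat.strong_induction_on generalizing y with
      | _ n ih =>
        obtain ⟨ps, hr, hps⟩ := total c y.1 y.2 h
        exact ⟨_, ps, hr, fun x hx => ih _ (hn ▸ (hps x hx).2) x (hps x hx).1 rfl⟩
  constructor
  · refine (h1.comp (f := fun x : γ × α => (x.1, x.2, true)) (by fun_prop)).of_iff fun x => ?_
    simp [h2]
  · refine (h1.comp (f := fun x : γ × α => (x.1, x.2, false)) (by fun_prop)).of_iff fun x => ?_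
    simp [h2]

theorem RE.reflTransGen {step : γ → α → α → Prop}
    (h : RE fun x : γ × α × α => step x.1 x.2.1 x.2.2) :
    RE fun x : γ × α × α => Relation.ReflTransGen (step x.1) x.2.1 x.2.2 := by
  have h1 := RE.derivable (γ := γ × α) (J := α)
    (R := fun c y ps => y = c.2 ∧ ps = [] ∨ ∃ z, ps = [z] ∧ step c.1 z y)
    ((RE.and (Rec.eq (by fun_prop) (by fun_prop)).re (Rec.eq (by fun_prop) (by fun_prop)).re).or
      (RE.ex (RE.and (Rec.eq (by fun_prop) (by fun_prop)).re
      (h.comp (show Eff fun x : ((γ × α) × α × List α) × α => (x.1.1.1, x.2, x.1.2.1)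
        by fun_prop)))))
  refine (h1.comp (f := fun x : γ × α × α => ((x.1, x.2.1), x.2.2)) (by fun_prop)).of_iff
    fun ⟨c, a, b⟩ => ?_
  dsimp only
  constructor
  · intro h
    induction h with
    | refl => exact ⟨_, [], .inl ⟨rfl, rfl⟩, by simp⟩
    | tail _ hs ih => exact ⟨_, _, .inr ⟨_, rfl, hs⟩, by simpa using ih⟩
  · intro h
    induction h with
    | intro y ps hr _ ih =>
      rcases hr with ⟨rfl, _⟩ | ⟨z, rfl, hs⟩
      · exact .refl
      · exact (ih z (by simp)).tail hs

/-- Unreachability has a finite certificate: a list that contains the source, omits the target and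
is closed under steps into `succs`. The reachable part is such a list, because `succs` contains
everything that is reached in at least one step. -/
theorem Rec.reflTransGen {step : γ → α → α → Prop} {succs : γ × α → List α} (hs : Eff succs)
    (h : Rec fun x : γ × α × α => step x.1 x.2.1 x.2.2)
    (mem : ∀ c a b d, Relation.ReflTransGen (step c) a b → step c b d → d ∈ succs (c, a)) :
    Rec fun x : γ × α × α => Relation.ReflTransGen (step x.1) x.2.1 x.2.2 := by
  refine ⟨RE.reflTransGen h.1, RE.of_iff (p := fun x : γ × α × α => ∃ l : List α, x.2.1 ∈ l ∧
    x.2.2 ∉ l ∧ ∀ a ∈ l, ∀ b ∈ succs (x.1, x.2.1), step x.1 a b → b ∈ l) ?_ fun x => ?_⟩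
  · exact RE.ex (RE.and (Rec.mem (by fun_prop) (by fun_prop)).re
      (RE.and (Rec.mem (by fun_prop) (by fun_prop)).not.re (RE.ball (by fun_prop)
      (RE.ball (by fun_prop) (RE.imp (h.comp
        (show Eff fun x : (((γ × α × α) × List α) × α) × α => (x.1.1.1.1, x.1.2, x.2) by fun_prop))
        (Rec.mem (by fun_prop) (by fun_prop)).re)))))
  · classical
    obtain ⟨c, a, b⟩ := x
    constructor
    · intro hn
      refine ⟨(a :: succs (c, a)).filter fun z => Relation.ReflTransGen (step c) a z,
        by simp [Relation.ReflTransGen.refl], by simp [hn], fun z hz w hw hst => ?_⟩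
      simp only [List.mem_filter, decide_eq_true_eq] at hz ⊢
      exact ⟨List.mem_cons_of_mem _ hw, hz.2.tail hst⟩
    · rintro ⟨l, ha, hb, hl⟩ hr
      have : ∀ z, Relation.ReflTransGen (step c) a z → z ∈ l := by
        intro z hz
        induction hz with
        | refl => exact ha
        | tail h1 h2 ih => exact hl _ ih _ (mem _ _ _ _ h1 h2) h2
      exact hb (this _ hr)

end Derivations

/-! ### Finite search spaces, association lists, and parallel search. -/

section Finite

variable {α β γ κ : Type} [Numbered α] [Numbered β] [Numbered γ] [Numbered κ]

/-- All assignments of elements of `ys` to the entries of `xs`. -/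
def assigns {α β : Type} (xs : List α) (ys : List β) : List (List (α × β)) :=
  xs.foldr (fun x ls => ls.flatMap fun l => ys.map fun y => (x, y) :: l) [[]]

theorem mem_assigns {α β : Type} {xs : List α} {ys : List β} {l : List (α × β)} :
    l ∈ assigns xs ys ↔ l.map Prod.fst = xs ∧ ∀ p ∈ l, p.2 ∈ ys := by
  induction xs generalizing l with
  | nil => simp +contextual [assigns]
  | cons x xs ih =>
    have : assigns (x :: xs) ys =
      (assigns xs ys).flatMap fun l => ys.map fun y => (x, y) :: l := rfl
    rw [this]
    simp only [List.mem_flatMap, List.mem_map, ih]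
    constructor
    · rintro ⟨l, ⟨rfl, h⟩, y, hy, rfl⟩
      exact ⟨rfl, by simpa [hy] using h⟩
    · rintro ⟨h1, h2⟩
      cases l with
      | nil => simp at h1
      | cons p l =>
        simp only [List.map_cons, List.cons.injEq] at h1
        exact ⟨l, ⟨h1.2, fun q hq => h2 q (List.mem_cons_of_mem _ hq)⟩, p.2,
          h2 p List.mem_cons_self, by rw [← h1.1]⟩

@[fun_prop]
theorem Eff.assigns {f : γ → List α} {g : γ → List β} (hf : Eff f) (hg : Eff g) :
    Eff fun x => assigns (f x) (g x) :=
  Eff.foldr hf (by fun_prop) (Eff.flatMap (by fun_prop) (Eff.map (by fun_prop) (by fun_prop)))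

/-- The sublists of a list. -/
def sublists {α : Type} (l : List α) : List (List α) :=
  l.foldr (fun x ls => ls ++ ls.map fun l => x :: l) [[]]

theorem mem_sublists {α : Type} {l s : List α} : s ∈ sublists l ↔ s.Sublist l := by
  induction l generalizing s with
  | nil => simp [sublists]
  | cons x l ih =>
    have : sublists (x :: l) = sublists l ++ (sublists l).map fun s => x :: s := rfl
    rw [this, List.mem_append, ih, List.sublist_cons_iff]
    simp [ih, eq_comm, and_comm]

@[fun_prop]
theorem Eff.sublists {f : γ → List α} (hf : Eff f) : Eff fun x => sublists (f x) :=
  Eff.foldr hf (by fun_prop) (Eff.append (by fun_prop) (Eff.map (by fun_prop) (by fun_prop)))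

/-- Lookup in an association list. -/
def look {κ β : Type} [DecidableEq κ] (l : List (κ × β)) (k : κ) : Option β :=
  l.foldr (fun p o => if p.1 = k then some p.2 else o) none

@[simp]
theorem look_nil {κ β : Type} [DecidableEq κ] (k : κ) : look ([] : List (κ × β)) k = none := rfl

theorem look_cons {κ β : Type} [DecidableEq κ] (p : κ × β) (l : List (κ × β)) (k : κ) :
    look (p :: l) k = if p.1 = k then some p.2 else look l k := rfl

theorem look_append {κ β : Type} [DecidableEq κ] (l l' : List (κ × β)) (k : κ) :
    look (l ++ l') k = (look l k).or (look l' k) := by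
  induction l with
  | nil => rfl
  | cons p l ih =>
    rw [List.cons_append, look_cons, look_cons, ih]
    split <;> rfl

theorem mem_of_look {κ β : Type} [DecidableEq κ] {l : List (κ × β)} {k : κ} {b : β}
    (h : look l k = some b) : (k, b) ∈ l := by
  induction l with
  | nil => simp at h
  | cons p l ih =>
    rw [look_cons] at h
    split at h
    · rename_i hk
      obtain rfl := Option.some_inj.1 h
      exact hk ▸ List.mem_cons_self
    · exact List.mem_cons_of_mem _ (ih h)

theorem look_eq_none_iff {κ β : Type} [DecidableEq κ] {l : List (κ × β)} {k : κ} :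
    look l k = none ↔ k ∉ l.map Prod.fst := by
  induction l with
  | nil => simp
  | cons p l ih =>
    rw [look_cons]
    split <;> simp_all [eq_comm]

theorem look_map {κ β : Type} [DecidableEq κ] (xs : List κ) (f : κ → β) (k : κ) :
    look (xs.map fun x => (x, f x)) k = if k ∈ xs then some (f k) else none := by
  induction xs with
  | nil => rfl
  | cons x xs ih =>
    rw [List.map_cons, look_cons, ih]
    by_cases h : x = k
    · simp [h]
    · simp [h, Ne.symm h]

@[fun_prop]
theorem Eff.look [DecidableEq κ] {f : γ → List (κ × β)} {g : γ → κ} (hf : Eff f) (hg : Eff g) :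
    Eff fun x => look (f x) (g x) :=
  Eff.foldr hf (by fun_prop) (Eff.ite_eq (by fun_prop) (by fun_prop) (by fun_prop) (by fun_prop))

-- Two searches in parallel: stage `k` tests `k` as a witness for either side. Under the promise one
-- of them succeeds, and as both are sound it does not matter which one is found first.
open Numbered in
theorem decidableOn_of_re {promise yes py pn : α → Prop} (hy : RE py) (hn : RE pn)
    (total : ∀ a, promise a → py a ∨ pn a) (sound : ∀ a, promise a → py a → yes a)
    (sound' : ∀ a, promise a → pn a → ¬ yes a) : DecidableOn code promise yes := by
  classical
  obtain ⟨_, ⟨q, hq, hq'⟩, hy⟩ := hy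
  obtain ⟨_, ⟨r, hr, hr'⟩, hn⟩ := hn
  refine ⟨fun n => Nat.rfindOpt fun k => if q n k then some true else if r n k then some false
    else none, Partrec.rfindOpt ?_, fun a ha => ?_⟩
  · exact (Primrec.ite hq (Primrec.const _)
      (Primrec.ite hr (Primrec.const _) (Primrec.const _))).to_comp
  · have hd : (Nat.rfindOpt fun k => if q (code a) k then some true else
        if r (code a) k then some false else none).Dom := by
      rw [Nat.rfindOpt_dom]
      rcases total a ha with h | h
      · obtain ⟨k, hk⟩ := (hq' _).1 ((hy a).1 h)
        exact ⟨k, true, by simp [hk]⟩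
      · obtain ⟨k, hk⟩ := (hr' _).1 ((hn a).1 h)
        by_cases hk' : q (code a) k
        · exact ⟨k, true, by simp [hk']⟩
        · exact ⟨k, false, by simp [hk', hk]⟩
    refine ⟨_, Part.get_mem hd, ?_⟩
    obtain ⟨k, hk⟩ := Nat.rfindOpt_spec (Part.get_mem hd)
    generalize (Nat.rfindOpt _).get hd = b at hk
    split at hk
    · rename_i h
      have := sound a ha ((hy a).2 ((hq' _).2 ⟨k, h⟩))
      simp_all
    · split at hk
      · rename_i h
        have := sound' a ha ((hn a).2 ((hr' _).2 ⟨k, h⟩))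
        simp_all
      · simp at hk

end Finite

/-! ### Numberings of the syntax. -/

section SyntaxCodes

open Numbered

variable {α β γ δ : Type} [Numbered α] [Numbered β] [Numbered γ] [Numbered δ]

@[fun_prop]
theorem Eff.code {f : α → β} (hf : Eff f) : Eff fun a => Numbered.code (f a) := by
  obtain ⟨F, hF, hf⟩ := hf
  exact ⟨F, hF, hf⟩

@[fun_prop]
theorem Eff.unpair₁ {f : α → ℕ} (hf : Eff f) : Eff fun a => (f a).unpair.1 := by
  obtain ⟨F, hF, hf⟩ := hf
  exact ⟨_, primrec_unpair₁.comp hF, fun a => by simp only [hf]; rfl⟩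

@[fun_prop]
theorem Eff.unpair₂ {f : α → ℕ} (hf : Eff f) : Eff fun a => (f a).unpair.2 := by
  obtain ⟨F, hF, hf⟩ := hf
  exact ⟨_, primrec_unpair₂.comp hF, fun a => by simp only [hf]; rfl⟩

theorem Eff.congr {f g : α → β} (h : Eff f) (e : ∀ a, f a = g a) : Eff g := funext e ▸ h

theorem Eff.of_code_eq_pair {c : α → β} (k : ℕ) (h : ∀ a, Numbered.code (c a) = Nat.pair k (Numbered.code a))
    {f : γ → α} (hf : Eff f) : Eff fun x => c (f x) :=
  Eff.comp (f := c) ⟨_, Primrec₂.natPair.comp (Primrec.const k) Primrec.id,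
    fun a => (h a).symm⟩ hf

def Role.equiv : Role ≃ ℕ ⊕ ℕ where
  toFun | .name P => .inl P | .inv P => .inr P
  invFun | .inl P => .name P | .inr P => .inv P
  left_inv R := by cases R <;> rfl
  right_inv R := by cases R <;> rfl

instance : Numbered Role := .ofEquiv Role.equiv Role.code fun R => by cases R <;> rfl

def BConcept.equiv : BConcept ≃ ℕ ⊕ Role where
  toFun | .name P => .inl P | .ex P => .inr P
  invFun | .inl P => .name P | .inr P => .ex P
  left_inv R := by cases R <;> rfl
  right_inv R := by cases R <;> rfl

instance : Numbered BConcept := .ofEquiv BConcept.equiv BConcept.code fun B => by cases B <;> rfl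

def TBox.equiv : TBox ≃ List (BConcept × BConcept) × List (BConcept × BConcept) × List Role where
  toFun T := (T.pos, T.neg, T.funct)
  invFun x := ⟨x.1, x.2.1, x.2.2⟩

instance : Numbered TBox := .ofEquiv TBox.equiv TBox.code fun _ => rfl

def Assertion.equiv (τ : Type) : Assertion τ ≃ (ℕ × τ) ⊕ (ℕ × τ × τ) where
  toFun | .conc N t => .inl (N, t) | .role P t u => .inr (P, t, u)
  invFun | .inl x => .conc x.1 x.2 | .inr x => .role x.1 x.2.1 x.2.2
  left_inv R := by cases R <;> rfl
  right_inv R := by cases R <;> rfl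

instance : Numbered (Assertion α) :=
  .ofEquiv (Assertion.equiv α) (Assertion.code code) fun F => by cases F <;> rfl

def QTerm.equiv : QTerm ≃ ℕ ⊕ ℕ where
  toFun | .const P => .inl P | .var P => .inr P
  invFun | .inl P => .const P | .inr P => .var P
  left_inv R := by cases R <;> rfl
  right_inv R := by cases R <;> rfl

instance : Numbered QTerm := .ofEquiv QTerm.equiv QTerm.code fun B => by cases B <;> rfl

def CQ.equiv : CQ ≃ List ℕ × List (Assertion QTerm) where
  toFun d := (d.evars, d.atoms)
  invFun x := ⟨x.1, x.2⟩

instance : Numbered CQ := .ofEquiv CQ.equiv CQ.code fun _ => rfl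

/-- A set of numbers that is generated by a recursively enumerable set of rules. -/
theorem sig_derivable {R : ℕ → List ℕ → Prop} (hR : RE fun x : ℕ × List ℕ => R x.1 x.2) :
    Sig (Derivable R) := by
  obtain ⟨P, hP, h⟩ := RE.derivable (γ := ℕ) (R := fun _ => R)
    (hR.comp (show Eff fun x : ℕ × ℕ × List ℕ => x.2 by fun_prop))
  exact (hP.comp (Primrec₂.natPair.comp (Primrec.const 0) Primrec.id)).of_iff fun n => h (0, n)

theorem ECQ.code_injective : Function.Injective ECQ.code := by
  intro Q
  induction Q with
  | ucq q =>
    rintro (_ | _ | _ | _) h <;> simp [ECQ.code, Nat.pair_eq_pair] at h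
    exact congrArg _ (Numbered.code_injective (α := List CQ) h)
  | neg Q ih =>
    rintro (_ | _ | _ | _) h <;> simp [ECQ.code, Nat.pair_eq_pair] at h
    rw [ih h]
  | and Q Q' ih ih' =>
    rintro (_ | _ | _ | _) h <;> simp [ECQ.code, Nat.pair_eq_pair] at h
    rw [ih h.1, ih' h.2]
  | ex x Q ih =>
    rintro (_ | _ | _ | _) h <;> simp [ECQ.code, Nat.pair_eq_pair] at h
    rw [h.1, ih h.2]

/-- The codes are generated by one rule per constructor. Codes of subqueries are recovered by
unpairing, so the rules form an enumerable set. -/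
theorem ECQ.sig_range_code : Sig fun n => ∃ Q : ECQ, Q.code = n := by
  refine (sig_derivable (R := fun n ps =>
    (n.unpair.1 = 0 ∧ (∃ q : List CQ, Numbered.code q = n.unpair.2) ∧ ps = []) ∨
    (n.unpair.1 = 1 ∧ ps = [n.unpair.2]) ∨
    (n.unpair.1 = 2 ∧ ps = [n.unpair.2.unpair.1, n.unpair.2.unpair.2]) ∨
    (n.unpair.1 = 3 ∧ ps = [n.unpair.2.unpair.2])) ?_).of_iff fun n => ?_
  · refine .or (.and (Rec.eq ?_ ?_).re (.and (RE.ex (Rec.eq ?_ ?_).re) (Rec.eq ?_ ?_).re))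
      (.or (.and (Rec.eq ?_ ?_).re (Rec.eq ?_ ?_).re) (.or (.and (Rec.eq ?_ ?_).re (Rec.eq ?_ ?_).re)
      (.and (Rec.eq ?_ ?_).re (Rec.eq ?_ ?_).re))) <;> fun_prop
  · constructor
    · rintro ⟨Q, rfl⟩
      induction Q with
      | ucq q => exact ⟨_, [], .inl ⟨by simp [ECQ.code], ⟨q, by simp [ECQ.code]; rfl⟩, rfl⟩, by simp⟩
      | neg Q ih => exact ⟨_, [Q.code], by simp [ECQ.code], by simpa using ih⟩
      | and Q Q' ih ih' => exact ⟨_, [Q.code, Q'.code], by simp [ECQ.code], by simpa using ⟨ih, ih'⟩⟩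
      | ex x Q ih => exact ⟨_, [Q.code], by simp [ECQ.code], by simpa using ih⟩
    · intro h
      induction h with
      | intro n ps h _ ih =>
        rcases h with ⟨h, ⟨q, hq⟩, rfl⟩ | ⟨h, rfl⟩ | ⟨h, rfl⟩ | ⟨h, rfl⟩
        · exact ⟨.ucq q, by rw [← Nat.pair_unpair n, h, ← hq]; rfl⟩
        · obtain ⟨Q, hQ⟩ := ih n.unpair.2 (by simp)
          exact ⟨.neg Q, by rw [← Nat.pair_unpair n, h, ← hQ]; rfl⟩
        · obtain ⟨Q, hQ⟩ := ih n.unpair.2.unpair.1 (by simp)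
          obtain ⟨Q', hQ'⟩ := ih n.unpair.2.unpair.2 (by simp)
          exact ⟨.and Q Q', by rw [ECQ.code, hQ, hQ', Nat.pair_unpair, ← h, Nat.pair_unpair]⟩
        · obtain ⟨Q, hQ⟩ := ih n.unpair.2.unpair.2 (by simp)
          exact ⟨.ex n.unpair.2.unpair.1 Q, by
            rw [ECQ.code, hQ, Nat.pair_unpair, ← h, Nat.pair_unpair]⟩

instance : Numbered ECQ where
  code := ECQ.code
  code_injective := ECQ.code_injective
  range := ECQ.sig_range_code

@[fun_prop]
theorem Eff.ecq_ucq {f : γ → List CQ} (hf : Eff f) : Eff fun x => ECQ.ucq (f x) :=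
  Eff.of_code_eq_pair (c := ECQ.ucq) 0 (fun _ => rfl) hf

@[fun_prop]
theorem Eff.ecq_neg {f : γ → ECQ} (hf : Eff f) : Eff fun x => ECQ.neg (f x) :=
  Eff.of_code_eq_pair (c := ECQ.neg) 1 (fun _ => rfl) hf

@[fun_prop]
theorem Eff.ecq_and {f g : γ → ECQ} (hf : Eff f) (hg : Eff g) :
    Eff fun x => ECQ.and (f x) (g x) :=
  Eff.of_code_eq_pair (c := fun p : ECQ × ECQ => ECQ.and p.1 p.2) 2 (fun _ => rfl) (hf.pair hg)

@[fun_prop]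
theorem Eff.ecq_ex {f : γ → ℕ} {g : γ → ECQ} (hf : Eff f) (hg : Eff g) :
    Eff fun x => ECQ.ex (f x) (g x) :=
  Eff.of_code_eq_pair (c := fun p : ℕ × ECQ => ECQ.ex p.1 p.2) 3 (fun _ => rfl) (hf.pair hg)

/-- The case distinction on head terms. -/
def ETerm.view : ETerm → ℕ ⊕ ℕ ⊕ (ℕ × List ℕ)
  | .const c => .inl c
  | .var x => .inr (.inl x)
  | .call f xs => .inr (.inr (f, xs))

instance : Numbered ETerm where
  code := ETerm.code
  code_injective := by
    rintro (_ | _ | _) (_ | _ | _) h <;> simp [ETerm.code, Nat.pair_eq_pair] at h ⊢ <;>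
      first | exact h | exact ⟨h.1, Numbered.code_injective (α := List ℕ) h.2⟩
  range := by
    -- Constants and variables have the same codes as the elements of `ℕ ⊕ ℕ`, with the tags 0 and
    -- 1.
    refine (((Numbered.range (α := ℕ ⊕ ℕ))).or
      ((Sig.of_primrec (P := fun n => n = 2) (Primrec.eq.comp Primrec.id (Primrec.const 2))).comp
        primrec_unpair₁ |>.and ((Numbered.range (α := ℕ × List ℕ)).comp primrec_unpair₂))).of_iff
      fun n => ?_
    constructor
    · rintro ⟨_ | _ | ⟨f, xs⟩, rfl⟩
      · exact .inl ⟨.inl _, rfl⟩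
      · exact .inl ⟨.inr _, rfl⟩
      · exact .inr ⟨by simp [ETerm.code], (f, xs), by simp [ETerm.code]; rfl⟩
    · rintro (⟨c | x, rfl⟩ | ⟨h, ⟨f, xs⟩, hn⟩)
      · exact ⟨.const c, rfl⟩
      · exact ⟨.var x, rfl⟩
      · exact ⟨.call f xs, by rw [← Nat.pair_unpair n, h, ← hn]; rfl⟩

@[fun_prop]
theorem Eff.eTerm_view {f : γ → ETerm} (hf : Eff f) : Eff fun x => (f x).view := by
  -- The view is a nested sum: tag 0 stays, while the tags 1 and 2 become an outer tag 1 with inner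
  -- tags 0 and 1.
  refine Eff.comp (f := ETerm.view) ⟨fun n => if n.unpair.1 = 0 then n else
    if n.unpair.1 = 1 then Nat.pair 1 (Nat.pair 0 n.unpair.2) else
    Nat.pair 1 (Nat.pair 1 n.unpair.2), Primrec.ite (Primrec.eq.comp primrec_unpair₁
    (Primrec.const 0)) Primrec.id (Primrec.ite (Primrec.eq.comp primrec_unpair₁
    (Primrec.const 1)) (Primrec₂.natPair.comp (Primrec.const 1) (Primrec₂.natPair.comp
    (Primrec.const 0) primrec_unpair₂)) (Primrec₂.natPair.comp (Primrec.const 1)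
    (Primrec₂.natPair.comp (Primrec.const 1) primrec_unpair₂))), fun t => ?_⟩ hf
  rcases t with _ | _ | _
  · simp [show ∀ c, Numbered.code (ETerm.const c) = Nat.pair 0 c from fun _ => rfl, ETerm.view]
    rfl
  · simp [show ∀ c, Numbered.code (ETerm.var c) = Nat.pair 1 c from fun _ => rfl, ETerm.view]
    rfl
  · simp [show ∀ f xs, Numbered.code (ETerm.call f xs) = Nat.pair 2 (Nat.pair f (Numbered.code xs)) from
      fun _ _ => rfl, ETerm.view]
    rfl

def Effect.equiv : Effect ≃ List CQ × ECQ × List (Assertion ETerm) where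
  toFun e := (e.pos, e.neg, e.head)
  invFun x := ⟨x.1, x.2.1, x.2.2⟩

instance : Numbered Effect := .ofEquiv Effect.equiv Effect.code fun _ => rfl

def Action.equiv : Action ≃ ℕ × List ℕ × List Effect where
  toFun α := (α.name, α.params, α.effects)
  invFun x := ⟨x.1, x.2.1, x.2.2⟩

instance : Numbered Action := .ofEquiv Action.equiv Action.code fun _ => rfl

def Rule.equiv : Rule ≃ ECQ × Action where
  toFun r := (r.cond, r.action)
  invFun x := ⟨x.1, x.2⟩

instance : Numbered Rule := .ofEquiv Rule.equiv Rule.code fun _ => rfl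

def KAB.equiv : KAB ≃ TBox × List (Assertion ℕ) × List Action × List Rule where
  toFun K := (K.tbox, K.abox₀, K.actions, K.process)
  invFun x := ⟨x.1, x.2.1, x.2.2.1, x.2.2.2⟩

instance : Numbered KAB := .ofEquiv KAB.equiv KAB.code fun _ => rfl

theorem ITForm.code_injective : Function.Injective ITForm.code := by
  intro Φ
  induction Φ with
  | query Q =>
    rintro (_ | _ | _ | _ | _ | _ | _ | _) h <;> simp [ITForm.code, Nat.pair_eq_pair] at h
    rw [ECQ.code_injective h]
  | neg Q ih =>
    rintro (_ | _ | _ | _ | _ | _ | _ | _) h <;> simp [ITForm.code, Nat.pair_eq_pair] at h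
    rw [ih h]
  | and Q Q' ih ih' =>
    rintro (_ | _ | _ | _ | _ | _ | _ | _) h <;> simp [ITForm.code, Nat.pair_eq_pair] at h
    rw [ih h.1, ih' h.2]
  | ex x Q ih =>
    rintro (_ | _ | _ | _ | _ | _ | _ | _) h <;> simp [ITForm.code, Nat.pair_eq_pair] at h
    rw [h.1, ih h.2]
  | diaBox Q ih =>
    rintro (_ | _ | _ | _ | _ | _ | _ | _) h <;> simp [ITForm.code, Nat.pair_eq_pair] at h
    rw [ih h]
  | boxBox Q ih =>
    rintro (_ | _ | _ | _ | _ | _ | _ | _) h <;> simp [ITForm.code, Nat.pair_eq_pair] at h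
    rw [ih h]
  | pvar Z =>
    rintro (_ | _ | _ | _ | _ | _ | _ | _) h <;> simp [ITForm.code, Nat.pair_eq_pair] at h
    rw [h]
  | mu x Q ih =>
    rintro (_ | _ | _ | _ | _ | _ | _ | _) h <;> simp [ITForm.code, Nat.pair_eq_pair] at h
    rw [h.1, ih h.2]

theorem ITForm.sig_range_code : Sig fun n => ∃ Q : ITForm, Q.code = n := by
  refine (sig_derivable (R := fun n ps =>
    (n.unpair.1 = 0 ∧ (∃ Q : ECQ, Numbered.code Q = n.unpair.2) ∧ ps = []) ∨
    ((n.unpair.1 = 1 ∨ n.unpair.1 = 4 ∨ n.unpair.1 = 5) ∧ ps = [n.unpair.2]) ∨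
    (n.unpair.1 = 2 ∧ ps = [n.unpair.2.unpair.1, n.unpair.2.unpair.2]) ∨
    ((n.unpair.1 = 3 ∨ n.unpair.1 = 7) ∧ ps = [n.unpair.2.unpair.2]) ∨
    (n.unpair.1 = 6 ∧ ps = [])) ?_).of_iff fun n => ?_
  · refine .or (.and (Rec.eq ?_ ?_).re (.and (RE.ex (Rec.eq ?_ ?_).re) (Rec.eq ?_ ?_).re))
      (.or (.and (.or (Rec.eq ?_ ?_).re (.or (Rec.eq ?_ ?_).re (Rec.eq ?_ ?_).re)) (Rec.eq ?_ ?_).re)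
      (.or (.and (Rec.eq ?_ ?_).re (Rec.eq ?_ ?_).re)
      (.or (.and (.or (Rec.eq ?_ ?_).re (Rec.eq ?_ ?_).re) (Rec.eq ?_ ?_).re)
      (.and (Rec.eq ?_ ?_).re (Rec.eq ?_ ?_).re)))) <;> fun_prop
  · constructor
    · rintro ⟨Q, rfl⟩
      induction Q with
      | query q => exact ⟨_, [], .inl ⟨by simp [ITForm.code], ⟨q, by simp [ITForm.code]; rfl⟩, rfl⟩, by simp⟩
      | neg Q ih => exact ⟨_, [Q.code], by simp [ITForm.code], by simpa using ih⟩
      | diaBox Q ih => exact ⟨_, [Q.code], by simp [ITForm.code], by simpa using ih⟩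
      | boxBox Q ih => exact ⟨_, [Q.code], by simp [ITForm.code], by simpa using ih⟩
      | and Q Q' ih ih' => exact ⟨_, [Q.code, Q'.code], by simp [ITForm.code], by simpa using ⟨ih, ih'⟩⟩
      | ex x Q ih => exact ⟨_, [Q.code], by simp [ITForm.code], by simpa using ih⟩
      | mu x Q ih => exact ⟨_, [Q.code], by simp [ITForm.code], by simpa using ih⟩
      | pvar Z => exact ⟨_, [], by simp [ITForm.code], by simp⟩
    · intro h
      induction h with
      | intro n ps h _ ih =>
        rcases h with ⟨h, ⟨q, hq⟩, rfl⟩ | ⟨h, rfl⟩ | ⟨h, rfl⟩ | ⟨h, rfl⟩ | ⟨h, rfl⟩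
        · exact ⟨.query q, by rw [← Nat.pair_unpair n, h, ← hq]; rfl⟩
        · obtain ⟨Q, hQ⟩ := ih n.unpair.2 (by simp)
          rw [← Nat.pair_unpair n, ← hQ]
          rcases h with h | h | h
          · exact ⟨.neg Q, by rw [h]; rfl⟩
          · exact ⟨.diaBox Q, by rw [h]; rfl⟩
          · exact ⟨.boxBox Q, by rw [h]; rfl⟩
        · obtain ⟨Q, hQ⟩ := ih n.unpair.2.unpair.1 (by simp)
          obtain ⟨Q', hQ'⟩ := ih n.unpair.2.unpair.2 (by simp)
          exact ⟨.and Q Q', by rw [ITForm.code, hQ, hQ', Nat.pair_unpair, ← h, Nat.pair_unpair]⟩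
        · obtain ⟨Q, hQ⟩ := ih n.unpair.2.unpair.2 (by simp)
          rcases h with h | h
          · exact ⟨.ex n.unpair.2.unpair.1 Q, by
              rw [ITForm.code, hQ, Nat.pair_unpair, ← h, Nat.pair_unpair]⟩
          · exact ⟨.mu n.unpair.2.unpair.1 Q, by
              rw [ITForm.code, hQ, Nat.pair_unpair, ← h, Nat.pair_unpair]⟩
        · exact ⟨.pvar n.unpair.2, by rw [ITForm.code, ← h, Nat.pair_unpair]⟩

instance : Numbered ITForm where
  code := ITForm.code
  code_injective := ITForm.code_injective
  range := ITForm.sig_range_code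

@[fun_prop]
theorem Eff.it_query {f : γ → ECQ} (hf : Eff f) : Eff fun x => ITForm.query (f x) :=
  Eff.of_code_eq_pair (c := ITForm.query) 0 (fun _ => rfl) hf

@[fun_prop]
theorem Eff.it_neg {f : γ → ITForm} (hf : Eff f) : Eff fun x => ITForm.neg (f x) :=
  Eff.of_code_eq_pair (c := ITForm.neg) 1 (fun _ => rfl) hf

@[fun_prop]
theorem Eff.it_and {f g : γ → ITForm} (hf : Eff f) (hg : Eff g) :
    Eff fun x => ITForm.and (f x) (g x) :=
  Eff.of_code_eq_pair (c := fun p : ITForm × ITForm => ITForm.and p.1 p.2) 2 (fun _ => rfl)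
    (hf.pair hg)

@[fun_prop]
theorem Eff.it_ex {f : γ → ℕ} {g : γ → ITForm} (hf : Eff f) (hg : Eff g) :
    Eff fun x => ITForm.ex (f x) (g x) :=
  Eff.of_code_eq_pair (c := fun p : ℕ × ITForm => ITForm.ex p.1 p.2) 3 (fun _ => rfl)
    (hf.pair hg)

@[fun_prop]
theorem Eff.it_diaBox {f : γ → ITForm} (hf : Eff f) : Eff fun x => ITForm.diaBox (f x) :=
  Eff.of_code_eq_pair (c := ITForm.diaBox) 4 (fun _ => rfl) hf

@[fun_prop]
theorem Eff.it_boxBox {f : γ → ITForm} (hf : Eff f) : Eff fun x => ITForm.boxBox (f x) :=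
  Eff.of_code_eq_pair (c := ITForm.boxBox) 5 (fun _ => rfl) hf

@[fun_prop]
theorem Eff.it_pvar {f : γ → ℕ} (hf : Eff f) : Eff fun x => ITForm.pvar (f x) :=
  Eff.of_code_eq_pair (c := ITForm.pvar) 6 (fun _ => rfl) hf

@[fun_prop]
theorem Eff.it_mu {f : γ → ℕ} {g : γ → ITForm} (hf : Eff f) (hg : Eff g) :
    Eff fun x => ITForm.mu (f x) (g x) :=
  Eff.of_code_eq_pair (c := fun p : ℕ × ITForm => ITForm.mu p.1 p.2) 7 (fun _ => rfl)
    (hf.pair hg)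

def Instance.equiv : Instance ≃ KAB × ℕ × ℕ × ITForm where
  toFun P := (P.kab, P.st, P.tmp, P.formula)
  invFun x := ⟨x.1, x.2.1, x.2.2.1, x.2.2.2⟩

instance : Numbered Instance := .ofEquiv Instance.equiv Instance.code fun _ => rfl

def SCall.equiv : SCall ≃ ℕ × List ℕ where
  toFun t := (t.fn, t.args)
  invFun x := ⟨x.1, x.2⟩

instance : Numbered SCall := .ofEquiv SCall.equiv (fun t => code (SCall.equiv t)) fun _ => rfl

instance : DecidableEq SCall := SCall.equiv.decidableEq

def GTerm.equiv : GTerm ≃ ℕ ⊕ SCall where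
  toFun | .val c => .inl c | .call t => .inr t
  invFun | .inl P => .val P | .inr P => .call P
  left_inv R := by cases R <;> rfl
  right_inv R := by cases R <;> rfl

instance : Numbered GTerm := .ofEquiv GTerm.equiv (fun t => code (GTerm.equiv t)) fun _ => rfl

@[fun_prop]
theorem Eff.role_equiv {f : γ → Role} (hf : Eff f) : Eff fun x => Role.equiv (f x) :=
  Eff.comp (.of_code_eq fun R => by cases R <;> rfl) hf

@[fun_prop]
theorem Eff.role_name {f : γ → ℕ} (hf : Eff f) : Eff fun x => Role.name (f x) :=
  Eff.of_code_eq_pair 0 (fun _ => rfl) hf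

@[fun_prop]
theorem Eff.role_inv {f : γ → ℕ} (hf : Eff f) : Eff fun x => Role.inv (f x) :=
  Eff.of_code_eq_pair 1 (fun _ => rfl) hf

@[fun_prop]
theorem Eff.bConcept_equiv {f : γ → BConcept} (hf : Eff f) : Eff fun x => BConcept.equiv (f x) :=
  Eff.comp (.of_code_eq fun R => by cases R <;> rfl) hf

@[fun_prop]
theorem Eff.bConcept_name {f : γ → ℕ} (hf : Eff f) : Eff fun x => BConcept.name (f x) :=
  Eff.of_code_eq_pair 0 (fun _ => rfl) hf

@[fun_prop]
theorem Eff.bConcept_ex {f : γ → Role} (hf : Eff f) : Eff fun x => BConcept.ex (f x) :=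
  Eff.of_code_eq_pair 1 (fun _ => rfl) hf

theorem Eff.tBox_equiv : Eff TBox.equiv := .of_code_eq fun _ => rfl

@[fun_prop]
theorem Eff.tBox_pos {f : γ → TBox} (hf : Eff f) : Eff fun x => (f x).pos :=
  (Eff.tBox_equiv.comp hf).fst

@[fun_prop]
theorem Eff.tBox_neg {f : γ → TBox} (hf : Eff f) : Eff fun x => (f x).neg :=
  (Eff.tBox_equiv.comp hf).snd.fst

@[fun_prop]
theorem Eff.tBox_funct {f : γ → TBox} (hf : Eff f) : Eff fun x => (f x).funct :=
  (Eff.tBox_equiv.comp hf).snd.snd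

@[fun_prop]
theorem Eff.assertion_equiv {f : γ → Assertion α} (hf : Eff f) :
    Eff fun x => Assertion.equiv α (f x) :=
  Eff.comp (.of_code_eq fun R => by cases R <;> rfl) hf

@[fun_prop]
theorem Eff.conc {f : γ → ℕ} {g : γ → α} (hf : Eff f) (hg : Eff g) :
    Eff fun x => Assertion.conc (f x) (g x) :=
  Eff.of_code_eq_pair (c := fun p : ℕ × α => Assertion.conc p.1 p.2) 0 (fun _ => rfl) (hf.pair hg)

@[fun_prop]
theorem Eff.role {f : γ → ℕ} {g h : γ → α} (hf : Eff f) (hg : Eff g) (hh : Eff h) :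
    Eff fun x => Assertion.role (f x) (g x) (h x) :=
  Eff.of_code_eq_pair (c := fun p : ℕ × α × α => Assertion.role p.1 p.2.1 p.2.2) 1 (fun _ => rfl)
    (hf.pair (hg.pair hh))

@[fun_prop]
theorem Eff.qTerm_equiv {f : γ → QTerm} (hf : Eff f) : Eff fun x => QTerm.equiv (f x) :=
  Eff.comp (.of_code_eq fun R => by cases R <;> rfl) hf

@[fun_prop]
theorem Eff.qTerm_var {f : γ → ℕ} (hf : Eff f) : Eff fun x => QTerm.var (f x) :=
  Eff.of_code_eq_pair 1 (fun _ => rfl) hf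

theorem Eff.cq_equiv : Eff CQ.equiv := .of_code_eq fun _ => rfl

@[fun_prop]
theorem Eff.cq_evars {f : γ → CQ} (hf : Eff f) : Eff fun x => (f x).evars :=
  (Eff.cq_equiv.comp hf).fst

@[fun_prop]
theorem Eff.cq_atoms {f : γ → CQ} (hf : Eff f) : Eff fun x => (f x).atoms :=
  (Eff.cq_equiv.comp hf).snd

theorem Eff.effect_equiv : Eff Effect.equiv := .of_code_eq fun _ => rfl

@[fun_prop]
theorem Eff.effect_pos {f : γ → Effect} (hf : Eff f) : Eff (β := List CQ) fun x => (f x).pos :=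
  (Eff.effect_equiv.comp hf).fst

@[fun_prop]
theorem Eff.effect_neg {f : γ → Effect} (hf : Eff f) : Eff fun x => (f x).neg :=
  (Eff.effect_equiv.comp hf).snd.fst

@[fun_prop]
theorem Eff.effect_head {f : γ → Effect} (hf : Eff f) : Eff fun x => (f x).head :=
  (Eff.effect_equiv.comp hf).snd.snd

theorem Eff.action_equiv : Eff Action.equiv := .of_code_eq fun _ => rfl

@[fun_prop]
theorem Eff.action_params {f : γ → Action} (hf : Eff f) : Eff fun x => (f x).params :=
  (Eff.action_equiv.comp hf).snd.fst

@[fun_prop]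
theorem Eff.action_effects {f : γ → Action} (hf : Eff f) : Eff fun x => (f x).effects :=
  (Eff.action_equiv.comp hf).snd.snd

theorem Eff.rule_equiv : Eff Rule.equiv := .of_code_eq fun _ => rfl

@[fun_prop]
theorem Eff.rule_cond {f : γ → Rule} (hf : Eff f) : Eff fun x => (f x).cond :=
  (Eff.rule_equiv.comp hf).fst

@[fun_prop]
theorem Eff.rule_action {f : γ → Rule} (hf : Eff f) : Eff fun x => (f x).action :=
  (Eff.rule_equiv.comp hf).snd

theorem Eff.kab_equiv : Eff KAB.equiv := .of_code_eq fun _ => rfl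

@[fun_prop]
theorem Eff.kab_tbox {f : γ → KAB} (hf : Eff f) : Eff fun x => (f x).tbox :=
  (Eff.kab_equiv.comp hf).fst

@[fun_prop]
theorem Eff.kab_abox₀ {f : γ → KAB} (hf : Eff f) : Eff fun x => (f x).abox₀ :=
  (Eff.kab_equiv.comp hf).snd.fst

@[fun_prop]
theorem Eff.kab_actions {f : γ → KAB} (hf : Eff f) : Eff fun x => (f x).actions :=
  (Eff.kab_equiv.comp hf).snd.snd.fst

@[fun_prop]
theorem Eff.kab_process {f : γ → KAB} (hf : Eff f) : Eff fun x => (f x).process :=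
  (Eff.kab_equiv.comp hf).snd.snd.snd

theorem Eff.instance_equiv : Eff Instance.equiv := .of_code_eq fun _ => rfl

@[fun_prop]
theorem Eff.instance_kab {f : γ → Instance} (hf : Eff f) : Eff fun x => (f x).kab :=
  (Eff.instance_equiv.comp hf).fst

@[fun_prop]
theorem Eff.instance_st {f : γ → Instance} (hf : Eff f) : Eff fun x => (f x).st :=
  (Eff.instance_equiv.comp hf).snd.fst

@[fun_prop]
theorem Eff.instance_tmp {f : γ → Instance} (hf : Eff f) : Eff fun x => (f x).tmp :=
  (Eff.instance_equiv.comp hf).snd.snd.fst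

@[fun_prop]
theorem Eff.instance_formula {f : γ → Instance} (hf : Eff f) : Eff fun x => (f x).formula :=
  (Eff.instance_equiv.comp hf).snd.snd.snd

theorem Eff.sCall_equiv : Eff SCall.equiv := .of_code_eq fun _ => rfl

@[fun_prop]
theorem Eff.sCall_args {f : γ → SCall} (hf : Eff f) : Eff fun x => (f x).args :=
  (Eff.sCall_equiv.comp hf).snd

@[fun_prop]
theorem Eff.sCall_mk {f : γ → ℕ} {g : γ → List ℕ} (hf : Eff f) (hg : Eff g) :
    Eff fun x => SCall.mk (f x) (g x) :=
  Eff.comp (f := SCall.equiv.symm) (.of_code_eq fun _ => rfl) (hf.pair hg)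

@[fun_prop]
theorem Eff.gTerm_equiv {f : γ → GTerm} (hf : Eff f) : Eff fun x => GTerm.equiv (f x) :=
  Eff.comp (.of_code_eq fun R => by cases R <;> rfl) hf

@[fun_prop]
theorem Eff.gTerm_val {f : γ → ℕ} (hf : Eff f) : Eff fun x => GTerm.val (f x) :=
  Eff.of_code_eq_pair 0 (fun _ => rfl) hf

@[fun_prop]
theorem Eff.gTerm_call {f : γ → SCall} (hf : Eff f) : Eff fun x => GTerm.call (f x) :=
  Eff.of_code_eq_pair 1 (fun _ => rfl) hf

@[fun_prop]
theorem Eff.terms {f : γ → Assertion α} (hf : Eff f) : Eff fun x => (f x).terms := by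
  have := Eff.sum_elim (g := fun _ x => [x.2]) (h := fun _ x => [x.2.1, x.2.2])
    (Eff.assertion_equiv hf) (by fun_prop) (by fun_prop)
  exact this.congr fun x => by cases f x <;> rfl

theorem Eff.assertion_map {f : γ → Assertion α} {g : γ → α → β} (hf : Eff f)
    (hg : Eff fun x : γ × α => g x.1 x.2) : Eff fun x => (f x).map (g x) := by
  have hg' : ∀ {δ : Type} [Numbered δ] {c : δ → γ} {a : δ → α}, Eff c → Eff a →
    Eff fun x => g (c x) (a x) := fun hc ha => hg.comp (hc.pair ha)
  have := Eff.sum_elim (g := fun c x => Assertion.conc x.1 (g c x.2))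
    (h := fun c x => Assertion.role x.1 (g c x.2.1) (g c x.2.2))
    (Eff.assertion_equiv hf) (.conc (by fun_prop) (hg' (by fun_prop) (by fun_prop)))
      (.role (by fun_prop) (hg' (by fun_prop) (by fun_prop)) (hg' (by fun_prop) (by fun_prop)))
  exact this.congr fun x => by cases f x <;> rfl

end SyntaxCodes

/-! ### The canonical model of a TBox and an ABox. -/

section CanonicalModel

def Role.flip : Role → Role
  | .name P => .inv P
  | .inv P => .name P

@[simp]
theorem Role.flip_flip (R : Role) : R.flip.flip = R := by cases R <;> rfl

@[simp]
theorem Interp.roleExt_flip {Δ : Type} (I : Interp Δ) (R : Role) (x y : Δ) :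
    I.roleExt R.flip x y ↔ I.roleExt R y x := by cases R <;> rfl

/-- `R(c,d)` is asserted in `A`. -/
def RoleIn (A : ABox) : Role → ℕ → ℕ → Prop
  | .name P, c, d => .role P c d ∈ A
  | .inv P, c, d => .role P d c ∈ A

@[simp]
theorem roleIn_flip (A : ABox) (R : Role) (c d : ℕ) : RoleIn A R.flip c d ↔ RoleIn A R d c := by
  cases R <;> rfl

/-- `B(c)` is asserted in `A`. -/
def Asserted (A : ABox) (c : ℕ) : BConcept → Prop
  | .name N => .conc N c ∈ A
  | .ex R => ∃ d, RoleIn A R c d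

/-- `B ⊑ B'` follows from the positive inclusions of `T`. -/
def Sub (T : TBox) : BConcept → BConcept → Prop :=
  Relation.ReflTransGen fun B B' => (B, B') ∈ T.pos

/-- Elements of the canonical model: a constant followed by the roles, in reverse order, that
lead from it to the element. -/
abbrev Elem := ℕ × List Role

/-- The basic concepts that hold of an element of the canonical model. -/
def ElTyp (T : TBox) (A : ABox) : Elem → BConcept → Prop
  | (c, []), B => ∃ B₀, Asserted A c B₀ ∧ Sub T B₀ B
  | (_, R :: _), B => Sub T (.ex R.flip) B

/-- An `R`-successor exists already. -/
def HasSucc (A : ABox) : Elem → Role → Prop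
  | (c, []), R => ∃ d, RoleIn A R c d
  | (_, R' :: _), R => R = R'.flip

/-- An `R`-child is created only if `∃R` is required and no `R`-edge is present yet. This economy is
what keeps functional roles functional. -/
def Valid (T : TBox) (A : ABox) (c : ℕ) : List Role → Prop
  | [] => True
  | R :: w => Valid T A c w ∧ ElTyp T A (c, w) (.ex R) ∧ ¬ HasSucc A (c, w) R

/-- The canonical model of the positive inclusions of `T` and of `A`. -/
def canon (T : TBox) (A : ABox) : Interp Elem where
  const c := (c, [])
  const_injective := fun _ _ h => (Prod.ext_iff.1 h).1
  conc N := {e | Valid T A e.1 e.2 ∧ ElTyp T A e (.name N)}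
  role P x y := (x.2 = [] ∧ y.2 = [] ∧ .role P x.1 y.1 ∈ A) ∨
    (y = (x.1, .name P :: x.2) ∧ Valid T A y.1 y.2) ∨
    (x = (y.1, .inv P :: y.2) ∧ Valid T A x.1 x.2)

variable {T : TBox} {A : ABox}

theorem canon_roleExt {R : Role} {x y : Elem} : (canon T A).roleExt R x y ↔
    (x.2 = [] ∧ y.2 = [] ∧ RoleIn A R x.1 y.1) ∨
    (y = (x.1, R :: x.2) ∧ Valid T A y.1 y.2) ∨
    (x = (y.1, R.flip :: y.2) ∧ Valid T A x.1 x.2) := by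
  cases R with
  | name P => exact Iff.rfl
  | inv P =>
    simp only [Interp.roleExt, canon, RoleIn, Role.flip]
    tauto

theorem Sub.refl (B : BConcept) : Sub T B B := Relation.ReflTransGen.refl

theorem ElTyp.mono {e : Elem} {B B' : BConcept} (h : ElTyp T A e B) (h' : Sub T B B') :
    ElTyp T A e B' := by
  obtain ⟨c, _ | ⟨R, w⟩⟩ := e
  · obtain ⟨B₀, h1, h2⟩ := h
    exact ⟨B₀, h1, h2.trans h'⟩
  · exact Relation.ReflTransGen.trans h h'

/-- Types are local: they come from the assertions about a constant or from the single role that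
leads to an unnamed element. Edges to children add nothing, because a child presupposes `∃R` in the
type, and conversely a required successor that is missing is supplied by a child. -/
theorem canon_concExt {B : BConcept} {e : Elem} :
    e ∈ (canon T A).concExt B ↔ Valid T A e.1 e.2 ∧ ElTyp T A e B := by
  cases B with
  | name N => exact Iff.rfl
  | ex R =>
    constructor
    · rintro ⟨y, h⟩
      rcases canon_roleExt.1 h with ⟨h1, h2, h3⟩ | ⟨rfl, hv⟩ | ⟨he, hv⟩
      · obtain ⟨c, w⟩ := e
        obtain rfl : w = [] := h1
        exact ⟨trivial, .ex R, ⟨y.1, h3⟩, Sub.refl _⟩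
      · exact ⟨hv.1, hv.2.1⟩
      · refine ⟨hv, ?_⟩
        rw [he]
        simpa [ElTyp] using Sub.refl (T := T) (.ex R)
    · rintro ⟨hv, ht⟩
      by_cases hs : HasSucc A e R
      · obtain ⟨c, _ | ⟨R', w⟩⟩ := e
        · obtain ⟨d, hd⟩ := hs
          exact ⟨(d, []), canon_roleExt.2 (.inl ⟨rfl, rfl, hd⟩)⟩
        · obtain rfl : R = R'.flip := hs
          exact ⟨(c, w), canon_roleExt.2 (.inr (.inr ⟨by simp, hv⟩))⟩
      · exact ⟨(e.1, R :: e.2), canon_roleExt.2 (.inr (.inl ⟨rfl, hv, ht, hs⟩))⟩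

theorem canon_satABox : (canon T A).SatABox A := by
  rintro (⟨N, c⟩ | ⟨P, c, d⟩) hF
  · exact ⟨trivial, .name N, hF, Sub.refl _⟩
  · exact .inl ⟨rfl, rfl, hF⟩

/-- A map from the canonical model into an interpretation. -/
noncomputable def canonHom {Δ : Type} (I : Interp Δ) (c : ℕ) : List Role → Δ
  | [] => I.const c
  | R :: w => by
    classical
    -- The default is immaterial: along valid words a model of the knowledge base has the required
    -- successor.
    exact if h : ∃ y, I.roleExt R (canonHom I c w) y then h.choose else I.const c

theorem canonHom_cons {Δ : Type} (I : Interp Δ) {c : ℕ} {R : Role} {w : List Role}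
    (h : canonHom I c w ∈ I.concExt (.ex R)) :
    I.roleExt R (canonHom I c w) (canonHom I c (R :: w)) := by
  have h : ∃ y, I.roleExt R (canonHom I c w) y := h
  rw [canonHom, dif_pos h]
  exact h.choose_spec

theorem Interp.SatTBox.sub {Δ : Type} {I : Interp Δ} (hI : I.SatTBox T) {B B' : BConcept}
    (h : Sub T B B') : I.concExt B ⊆ I.concExt B' := by
  induction h with
  | refl => exact fun _ h => h
  | tail _ hs ih => exact ih.trans (hI.1 _ hs)

theorem Interp.SatABox.roleIn {Δ : Type} {I : Interp Δ} (hI : I.SatABox A) {R : Role} {c d : ℕ}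
    (h : RoleIn A R c d) : I.roleExt R (I.const c) (I.const d) := by
  cases R <;> exact hI _ h

theorem Interp.SatABox.asserted {Δ : Type} {I : Interp Δ} (hI : I.SatABox A) {B : BConcept} {c : ℕ}
    (h : Asserted A c B) : I.const c ∈ I.concExt B := by
  cases B with
  | name N => exact hI _ h
  | ex R =>
    obtain ⟨d, hd⟩ := h
    exact ⟨_, hI.roleIn hd⟩

/-- Along a valid word the model has each required successor, and the edge read backwards puts that
successor into `∃R.flip`, from which the type of the element follows. -/
theorem canonHom_concExt {Δ : Type} {I : Interp Δ} (hI : I.Model T A) {c : ℕ} {w : List Role}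
    (hv : Valid T A c w) {B : BConcept} (h : ElTyp T A (c, w) B) :
    canonHom I c w ∈ I.concExt B := by
  induction w generalizing B with
  | nil =>
    obtain ⟨B₀, h1, h2⟩ := h
    exact hI.1.sub h2 (hI.2.asserted h1)
  | cons R w ih =>
    refine hI.1.sub h ?_
    exact ⟨canonHom I c w, (I.roleExt_flip _ _ _).2 (canonHom_cons I (ih hv.1 hv.2.1))⟩

theorem canonHom_roleExt {Δ : Type} {I : Interp Δ} (hI : I.Model T A) {R : Role} {x y : Elem}
    (h : (canon T A).roleExt R x y) :
    I.roleExt R (canonHom I x.1 x.2) (canonHom I y.1 y.2) := by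
  rcases canon_roleExt.1 h with ⟨h1, h2, h3⟩ | ⟨rfl, hv⟩ | ⟨rfl, hv⟩
  · rw [h1, h2]
    exact hI.2.roleIn h3
  · exact canonHom_cons I (canonHom_concExt hI hv.1 hv.2.1)
  · rw [← Interp.roleExt_flip]
    exact canonHom_cons I (canonHom_concExt hI hv.1 hv.2.1)

theorem canonHom_holdsAtom {Δ : Type} {I : Interp Δ} (hI : I.Model T A) {F : Assertion Elem}
    (h : (canon T A).HoldsAtom F) : I.HoldsAtom (F.map fun e => canonHom I e.1 e.2) := by
  cases F with
  | conc N e => exact canonHom_concExt hI h.1 h.2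
  | role P x y => exact canonHom_roleExt hI (R := .name P) h

/-- The negative inclusions hold in the canonical model, and the functionality assertions hold
for the asserted facts. -/
def NoClash (T : TBox) (A : ABox) : Prop :=
  (∀ R ∈ T.funct, ∀ c d d', RoleIn A R c d → RoleIn A R c d' → d = d') ∧
  ∀ c w, Valid T A c w → ∀ i ∈ T.neg, ElTyp T A (c, w) i.1 → ¬ ElTyp T A (c, w) i.2

/-- Only functionality needs an argument. An `R`-successor is asserted, or a child, or the parent.
Two kinds cannot coexist, since a child is created only in the absence of an `R`-edge, and an
element has at most one child by `R` and one parent. What remains is the case of two asserted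
successors. -/
theorem NoClash.model (h : NoClash T A) : (canon T A).Model T A := by
  refine ⟨⟨fun i hi e he => ?_, fun i hi e h1 h2 => ?_, fun R hR x y z hy hz => ?_⟩, canon_satABox⟩
  · rw [canon_concExt] at he ⊢
    exact ⟨he.1, he.2.mono (.single hi)⟩
  · rw [canon_concExt] at h1 h2
    exact h.2 _ _ h1.1 i hi h1.2 h2.2
  · obtain ⟨c, w⟩ := x
    rcases canon_roleExt.1 hy with ⟨h1, h2, h3⟩ | ⟨rfl, hv⟩ | ⟨h1, hv⟩ <;>
    rcases canon_roleExt.1 hz with ⟨k1, k2, k3⟩ | ⟨rfl, kv⟩ | ⟨k1, kv⟩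
    · exact Prod.ext (h.1 R hR _ _ _ h3 k3) (h2.trans k2.symm)
    · obtain rfl : w = [] := h1
      exact (kv.2.2 ⟨_, h3⟩).elim
    · simp only [Prod.mk.injEq] at k1 h1
      simp [h1] at k1
    · obtain rfl : w = [] := k1
      exact (hv.2.2 ⟨_, k3⟩).elim
    · rfl
    · simp only [Prod.mk.injEq] at k1
      obtain ⟨rfl, rfl⟩ := k1
      exact (hv.2.2 (by simp [HasSucc])).elim
    · simp only [Prod.mk.injEq] at h1 k1
      simp [k1] at h1
    · simp only [Prod.mk.injEq] at h1
      obtain ⟨rfl, rfl⟩ := h1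
      exact (kv.2.2 (by simp [HasSucc])).elim
    · simp only [Prod.mk.injEq] at h1 k1
      rw [h1.2, List.cons.injEq] at k1
      exact Prod.ext (h1.1.symm.trans k1.1) k1.2.2

/-- The map `canonHom` carries a violated negative inclusion into any model, and a violated
functionality assertion on asserted facts contradicts the unique name assumption. -/
theorem consistent_iff : Consistent T A ↔ NoClash T A := by
  constructor
  · rintro ⟨Δ, I, hI⟩
    refine ⟨fun R hR c d d' h1 h2 => ?_, fun c w hv i hi h1 h2 => ?_⟩
    · exact I.const_injective (hI.1.2.2 R hR _ _ _ (hI.2.roleIn h1) (hI.2.roleIn h2))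
    · exact hI.1.2.1 i hi _ (canonHom_concExt hI hv h1) (canonHom_concExt hI hv h2)
  · exact fun h => ⟨_, _, h.model⟩

theorem Assertion.map_map {α β γ : Type} (f : α → β) (g : β → γ) (F : Assertion α) :
    (F.map f).map g = F.map (g ∘ f) := by cases F <;> rfl

theorem Assertion.terms_map {α β : Type} (f : α → β) (F : Assertion α) :
    (F.map f).terms = F.terms.map f := by cases F <;> rfl

theorem Assertion.map_congr {α β : Type} {f g : α → β} {F : Assertion α}
    (h : ∀ t ∈ F.terms, f t = g t) : F.map f = F.map g := by
  cases F <;> simp_all [Assertion.map, Assertion.terms]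

/-- If there is a model at all then the canonical one is a model, and `canonHom` maps it into every
other one, preserving atoms and hence matches of positive queries. -/
theorem certain_iff {q : UCQ} {ρ : ℕ → ℕ} :
    Certain T A q ρ ↔ ¬ Consistent T A ∨ (canon T A).SatUCQ q ρ := by
  constructor
  · intro h
    by_cases hc : Consistent T A
    · exact .inr (h _ _ (consistent_iff.1 hc).model)
    · exact .inl hc
  · rintro (h | ⟨d, hd, μ, h1, h2⟩) Δ I hI
    · exact (h ⟨Δ, I, hI⟩).elim
    · refine ⟨d, hd, fun x => canonHom I (μ x).1 (μ x).2, fun x hx => by simp only [h1 x hx]; rfl,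
        fun a ha => ?_⟩
      have := canonHom_holdsAtom hI (h2 a ha)
      rw [Assertion.map_map] at this
      convert this using 2
      funext t
      cases t <;> rfl

end CanonicalModel

/-! ### Bounding the words in matches of a query. -/

section BoundedMatches

variable {T : TBox} {A : ABox}

theorem Valid.of_append {c : ℕ} {u v : List Role} (h : Valid T A c (u ++ v)) : Valid T A c v := by
  induction u with
  | nil => exact h
  | cons R u ih => exact ih h.1

/-- From `R` on, an element's type depends on its last role only. Subtrees that hang from equal
roles are therefore copies of each other, wherever they are attached. -/
theorem elTyp_append {c : ℕ} {u a b : List Role} {R : Role} {B : BConcept} :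
    ElTyp T A (c, u ++ R :: a) B ↔ ElTyp T A (c, u ++ R :: b) B := by
  cases u <;> exact Iff.rfl

theorem hasSucc_append {c : ℕ} {u a b : List Role} {R R' : Role} :
    HasSucc A (c, u ++ R :: a) R' ↔ HasSucc A (c, u ++ R :: b) R' := by
  cases u <;> exact Iff.rfl

theorem Valid.replace {c : ℕ} {u a b : List Role} {R : Role} (h : Valid T A c (u ++ R :: a))
    (h' : Valid T A c (R :: b)) : Valid T A c (u ++ R :: b) := by
  induction u with
  | nil => exact h'
  | cons R' u ih =>
    exact ⟨ih h.1, elTyp_append.1 h.2.1, fun hs => h.2.2 (hasSucc_append.1 hs)⟩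

theorem Sub.eq_or_mem {B B' : BConcept} (h : Sub T B B') : B = B' ∨ B' ∈ T.pos.map Prod.snd := by
  cases h with
  | refl => exact .inl rfl
  | tail _ hs => exact .inr (List.mem_map_of_mem hs)

/-- If `∃R` held merely by assertion, or as the inverse of the incoming role, an `R`-edge would be
present and the child would not exist. So a proper inclusion was used, and only finitely many roles
occur in valid words. -/
theorem Valid.ex_mem {c : ℕ} {R : Role} {w : List Role} (h : Valid T A c (R :: w)) :
    BConcept.ex R ∈ T.pos.map Prod.snd := by
  obtain ⟨_, h1, h2⟩ := h
  cases w with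
  | nil =>
    obtain ⟨B₀, h3, h4⟩ := h1
    rcases h4.eq_or_mem with rfl | h
    · exact (h2 h3).elim
    · exact h
  | cons R' w =>
    rcases Sub.eq_or_mem h1 with h | h
    · exact (h2 (BConcept.ex.inj h).symm).elim
    · exact h

theorem Asserted.mem_adom {c : ℕ} {B : BConcept} (h : Asserted A c B) : c ∈ adom A := by
  rcases B with N | _ | _
  · exact ⟨_, h, by simp [Assertion.terms]⟩
  · obtain ⟨d, hd⟩ := h
    exact ⟨_, hd, by simp [Assertion.terms]⟩
  · obtain ⟨d, hd⟩ := h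
    exact ⟨_, hd, by simp [Assertion.terms]⟩

theorem ElTyp.mem_adom {c : ℕ} {w : List Role} (hv : Valid T A c w) {B : BConcept}
    (h : ElTyp T A (c, w) B) : c ∈ adom A := by
  induction w generalizing B with
  | nil =>
    obtain ⟨B₀, h1, _⟩ := h
    exact h1.mem_adom
  | cons R w ih => exact ih hv.1 hv.2.1

theorem canon_holdsAtom_terms {F : Assertion Elem} (h : (canon T A).HoldsAtom F) {e : Elem}
    (he : e ∈ F.terms) : Valid T A e.1 e.2 ∧ e.1 ∈ adom A := by
  have key : ∀ B, e ∈ (canon T A).concExt B → Valid T A e.1 e.2 ∧ e.1 ∈ adom A := by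
    intro B hB
    rw [canon_concExt] at hB
    exact ⟨hB.1, hB.2.mem_adom hB.1⟩
  cases F with
  | conc N x =>
    obtain rfl : e = x := by simpa [Assertion.terms] using he
    exact key (.name N) h
  | role P x y =>
    simp only [Assertion.terms, List.mem_cons, List.not_mem_nil, or_false] at he
    rcases he with rfl | rfl
    · exact key (.ex (.name P)) ⟨_, h⟩
    · exact key (.ex (.inv P)) ⟨_, h⟩

/-- Replace the prefix `R :: a` of elements below the constant `c` by `R :: b`. -/
noncomputable def graft (c : ℕ) (R : Role) (a b : List Role) (e : Elem) : Elem := by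
  classical
  exact if h : ∃ u, e = (c, u ++ R :: a) then (c, h.choose ++ R :: b) else e

theorem graft_append (c : ℕ) (R : Role) (a b u : List Role) :
    graft c R a b (c, u ++ R :: a) = (c, u ++ R :: b) := by
  have h : ∃ u', ((c, u ++ R :: a) : Elem) = (c, u' ++ R :: a) := ⟨u, rfl⟩
  rw [graft, dif_pos h]
  have := (Prod.ext_iff.1 h.choose_spec).2
  rw [← List.append_cancel_right this]

theorem graft_of_ne {c : ℕ} {R : Role} {a b : List Role} {e : Elem}
    (h : ∀ u, e ≠ (c, u ++ R :: a)) : graft c R a b e = e := by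
  rw [graft, dif_neg]
  exact fun ⟨u, hu⟩ => h u hu

theorem graft_nil (c : ℕ) (R : Role) (a b : List Role) (k : ℕ) :
    graft c R a b (k, []) = (k, []) :=
  graft_of_ne (by simp)

theorem graft_fst (c : ℕ) (R : Role) (a b : List Role) (e : Elem) :
    (graft c R a b e).1 = e.1 := by
  by_cases h : ∃ u, e = (c, u ++ R :: a)
  · obtain ⟨u, rfl⟩ := h
    rw [graft_append]
  · push Not at h
    rw [graft_of_ne h]

theorem length_graft_le (c : ℕ) (R : Role) {a b : List Role} (hab : b.length < a.length)
    (e : Elem) : (graft c R a b e).2.length ≤ e.2.length := by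
  by_cases h : ∃ u, e = (c, u ++ R :: a)
  · obtain ⟨u, rfl⟩ := h
    rw [graft_append]
    simp
    omega
  · push Not at h
    rw [graft_of_ne h]

section Graft

variable {c : ℕ} {R : Role} {a b : List Role} (hb : Valid T A c (R :: b))
include hb

theorem graft_concExt {B : BConcept} {e : Elem} (h : e ∈ (canon T A).concExt B) :
    graft c R a b e ∈ (canon T A).concExt B := by
  by_cases h' : ∃ u, e = (c, u ++ R :: a)
  · obtain ⟨u, rfl⟩ := h'
    rw [graft_append, canon_concExt]
    rw [canon_concExt] at h
    exact ⟨h.1.replace hb, elTyp_append.1 h.2⟩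
  · push Not at h'
    rwa [graft_of_ne h']

theorem valid_graft {e : Elem} (h : Valid T A e.1 e.2) :
    Valid T A (graft c R a b e).1 (graft c R a b e).2 := by
  by_cases h' : ∃ u, e = (c, u ++ R :: a)
  · obtain ⟨u, rfl⟩ := h'
    rw [graft_append]
    exact h.replace hb
  · push Not at h'
    rwa [graft_of_ne h']

/-- Grafting moves the subtree at `R :: a` onto the one at `R :: b`. The only edge cut is the one
from `(c, a)` to the root of the moved subtree; every other edge has both ends inside it or both
outside. -/
theorem graft_child {k : ℕ} {S : Role} {w : List Role} (hv : Valid T A k (S :: w))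
    (hne : ((k, w) : Elem) ≠ (c, a)) :
    ∃ w', graft c R a b (k, w) = (k, w') ∧ graft c R a b (k, S :: w) = (k, S :: w') ∧
      Valid T A k (S :: w') := by
  by_cases h' : ∃ u, ((k, w) : Elem) = (c, u ++ R :: a)
  · obtain ⟨u, hu⟩ := h'
    obtain ⟨rfl, rfl⟩ := Prod.mk.inj hu
    exact ⟨_, graft_append .., graft_append _ _ _ _ (S :: u), hv.replace (u := S :: u) hb⟩
  · push Not at h'
    refine ⟨w, graft_of_ne h', graft_of_ne fun u hu => ?_, hv⟩
    obtain ⟨rfl, hu⟩ := Prod.mk.inj hu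
    cases u with
    | nil => exact hne (by simp_all)
    | cons S' u => exact h' u (by simp_all)

theorem graft_holdsAtom {F : Assertion Elem} (h : (canon T A).HoldsAtom F)
    (hne : ∀ e ∈ F.terms, e ≠ (c, a)) : (canon T A).HoldsAtom (F.map (graft c R a b)) := by
  cases F with
  | conc N e => exact graft_concExt hb (B := .name N) h
  | role P x y =>
    simp only [Assertion.terms, List.mem_cons, List.not_mem_nil, or_false, forall_eq_or_imp,
      forall_eq] at hne
    rcases h with ⟨h1, h2, h3⟩ | ⟨h1, hv⟩ | ⟨h1, hv⟩
    · obtain ⟨x, _⟩ := x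
      obtain ⟨y, _⟩ := y
      dsimp only at h1 h2
      subst h1 h2
      exact .inl (by simpa [graft_nil] using h3)
    · obtain ⟨x, w⟩ := x
      subst h1
      obtain ⟨w', e1, e2, hv'⟩ := graft_child hb hv hne.1
      exact .inr (.inl (by rw [e1, e2]; exact ⟨rfl, hv'⟩))
    · obtain ⟨y, w⟩ := y
      subst h1
      obtain ⟨w', e1, e2, hv'⟩ := graft_child hb hv hne.2
      exact .inr (.inr (by rw [e1, e2]; exact ⟨rfl, hv'⟩))

end Graft

/-- `μ` maps the disjunct `d` into the canonical model. -/
def IsMatch (T : TBox) (A : ABox) (d : CQ) (ρ : ℕ → ℕ) (μ : ℕ → Elem) : Prop :=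
  (∀ x, x ∉ d.evars → μ x = (ρ x, [])) ∧
    ∀ a ∈ d.atoms, (canon T A).HoldsAtom (a.map (QTerm.eval (canon T A) μ))

theorem qTerm_eval_canon_comp {μ : ℕ → Elem} {f : Elem → Elem} (hf : ∀ k, f (k, []) = (k, []))
    (t : QTerm) :
    QTerm.eval (canon T A) (f ∘ μ) t = f (QTerm.eval (canon T A) μ t) := by
  cases t with
  | const k => exact (hf k).symm
  | var x => rfl

/-- A repetition of roles along a path, at places where the parents avoid a given set. -/
theorem exists_repetition {c : ℕ} {w : List Role} (hv : Valid T A c w) (W : Finset Elem)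
    (hlt : W.card + T.pos.length < w.length) :
    ∃ u R a b, w = u ++ R :: a ∧ b.length < a.length ∧ Valid T A c (R :: b) ∧ (c, a) ∉ W := by
  classical
  let J := (Finset.range w.length).filter fun j => ((c, w.drop (j + 1)) : Elem) ∉ W
  have hdrop : ∀ j (h : j < w.length), w.drop j = w[j] :: w.drop (j + 1) := fun j h =>
    List.drop_eq_getElem_cons h
  have hvd : ∀ j, Valid T A c (w.drop j) := fun j =>
    Valid.of_append (u := w.take j) (by rwa [List.take_append_drop])
  -- Suffixes at different places have different lengths, so at most `W.card` places are excluded.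
  -- Among the remaining ones some role occurs twice, by the pigeonhole principle.
  have hJ : T.pos.length < J.card := by
    have h1 : ((Finset.range w.length).filter fun j => ¬ ((c, w.drop (j + 1)) : Elem) ∉ W).card
        ≤ W.card := by
      refine Finset.card_le_card_of_injOn (fun j => ((c, w.drop (j + 1)) : Elem))
        (fun j hj => ?_) fun j hj j' hj' h => ?_
      · simpa using (Finset.mem_filter.1 hj).2
      · have := congrArg (fun e : Elem => e.2.length) h
        have h1 := Finset.mem_range.1 (Finset.mem_filter.1 hj).1
        have h2 := Finset.mem_range.1 (Finset.mem_filter.1 hj').1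
        simp at this
        omega
    have h2 := Finset.card_filter_add_card_filter_not (s := Finset.range w.length)
      (fun j => ((c, w.drop (j + 1)) : Elem) ∉ W)
    rw [Finset.card_range] at h2
    change J.card + _ = _ at h2
    omega
  let f : ℕ → BConcept := fun j => if h : j < w.length then .ex w[j] else .name 0
  obtain ⟨i, hi, j, hj, hne, hf⟩ := Finset.exists_ne_map_eq_of_card_lt_of_maps_to
    (s := J) (t := (T.pos.map Prod.snd).toFinset) (f := f)
    (lt_of_le_of_lt ((List.toFinset_card_le _).trans (by simp)) hJ) (fun j hj => by
      have h := Finset.mem_range.1 (Finset.mem_filter.1 hj).1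
      simp only [f, dif_pos h, List.coe_toFinset, Set.mem_ofPred_eq]
      exact (hdrop j h ▸ hvd j : Valid T A c (w[j] :: w.drop (j + 1))).ex_mem)
  wlog hij : i < j generalizing i j
  · exact this j hj i hi hne.symm hf.symm (by omega)
  have hi' := Finset.mem_filter.1 hi
  have hj' := Finset.mem_filter.1 hj
  have h1 := Finset.mem_range.1 hi'.1
  have h2 := Finset.mem_range.1 hj'.1
  simp only [f, dif_pos h1, dif_pos h2, BConcept.ex.injEq] at hf
  refine ⟨w.take i, w[i], w.drop (i + 1), w.drop (j + 1), ?_, ?_, ?_, hi'.2⟩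
  · rw [← hdrop i h1, List.take_append_drop]
  · simp
    omega
  · rw [hf, ← hdrop j h2]
    exact hvd j

/-- The bound on the length of words in matches. -/
def matchBound (T : TBox) (d : CQ) : ℕ := d.evars.length + T.pos.length

/-- A word beyond the bound contains a role twice, and the occurrence farther from the constant can
be chosen such that its parent is not a value of an existential variable. Grafting the subtree from
there to the nearer occurrence breaks no atom of the query, because the edge cut is not used, and it
lowers the total length of the words. -/
theorem IsMatch.exists_bounded {d : CQ} {ρ : ℕ → ℕ} {μ : ℕ → Elem} (h : IsMatch T A d ρ μ) :
    ∃ μ', IsMatch T A d ρ μ' ∧ ∀ x ∈ d.evars, μ' x = (0, []) ∨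
      (Valid T A (μ' x).1 (μ' x).2 ∧ (μ' x).1 ∈ adom A ∧
        (μ' x).2.length ≤ matchBound T d) := by
  classical
  -- An existential variable that occurs in no atom is unconstrained and gets the dummy value `(0,
  -- [])`. The values of the others are elements that satisfy some atom, hence valid ones over the
  -- active domain.
  have h0 : ∃ μ', IsMatch T A d ρ μ' ∧ ∀ x ∈ d.evars, μ' x = (0, []) ∨
      (Valid T A (μ' x).1 (μ' x).2 ∧ (μ' x).1 ∈ adom A) := by
    let occ : ℕ → Prop := fun x => ∃ a ∈ d.atoms, QTerm.var x ∈ a.terms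
    refine ⟨fun x => if x ∈ d.evars ∧ ¬ occ x then (0, []) else μ x, ⟨fun x hx => ?_,
      fun a ha => ?_⟩, fun x hx => ?_⟩
    · exact (if_neg (by tauto)).trans (h.1 x hx)
    · rw [Assertion.map_congr (g := QTerm.eval (canon T A) μ)]
      · exact h.2 a ha
      · rintro (k | x) ht
        · rfl
        · exact if_neg fun h' => h'.2 ⟨a, ha, ht⟩
    · beta_reduce
      by_cases ho : occ x
      · rw [if_neg fun h' => h'.2 ho]
        obtain ⟨a, ha, ht⟩ := ho
        refine .inr (canon_holdsAtom_terms (h.2 a ha) ?_)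
        rw [Assertion.terms_map]
        exact List.mem_map_of_mem (f := QTerm.eval (canon T A) μ) ht
      · exact .inl (if_pos ⟨hx, ho⟩)
  clear h
  obtain ⟨μ, h, hμ⟩ := h0
  induction hn : (d.evars.map fun x => (μ x).2.length).sum using Nat.strong_induction_on
    generalizing μ with
  | _ n ih =>
    by_cases hall : ∀ x ∈ d.evars, (μ x).2.length ≤ matchBound T d
    · exact ⟨μ, h, fun x hx => (hμ x hx).imp id fun h' => ⟨h'.1, h'.2, hall x hx⟩⟩
    push Not at hall
    obtain ⟨x, hx, hlen⟩ := hall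
    have hv : Valid T A (μ x).1 (μ x).2 := by
      rcases hμ x hx with h' | h'
      · rw [h']
        trivial
      · exact h'.1
    -- The parents to avoid are the values of the existential variables; this is the summand
    -- `d.evars.length` of `matchBound`.
    obtain ⟨u, R, a, b, hw, hab, hb, hW⟩ := exists_repetition hv (d.evars.map μ).toFinset
      (lt_of_le_of_lt (Nat.add_le_add_right ((List.toFinset_card_le _).trans (by simp)) _) hlen)
    set c := (μ x).1
    have hx' : μ x = (c, u ++ R :: a) := Prod.ext rfl hw
    refine ih (d.evars.map fun x => (graft c R a b (μ x)).2.length).sum ?_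
      (graft c R a b ∘ μ) ⟨fun y hy => ?_, fun F hF => ?_⟩ (fun y hy => ?_) rfl
    · rw [← hn]
      refine List.sum_lt_sum _ _ (fun y _ => length_graft_le _ _ hab _) ⟨x, hx, ?_⟩
      rw [hx', graft_append]
      simpa using hab
    · rw [Function.comp_apply, h.1 y hy, graft_nil]
    · have := graft_holdsAtom hb (a := a) (h.2 F hF) ?_
      · rw [Assertion.map_map] at this
        convert this using 2
        funext t
        exact qTerm_eval_canon_comp (graft_nil c R a b) t
      · intro e he
        rw [Assertion.terms_map, List.mem_map] at he
        obtain ⟨t, _, rfl⟩ := he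
        -- Terms with a constant as value have the empty word, whereas `a` is longer than `b` and
        -- hence nonempty.
        have hnil : ∀ k : ℕ, ((k, []) : Elem) ≠ (c, a) := by
          intro k hk
          rw [← (Prod.mk.inj hk).2] at hab
          simp at hab
        cases t with
        | const k => exact hnil k
        | var y =>
          by_cases hy : y ∈ d.evars
          · exact fun h' => hW (h' ▸ by simpa using ⟨y, hy, rfl⟩)
          · change μ y ≠ _
            rw [h.1 y hy]
            exact hnil _
    · rcases hμ y hy with h' | h'
      · left
        rw [Function.comp_apply, h', graft_nil]
      · right
        exact ⟨valid_graft hb h'.1, by simpa [graft_fst] using h'.2⟩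

end BoundedMatches

/-! ### Decidability of consistency and of certain answers. -/

section DecidingCertainAnswers

open Numbered

variable {α β γ δ : Type} [Numbered α] [Numbered β] [Numbered γ] [Numbered δ]

@[fun_prop]
theorem Eff.head? {f : γ → List α} (hf : Eff f) : Eff fun x => (f x).head? :=
  (Eff.foldr (z := fun _ => none) (g := fun _ a _ => Option.some a) hf (by fun_prop)
    (by fun_prop)).congr fun x => by cases f x <;> rfl

@[fun_prop]
theorem Eff.tail {f : γ → List α} (hf : Eff f) : Eff fun x => (f x).tail :=
  Eff.comp (f := List.tail) ⟨fun n => Encodable.encode (Denumerable.ofNat (List ℕ) n).tail,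
    Primrec.encode.comp (Primrec.list_tail.comp (Primrec.ofNat _)),
    fun l => by simp only [ofNat_code_list, ← List.map_tail]; rfl⟩ hf

@[fun_prop]
theorem Eff.tails {f : γ → List α} (hf : Eff f) : Eff fun x => (f x).tails := by
  refine (Eff.foldr (z := fun _ => [[]]) (g := fun _ a ls => (a :: ls.head?.getD []) :: ls) hf
    (by fun_prop) (by fun_prop)).congr fun x => ?_
  induction f x with
  | nil => rfl
  | cons a l ih =>
    rw [List.foldr_cons, ih]
    cases l <;> rfl

theorem RE.option_elim {o : γ → Option α} {p : γ → Prop} {q : γ → α → Prop} (ho : Eff o)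
    (hp : RE p) (hq : RE fun x : γ × α => q x.1 x.2) : RE fun x => (o x).elim (p x) (q x) :=
  (((Rec.eq ho (Eff.const none)).re.and hp).or (RE.ex (p := fun x a => o x = some a ∧ q x a)
    ((Rec.eq (by fun_prop) (by fun_prop)).re.and hq))).of_iff fun x => by cases o x <;> simp

theorem Rec.option_elim {o : γ → Option α} {p : γ → Prop} {q : γ → α → Prop} (ho : Eff o)
    (hp : Rec p) (hq : Rec fun x : γ × α => q x.1 x.2) : Rec fun x => (o x).elim (p x) (q x) :=
  ⟨RE.option_elim ho hp.1 hq.1, (RE.option_elim (q := fun x a => ¬ q x a) ho hp.2 hq.2).of_iff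
    fun x => by beta_reduce; cases o x <;> simp⟩

@[fun_prop]
theorem Eff.flip {f : γ → Role} (hf : Eff f) : Eff fun x => (f x).flip :=
  (Eff.sum_elim (g := fun _ P => Role.inv P) (h := fun _ P => Role.name P) (Eff.role_equiv hf)
    (by fun_prop) (by fun_prop)).congr fun x => by cases f x <;> rfl

/-- The constants in a list of assertions. -/
def adomList (l : List (Assertion ℕ)) : List ℕ := l.flatMap Assertion.terms

@[fun_prop]
theorem Eff.adomList {f : γ → List (Assertion ℕ)} (hf : Eff f) : Eff fun x => adomList (f x) :=
  Eff.flatMap (g := fun _ (F : Assertion ℕ) => F.terms) hf (by fun_prop)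

theorem mem_adomList {l : List (Assertion ℕ)} {c : ℕ} :
    c ∈ adomList l ↔ c ∈ adom l.toFinset := by
  simp [adomList, adom]

/-- The basic concepts of which some constant is an asserted instance. -/
def assertedList (l : List (Assertion ℕ)) : List BConcept :=
  l.flatMap fun F => (Assertion.equiv ℕ F).elim (fun x => [.name x.1])
    fun x => [.ex (.name x.1), .ex (.inv x.1)]

@[fun_prop]
theorem Eff.assertedList {f : γ → List (Assertion ℕ)} (hf : Eff f) :
    Eff fun x => assertedList (f x) :=
  Eff.flatMap hf (Eff.sum_elim (by fun_prop) (by fun_prop) (by fun_prop))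

theorem Asserted.mem_assertedList {l : List (Assertion ℕ)} {c : ℕ} {B : BConcept}
    (h : Asserted l.toFinset c B) : B ∈ assertedList l := by
  rw [assertedList, List.mem_flatMap]
  rcases B with N | P | P
  · exact ⟨_, List.mem_toFinset.1 h, by simp [Assertion.equiv]⟩
  · obtain ⟨d, hd⟩ := h
    exact ⟨_, List.mem_toFinset.1 hd, by simp [Assertion.equiv]⟩
  · obtain ⟨d, hd⟩ := h
    exact ⟨_, List.mem_toFinset.1 hd, by simp [Assertion.equiv]⟩

theorem exists_asserted_of_mem {l : List (Assertion ℕ)} {B : BConcept} (h : B ∈ assertedList l) :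
    ∃ c, Asserted l.toFinset c B := by
  rw [assertedList, List.mem_flatMap] at h
  obtain ⟨F, hF, hB⟩ := h
  cases F with
  | conc N t =>
    simp only [Assertion.equiv, Equiv.coe_fn_mk, Sum.elim_inl, List.mem_singleton] at hB
    subst hB
    exact ⟨t, List.mem_toFinset.2 hF⟩
  | role P t u =>
    simp only [Assertion.equiv, Equiv.coe_fn_mk, Sum.elim_inr, List.mem_cons, List.not_mem_nil,
      or_false] at hB
    rcases hB with rfl | rfl
    · exact ⟨t, u, List.mem_toFinset.2 hF⟩
    · exact ⟨u, t, List.mem_toFinset.2 hF⟩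

section

variable {T : γ → TBox} {A : γ → List (Assertion ℕ)} {R : γ → Role} {B B' : γ → BConcept}
  {c d : γ → ℕ} {e : γ → Elem}

theorem Rec.mem_toFinset {F : γ → Assertion ℕ} (hF : Eff F) (hA : Eff A) :
    Rec fun x => F x ∈ (A x).toFinset :=
  (Rec.mem hF hA).of_iff fun _ => List.mem_toFinset

theorem Rec.mem_adom (hc : Eff c) (hA : Eff A) : Rec fun x => c x ∈ adom (A x).toFinset :=
  (Rec.mem hc (by fun_prop : Eff fun x => KABs.adomList (A x))).of_iff fun _ => mem_adomList.symm

theorem Rec.roleIn (hA : Eff A) (hR : Eff R) (hc : Eff c) (hd : Eff d) :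
    Rec fun x => RoleIn (A x).toFinset (R x) (c x) (d x) :=
  (Rec.sum_elim (g := fun x P => .role P (c x) (d x) ∈ (A x).toFinset)
    (h := fun x P => .role P (d x) (c x) ∈ (A x).toFinset) (Eff.role_equiv hR)
    (Rec.mem_toFinset (by fun_prop) (by fun_prop))
    (Rec.mem_toFinset (by fun_prop) (by fun_prop))).of_iff fun x => by cases R x <;> rfl

theorem RoleIn.mem_adom {A : ABox} {R : Role} {c d : ℕ} (h : RoleIn A R c d) :
    c ∈ adom A ∧ d ∈ adom A :=
  ⟨Asserted.mem_adom (B := .ex R) ⟨d, h⟩,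
    Asserted.mem_adom (B := .ex R.flip) ⟨c, (roleIn_flip _ _ _ _).2 h⟩⟩

theorem Rec.exists_roleIn (hA : Eff A) (hR : Eff R) (hc : Eff c) :
    Rec fun x => ∃ d, RoleIn (A x).toFinset (R x) (c x) d :=
  (Rec.bex (f := fun x => KABs.adomList (A x)) (by fun_prop)
    (Rec.roleIn (γ := γ × ℕ) (A := fun y => A y.1) (R := fun y => R y.1) (c := fun y => c y.1)
      (d := Prod.snd) (by fun_prop) (by fun_prop) (by fun_prop) (by fun_prop))).of_iff fun x =>
    ⟨fun ⟨d, h⟩ => ⟨d, mem_adomList.2 h.mem_adom.2, h⟩, fun ⟨d, _, h⟩ => ⟨d, h⟩⟩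

theorem Rec.asserted (hA : Eff A) (hc : Eff c) (hB : Eff B) :
    Rec fun x => Asserted (A x).toFinset (c x) (B x) :=
  (Rec.sum_elim (g := fun x N => .conc N (c x) ∈ (A x).toFinset)
    (h := fun x R => ∃ d, RoleIn (A x).toFinset R (c x) d) (Eff.bConcept_equiv hB)
    (Rec.mem_toFinset (by fun_prop) (by fun_prop))
    (Rec.exists_roleIn (by fun_prop) (by fun_prop) (by fun_prop))).of_iff fun x => by
      cases B x <;> rfl

theorem Rec.sub (hT : Eff T) (hB : Eff B) (hB' : Eff B') :
    Rec fun x => Sub (T x) (B x) (B' x) := by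
  have := Rec.reflTransGen (γ := TBox) (step := fun T B B' => (B, B') ∈ T.pos)
    (succs := fun x => x.1.pos.map Prod.snd) (Eff.map (g := fun _ => Prod.snd) (by fun_prop)
      (by fun_prop)) (Rec.mem (by fun_prop) (by fun_prop))
    fun _ _ _ _ _ h => List.mem_map_of_mem h
  exact this.comp (f := fun x => (T x, B x, B' x)) (by fun_prop)

theorem Rec.elTyp (hT : Eff T) (hA : Eff A) (he : Eff e) (hB : Eff B) :
    Rec fun x => ElTyp (T x) (A x).toFinset (e x) (B x) := by
  have h := Rec.option_elim (o := fun x => (e x).2.head?)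
    (p := fun x => ∃ B₀ ∈ KABs.assertedList (A x), Asserted (A x).toFinset (e x).1 B₀ ∧ Sub (T x) B₀ (B x))
    (q := fun x R => Sub (T x) (.ex R.flip) (B x)) (by fun_prop)
    (Rec.bex (by fun_prop) (Rec.and (Rec.asserted (by fun_prop) (by fun_prop) (by fun_prop))
      (Rec.sub (by fun_prop) (by fun_prop) (by fun_prop))))
    (Rec.sub (by fun_prop) (by fun_prop) (by fun_prop))
  refine h.of_iff fun x => ?_
  rcases e x with ⟨c, _ | ⟨R, w⟩⟩
  · exact ⟨fun ⟨B₀, h⟩ => ⟨B₀, h.1.mem_assertedList, h⟩, fun ⟨B₀, _, h⟩ => ⟨B₀, h⟩⟩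
  · exact Iff.rfl

theorem Rec.hasSucc (hA : Eff A) (he : Eff e) (hR : Eff R) :
    Rec fun x => HasSucc (A x).toFinset (e x) (R x) := by
  have h := Rec.option_elim (o := fun x => (e x).2.head?)
    (p := fun x => ∃ d, RoleIn (A x).toFinset (R x) (e x).1 d)
    (q := fun x R' => R x = R'.flip) (by fun_prop)
    (Rec.exists_roleIn (by fun_prop) (by fun_prop) (by fun_prop))
    (Rec.eq (by fun_prop) (by fun_prop))
  refine h.of_iff fun x => ?_
  rcases e x with ⟨c, _ | ⟨R, w⟩⟩ <;> exact Iff.rfl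

/-- Recursion along the word becomes a quantifier over its suffixes, to which the closure properties
apply. -/
theorem valid_iff {T : TBox} {A : ABox} {c : ℕ} {w : List Role} :
    Valid T A c w ↔ ∀ v ∈ w.tails, v.head?.elim True fun R =>
      ElTyp T A (c, v.tail) (.ex R) ∧ ¬ HasSucc A (c, v.tail) R := by
  induction w with
  | nil => simp [Valid]
  | cons R w ih =>
    rw [List.tails_cons, List.forall_mem_cons, ← ih]
    simp only [Valid, List.head?_cons, Option.elim_some, List.tail_cons]
    tauto

theorem Rec.valid (hT : Eff T) (hA : Eff A) (he : Eff e) :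
    Rec fun x => Valid (T x) (A x).toFinset (e x).1 (e x).2 := by
  refine Rec.of_iff ?_ fun x => valid_iff
  refine Rec.ball (by fun_prop) (Rec.option_elim (by fun_prop) (Rec.const _) (Rec.and
    (Rec.elTyp ?_ ?_ ?_ ?_) (Rec.hasSucc ?_ ?_ ?_).not)) <;> fun_prop

theorem Rec.canon_holdsAtom {F : γ → Assertion Elem} (hT : Eff T) (hA : Eff A) (hF : Eff F) :
    Rec fun x => (canon (T x) (A x).toFinset).HoldsAtom (F x) := by
  have h := Rec.sum_elim (g := fun x y => Valid (T x) (A x).toFinset y.2.1 y.2.2 ∧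
      ElTyp (T x) (A x).toFinset y.2 (.name y.1))
    (h := fun x y => (y.2.1.2 = [] ∧ y.2.2.2 = [] ∧
        Assertion.role y.1 y.2.1.1 y.2.2.1 ∈ (A x).toFinset) ∨
      (y.2.2 = (y.2.1.1, .name y.1 :: y.2.1.2) ∧ Valid (T x) (A x).toFinset y.2.2.1 y.2.2.2) ∨
      (y.2.1 = (y.2.2.1, .inv y.1 :: y.2.2.2) ∧ Valid (T x) (A x).toFinset y.2.1.1 y.2.1.2))
    (Eff.assertion_equiv hF)
    (Rec.and (Rec.valid (by fun_prop) (by fun_prop) (by fun_prop))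
      (Rec.elTyp (by fun_prop) (by fun_prop) (by fun_prop) (by fun_prop)))
    (Rec.or (Rec.and (Rec.eq (by fun_prop) (by fun_prop)) (Rec.and (Rec.eq (by fun_prop) (by fun_prop))
        (Rec.mem_toFinset (by fun_prop) (by fun_prop))))
      (Rec.or (Rec.and (Rec.eq (by fun_prop) (by fun_prop))
          (Rec.valid (by fun_prop) (by fun_prop) (by fun_prop)))
        (Rec.and (Rec.eq (by fun_prop) (by fun_prop))
          (Rec.valid (by fun_prop) (by fun_prop) (by fun_prop)))))
  exact h.of_iff fun x => by cases F x <;> rfl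

/-- The nonemptiness of `B` entails that of `B'`, in one step. -/
def Jump (T : TBox) (B B' : BConcept) : Prop :=
  (B, B') ∈ T.pos ∨ ∃ R : Role, B = .ex R ∧ B' = .ex R.flip

/-- The concepts that can be reached from `B` by jumps. -/
def jumpList (x : TBox × BConcept) : List BConcept :=
  (x.2 :: x.1.pos.map Prod.snd).flatMap fun B => B :: (BConcept.equiv B).elim (fun _ => [])
    fun R => [.ex R.flip]

theorem Eff.jumpList : Eff jumpList :=
  Eff.flatMap (.cons (by fun_prop) (Eff.map (g := fun _ => Prod.snd) (by fun_prop) (by fun_prop)))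
    (.cons (by fun_prop) (Eff.sum_elim (by fun_prop) (by fun_prop) (by fun_prop)))

theorem mem_jumpList {T : TBox} {B B' : BConcept} : B' ∈ jumpList (T, B) ↔
    ∃ C ∈ B :: T.pos.map Prod.snd, B' = C ∨ ∃ R : Role, C = .ex R ∧ B' = .ex R.flip := by
  rw [jumpList, List.mem_flatMap]
  refine exists_congr fun C => and_congr_right fun _ => ?_
  cases C <;> simp [BConcept.equiv]

/-- Because `Role.flip` is an involution, at most one inversion after the start or after a
right-hand side ever has to be recorded. -/
theorem mem_jumpList_of_jump {T : TBox} {B B' B'' : BConcept} (h : B' ∈ jumpList (T, B))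
    (h' : Jump T B' B'') : B'' ∈ jumpList (T, B) := by
  rw [mem_jumpList] at h ⊢
  rcases h' with h' | ⟨R, rfl, rfl⟩
  · exact ⟨B'', List.mem_cons_of_mem _ (List.mem_map_of_mem h'), .inl rfl⟩
  · obtain ⟨C, hC, rfl | ⟨R', rfl, h⟩⟩ := h
    · exact ⟨_, hC, .inr ⟨R, rfl, rfl⟩⟩
    · refine ⟨_, hC, .inl ?_⟩
      rw [BConcept.ex.inj h, Role.flip_flip]

theorem mem_jumpList_of_reflTransGen {T : TBox} {B B' : BConcept}
    (h : Relation.ReflTransGen (Jump T) B B') : B' ∈ jumpList (T, B) := by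
  induction h with
  | refl => exact mem_jumpList.2 ⟨B, List.mem_cons_self, .inl rfl⟩
  | tail _ h ih => exact mem_jumpList_of_jump ih h

theorem Rec.jump (hT : Eff T) (hB : Eff B) (hB' : Eff B') :
    Rec fun x => Relation.ReflTransGen (Jump (T x)) (B x) (B' x) := by
  have h1 : Rec fun x : TBox × BConcept × BConcept => Jump x.1 x.2.1 x.2.2 := by
    refine Rec.or (Rec.mem (by fun_prop) (by fun_prop)) (Rec.of_iff (Rec.sum_elim
      (g := fun _ _ => False) (h := fun x R => x.2.2 = .ex R.flip)
      (f := fun x => BConcept.equiv x.2.1) (by fun_prop) (Rec.const _)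
      (Rec.eq (by fun_prop) (by fun_prop))) fun ⟨T, B, B'⟩ => ?_)
    cases B <;> simp [BConcept.equiv]
  have := Rec.reflTransGen (γ := TBox) (step := Jump) Eff.jumpList h1
    fun c a b d h h' => mem_jumpList_of_jump (mem_jumpList_of_reflTransGen h) h'
  exact this.comp (f := fun x => (T x, B x, B' x)) (by fun_prop)

theorem Sub.jump {T : TBox} {B B' : BConcept} (h : Sub T B B') :
    Relation.ReflTransGen (Jump T) B B' := Relation.ReflTransGen.mono (fun _ _ => Or.inl) _ _ h

/-- Each role of the word prolongs a chain of jumps: `∃R` follows from the type of the parent, and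
its inversion starts the type of the child. -/
theorem ElTyp.exists_jump {T : TBox} {A : ABox} {c : ℕ} {w : List Role} (hv : Valid T A c w)
    {B : BConcept} (h : ElTyp T A (c, w) B) :
    ∃ B₀, Asserted A c B₀ ∧ Relation.ReflTransGen (Jump T) B₀ B := by
  induction w generalizing B with
  | nil =>
    obtain ⟨B₀, h1, h2⟩ := h
    exact ⟨B₀, h1, h2.jump⟩
  | cons R w ih =>
    obtain ⟨B₀, h1, h2⟩ := ih hv.1 hv.2.1
    exact ⟨B₀, h1, (h2.tail (.inr ⟨R, rfl, rfl⟩)).trans (Sub.jump h)⟩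

theorem Interp.SatTBox.jump {T : TBox} {Δ : Type} {I : Interp Δ} (hI : I.SatTBox T)
    {B B' : BConcept} (h : Relation.ReflTransGen (Jump T) B B') (hB : (I.concExt B).Nonempty) :
    (I.concExt B').Nonempty := by
  induction h with
  | refl => exact hB
  | tail _ h ih =>
    rcases h with h | ⟨R, rfl, rfl⟩
    · exact ih.mono (hI.1 _ h)
    · obtain ⟨x, y, hxy⟩ := ih
      exact ⟨y, x, (I.roleExt_flip _ _ _).2 hxy⟩

/-- `NoClash` speaks of infinitely many elements. But an unnamed element's type depends on its last
role only, and this role is reached by jumps from an asserted concept, which leaves a finite test.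
Conversely, jumps may lead to concepts without instances among the unnamed elements, but they
preserve nonemptiness in every model, so a clash found in this way still refutes consistency. -/
theorem consistent_toFinset_iff {T : TBox} {l : List (Assertion ℕ)} : Consistent T l.toFinset ↔
    (∀ R ∈ T.funct, ∀ c ∈ adomList l, ∀ d ∈ adomList l, ∀ d' ∈ adomList l,
      RoleIn l.toFinset R c d → RoleIn l.toFinset R c d' → d = d') ∧
    (∀ c ∈ adomList l, ∀ i ∈ T.neg, ElTyp T l.toFinset (c, []) i.1 →
      ¬ ElTyp T l.toFinset (c, []) i.2) ∧
    ∀ B₀ ∈ assertedList l, ∀ B ∈ jumpList (T, B₀), Relation.ReflTransGen (Jump T) B₀ B →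
      ∀ i ∈ T.neg, Sub T B i.1 → ¬ Sub T B i.2 := by
  constructor
  · intro h
    have h' := consistent_iff.1 h
    refine ⟨fun R hR c _ d _ d' _ => h'.1 R hR c d d', fun c _ i hi => h'.2 c [] trivial i hi,
      fun B₀ h0 B _ hj i hi h1 h2 => ?_⟩
    obtain ⟨Δ, I, hI⟩ := h
    obtain ⟨c, hc⟩ := exists_asserted_of_mem h0
    obtain ⟨x, hx⟩ := hI.1.jump hj ⟨_, hI.2.asserted hc⟩
    exact hI.1.2.1 i hi x (hI.1.sub h1 hx) (hI.1.sub h2 hx)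
  · rintro ⟨h1, h2, h3⟩
    refine consistent_iff.2 ⟨fun R hR c d d' hd hd' => ?_, fun c w hv i hi k1 k2 => ?_⟩
    · exact h1 R hR c (mem_adomList.2 hd.mem_adom.1) d (mem_adomList.2 hd.mem_adom.2) d'
        (mem_adomList.2 hd'.mem_adom.2) hd hd'
    · cases w with
      | nil => exact h2 c (mem_adomList.2 (k1.mem_adom hv)) i hi k1 k2
      | cons R w =>
        obtain ⟨B₀, hB, hj⟩ := ElTyp.exists_jump hv (B := .ex R.flip) (Sub.refl _)
        exact h3 B₀ hB.mem_assertedList _ (mem_jumpList_of_reflTransGen hj) hj i hi k1 k2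

theorem Rec.consistent (hT : Eff T) (hA : Eff A) : Rec fun x => Consistent (T x) (A x).toFinset := by
  refine Rec.of_iff ?_ fun x => consistent_toFinset_iff
  refine Rec.and (Rec.ball ?_ (Rec.ball ?_ (Rec.ball ?_ (Rec.ball ?_ (Rec.imp (Rec.roleIn ?_ ?_ ?_ ?_)
    (Rec.imp (Rec.roleIn ?_ ?_ ?_ ?_) (Rec.eq ?_ ?_))))))) (Rec.and (Rec.ball ?_ (Rec.ball ?_
    (Rec.imp (Rec.elTyp ?_ ?_ ?_ ?_) (Rec.not (Rec.elTyp ?_ ?_ ?_ ?_))))) (Rec.ball ?_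
    (Rec.ball (Eff.jumpList.comp ?_) (Rec.imp (Rec.jump ?_ ?_ ?_) (Rec.ball ?_ (Rec.imp
    (Rec.sub ?_ ?_ ?_) (Rec.not (Rec.sub ?_ ?_ ?_)))))))) <;> fun_prop

end

/-- The assignment given by an association list; other variables get the value `0`. -/
def envFun (l : List (ℕ × ℕ)) (x : ℕ) : ℕ := (look l x).getD 0

@[fun_prop]
theorem Eff.envFun {f : γ → List (ℕ × ℕ)} {g : γ → ℕ} (hf : Eff f) (hg : Eff g) :
    Eff fun x => envFun (f x) (g x) := by
  unfold KABs.envFun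
  fun_prop

/-- The assignment of elements to variables given by `ml`, and by `l` for other variables. -/
def matchFun (l : List (ℕ × ℕ)) (ml : List (ℕ × Elem)) (x : ℕ) : Elem :=
  (look ml x).getD (envFun l x, [])

/-- The value of a term under `matchFun`. -/
def matchTerm (l : List (ℕ × ℕ)) (ml : List (ℕ × Elem)) (t : QTerm) : Elem :=
  (QTerm.equiv t).elim (fun c => (c, [])) (matchFun l ml)

@[fun_prop]
theorem Eff.matchTerm {f : γ → List (ℕ × ℕ)} {g : γ → List (ℕ × Elem)} {t : γ → QTerm} (hf : Eff f)
    (hg : Eff g) (ht : Eff t) : Eff fun x => matchTerm (f x) (g x) (t x) := by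
  unfold KABs.matchTerm KABs.matchFun
  exact Eff.sum_elim (by fun_prop) (by fun_prop) (by fun_prop)

theorem qTerm_eval_matchFun {T : TBox} {A : ABox} {l : List (ℕ × ℕ)} {ml : List (ℕ × Elem)} :
    QTerm.eval (canon T A) (matchFun l ml) = matchTerm l ml := by
  funext t
  cases t <;> rfl

/-- All atoms of `d` hold under the assignment given by `ml` and `l`. -/
def AtomsHold (T : TBox) (A : ABox) (d : CQ) (l : List (ℕ × ℕ)) (ml : List (ℕ × Elem)) : Prop :=
  ∀ a ∈ d.atoms, (canon T A).HoldsAtom (a.map (matchTerm l ml))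

theorem AtomsHold.isMatch {T : TBox} {A : ABox} {d : CQ} {l : List (ℕ × ℕ)}
    {ml : List (ℕ × Elem)} (h : AtomsHold T A d l ml) (hml : ∀ p ∈ ml, p.1 ∈ d.evars) :
    IsMatch T A d (envFun l) (matchFun l ml) := by
  refine ⟨fun x hx => ?_, by rwa [qTerm_eval_matchFun]⟩
  rw [matchFun, look_eq_none_iff.2, Option.getD_none]
  intro hx'
  obtain ⟨p, hp, rfl⟩ := List.mem_map.1 hx'
  exact hx (hml p hp)

theorem IsMatch.atomsHold {T : TBox} {A : ABox} {d : CQ} {l : List (ℕ × ℕ)} {μ : ℕ → Elem}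
    (h : IsMatch T A d (envFun l) μ) : AtomsHold T A d l (d.evars.map fun x => (x, μ x)) := by
  have : matchFun l (d.evars.map fun x => (x, μ x)) = μ := by
    funext x
    rw [matchFun, look_map]
    by_cases hx : x ∈ d.evars
    · simp [hx]
    · simp [hx, h.1 x hx]
  rw [AtomsHold, ← qTerm_eval_matchFun (T := T) (A := A), this]
  exact h.2

/-- The roles `R` with `∃R` on the right of a positive inclusion. -/
def rolesList (T : TBox) : List Role :=
  T.pos.flatMap fun i => (BConcept.equiv i.2).elim (fun _ => []) fun R => [R]

@[fun_prop]
theorem Eff.rolesList {f : γ → TBox} (hf : Eff f) : Eff fun x => rolesList (f x) :=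
  Eff.flatMap (by fun_prop) (Eff.sum_elim (by fun_prop) (by fun_prop) (by fun_prop))

theorem mem_rolesList {T : TBox} {R : Role} (h : BConcept.ex R ∈ T.pos.map Prod.snd) :
    R ∈ rolesList T := by
  obtain ⟨i, hi, h⟩ := List.mem_map.1 h
  exact List.mem_flatMap.2 ⟨i, hi, by simp [h, BConcept.equiv]⟩

theorem finite_lists {α : Type} {S : Set α} (hS : S.Finite) (n : ℕ) :
    {w : List α | w.length ≤ n ∧ ∀ x ∈ w, x ∈ S}.Finite := by
  induction n with
  | zero =>
    exact (Set.finite_singleton []).subset fun w hw => List.length_eq_zero_iff.1 (Nat.le_zero.1 hw.1)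
  | succ n ih =>
    refine ((Set.finite_singleton []).union (Set.Finite.image2 List.cons hS ih)).subset ?_
    rintro (_ | ⟨x, w⟩) hw
    · exact .inl rfl
    · exact .inr ⟨x, hw.2 x List.mem_cons_self, w, ⟨by simpa using hw.1,
        fun y hy => hw.2 y (List.mem_cons_of_mem _ hy)⟩, rfl⟩

/-- `es` contains all elements that are needed for a search for matches of `d`. -/
def Suffices (T : TBox) (A : List (Assertion ℕ)) (d : CQ) (es : List Elem) : Prop :=
  (0, []) ∈ es ∧ (∀ c ∈ adomList A, (c, []) ∈ es) ∧ ∀ e ∈ es, e.2.length < matchBound T d →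
    ∀ R ∈ rolesList T, (e.1, R :: e.2) ∈ es

/-- The list of all words of bounded length over `rolesList T`, attached to the constants of the
ABox and to the dummy `0`. -/
theorem exists_suffices (T : TBox) (A : List (Assertion ℕ)) (d : CQ) :
    ∃ es, Suffices T A d es := by
  have h := (((adomList A).finite_toSet).insert 0).prod
    (finite_lists ((rolesList T).finite_toSet) (matchBound T d))
  refine ⟨h.toFinset.toList, ?_, fun c hc => ?_, fun e he hl R hR => ?_⟩
  · simp
  · simp [hc]
  · simp only [Finset.mem_toList, Set.Finite.mem_toFinset, Set.mem_prod] at he ⊢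
    exact ⟨he.1, by simpa using hl, by simpa [hR] using he.2.2⟩

theorem Suffices.mem {T : TBox} {A : List (Assertion ℕ)} {d : CQ} {es : List Elem}
    (h : Suffices T A d es) {c : ℕ} {w : List Role} (hv : Valid T A.toFinset c w)
    (hc : c ∈ adom A.toFinset) (hw : w.length ≤ matchBound T d) : (c, w) ∈ es := by
  induction w with
  | nil => exact h.2.1 c (mem_adomList.2 hc)
  | cons R w ih =>
    rw [List.length_cons] at hw
    exact h.2.2 _ (ih hv.1 (by omega)) (by simpa using hw) R (mem_rolesList hv.ex_mem)

/-- Here `IsMatch.exists_bounded` enters. The absence of matches is certified by a finite list of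
elements, closed under extension up to the bound, over which every assignment fails. The list is
guessed rather than computed, so this makes the complement enumerable, and `exists_isMatch_iff` does
the same for the predicate itself. -/
theorem not_exists_isMatch_iff {T : TBox} {A : List (Assertion ℕ)} {d : CQ} {l : List (ℕ × ℕ)} :
    (¬ ∃ μ, IsMatch T A.toFinset d (envFun l) μ) ↔
      ∃ es, Suffices T A d es ∧ ∀ ml ∈ assigns d.evars es, ¬ AtomsHold T A.toFinset d l ml := by
  constructor
  · intro h
    obtain ⟨es, hes⟩ := exists_suffices T A d
    refine ⟨es, hes, fun ml hml ha => h ⟨_, ha.isMatch fun p hp => ?_⟩⟩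
    rw [← (mem_assigns.1 hml).1]
    exact List.mem_map_of_mem hp
  · rintro ⟨es, hes, h⟩ ⟨μ, hμ⟩
    obtain ⟨μ, hμ, hb⟩ := hμ.exists_bounded
    refine h _ (mem_assigns.2 ⟨by simp [Function.comp_def], ?_⟩) hμ.atomsHold
    rintro p hp
    obtain ⟨x, hx, rfl⟩ := List.mem_map.1 hp
    rcases hb x hx with h' | ⟨h1, h2, h3⟩
    · simpa only [h'] using hes.1
    · exact hes.mem h1 h2 h3

theorem exists_isMatch_iff {T : TBox} {A : List (Assertion ℕ)} {d : CQ} {l : List (ℕ × ℕ)} :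
    (∃ μ, IsMatch T A.toFinset d (envFun l) μ) ↔
      ∃ ml : List (ℕ × Elem), (∀ p ∈ ml, p.1 ∈ d.evars) ∧ AtomsHold T A.toFinset d l ml := by
  constructor
  · rintro ⟨μ, h⟩
    exact ⟨_, by simp, h.atomsHold⟩
  · rintro ⟨ml, h1, h2⟩
    exact ⟨_, h2.isMatch h1⟩

variable {T : γ → TBox} {A : γ → List (Assertion ℕ)} {l : γ → List (ℕ × ℕ)}

theorem Rec.atomsHold {d : γ → CQ} {ml : γ → List (ℕ × Elem)} (hT : Eff T) (hA : Eff A)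
    (hd : Eff d) (hl : Eff l) (hml : Eff ml) :
    Rec fun x => AtomsHold (T x) (A x).toFinset (d x) (l x) (ml x) :=
  Rec.ball (by fun_prop) (Rec.canon_holdsAtom (by fun_prop) (by fun_prop)
    (Eff.assertion_map (by fun_prop) (by fun_prop)))

theorem Rec.exists_isMatch {d : γ → CQ} (hT : Eff T) (hA : Eff A) (hd : Eff d) (hl : Eff l) :
    Rec fun x => ∃ μ, IsMatch (T x) (A x).toFinset (d x) (envFun (l x)) μ := by
  constructor
  · refine RE.of_iff ?_ fun x => exists_isMatch_iff
    exact RE.ex (RE.and (RE.ball (by fun_prop) (Rec.mem (by fun_prop) (by fun_prop)).re)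
      (Rec.atomsHold (by fun_prop) (by fun_prop) (by fun_prop) (by fun_prop) (by fun_prop)).re)
  · refine RE.of_iff ?_ fun x => not_exists_isMatch_iff
    unfold Suffices matchBound
    exact RE.ex (RE.and (RE.and (Rec.mem (by fun_prop) (by fun_prop)).re
      (RE.and (RE.ball (by fun_prop) (Rec.mem (by fun_prop) (by fun_prop)).re)
      (RE.ball (by fun_prop) (RE.imp (Rec.lt (by fun_prop) (by fun_prop)) (RE.ball (by fun_prop)
        (Rec.mem (by fun_prop) (by fun_prop)).re))))) (RE.ball (by fun_prop)
      (Rec.atomsHold (by fun_prop) (by fun_prop) (by fun_prop) (by fun_prop) (by fun_prop)).not.re))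

theorem Rec.certain {q : γ → UCQ} (hT : Eff T) (hA : Eff A) (hq : Eff (β := List CQ) q)
    (hl : Eff l) : Rec fun x => Certain (T x) (A x).toFinset (q x) (envFun (l x)) := by
  refine Rec.of_iff ?_ fun x => certain_iff
  exact Rec.or (Rec.consistent (by fun_prop) (by fun_prop)).not (Rec.bex hq
    (Rec.exists_isMatch (by fun_prop) (by fun_prop) (by fun_prop) (by fun_prop)))

end DecidingCertainAnswers

/-! ### Decidability of ECQ evaluation. -/

section DecidingQueries

open Numbered

variable {α β γ δ : Type} [Numbered α] [Numbered β] [Numbered γ] [Numbered δ]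

theorem Interp.SatUCQ.congr {Δ : Type} {I : Interp Δ} {q : UCQ} {ρ ρ' : ℕ → ℕ}
    (h : ∀ x ∈ UCQ.fv q, ρ x = ρ' x) (hs : I.SatUCQ q ρ) : I.SatUCQ q ρ' := by
  classical
  obtain ⟨d, hd, μ, h1, h2⟩ := hs
  refine ⟨d, hd, fun x => if x ∈ d.evars then μ x else I.const (ρ' x), fun x hx => if_neg hx,
    fun a ha => ?_⟩
  rw [Assertion.map_congr (g := QTerm.eval I μ)]
  · exact h2 a ha
  · rintro (c | x) ht
    · rfl
    · by_cases hx : x ∈ d.evars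
      · exact if_pos hx
      · change (if x ∈ d.evars then μ x else I.const (ρ' x)) = μ x
        rw [if_neg hx, h1 x hx, h x ⟨d, hd, hx, a, ha, ht⟩]

theorem certain_congr {T : TBox} {A : ABox} {q : UCQ} {ρ ρ' : ℕ → ℕ}
    (h : ∀ x ∈ UCQ.fv q, ρ x = ρ' x) : Certain T A q ρ ↔ Certain T A q ρ' :=
  ⟨fun H Δ I hI => (H Δ I hI).congr h, fun H Δ I hI => (H Δ I hI).congr fun x hx => (h x hx).symm⟩

theorem ECQ.holds_congr {T : TBox} {A : ABox} {Q : ECQ} {ρ ρ' : ℕ → ℕ}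
    (h : ∀ x ∈ Q.fv, ρ x = ρ' x) : Q.Holds T A ρ ↔ Q.Holds T A ρ' := by
  induction Q generalizing ρ ρ' with
  | ucq q => exact certain_congr h
  | neg Q ih => exact not_congr (ih h)
  | and Q Q' ih ih' =>
    exact and_congr (ih fun x hx => h x (.inl hx)) (ih' fun x hx => h x (.inr hx))
  | ex x Q ih =>
    refine exists_congr fun d => and_congr_right fun _ => ih fun y hy => ?_
    by_cases hxy : y = x
    · simp [hxy]
    · simp [hxy, h y ⟨hy, hxy⟩]

theorem envFun_cons (x d : ℕ) (l : List (ℕ × ℕ)) :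
    envFun ((x, d) :: l) = Function.update (envFun l) x d := by
  funext y
  rw [envFun, look_cons]
  by_cases h : x = y
  · simp [h]
  · simp [h, Ne.symm h, envFun]

/-- The rules for the truth values of queries. -/
def HoldsRule (c : TBox × List (Assertion ℕ)) (a : ECQ × List (ℕ × ℕ)) (b : Bool)
    (ps : List ((ECQ × List (ℕ × ℕ)) × Bool)) : Prop :=
  (∃ q : List CQ, a.1 = .ucq q ∧ ps = [] ∧ (b = true ↔ Certain c.1 c.2.toFinset q (envFun a.2))) ∨
  (∃ Q, a.1 = .neg Q ∧ ∃ b', ps = [((Q, a.2), b')] ∧ ¬ b = b') ∨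
  (∃ Q Q', a.1 = .and Q Q' ∧ ∃ b₁ b₂, ps = [((Q, a.2), b₁), ((Q', a.2), b₂)] ∧
    (b = true ↔ b₁ = true ∧ b₂ = true)) ∨
  ∃ x Q, a.1 = .ex x Q ∧ (∀ d ∈ adomList c.2, ∃ y ∈ ps, y.1 = (Q, (x, d) :: a.2)) ∧
    (∀ y ∈ ps, ∃ d ∈ adomList c.2, y.1 = (Q, (x, d) :: a.2)) ∧ (b = true ↔ ∃ y ∈ ps, y.2 = true)

theorem RE.holdsRule :
    RE fun x : (TBox × List (Assertion ℕ)) × ((ECQ × List (ℕ × ℕ)) × Bool) ×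
      List ((ECQ × List (ℕ × ℕ)) × Bool) => HoldsRule x.1 x.2.1.1 x.2.1.2 x.2.2 := by
  refine .or (.ex (.and (Rec.eq ?_ ?_).re (.and (Rec.eq ?_ ?_).re
    (Rec.iff (.eq ?_ ?_) (.certain ?_ ?_ ?_ ?_)).re)))
    (.or (.ex (.and (Rec.eq ?_ ?_).re (.ex (.and (Rec.eq ?_ ?_).re (Rec.eq ?_ ?_).not.re))))
    (.or (.ex (.ex (.and (Rec.eq ?_ ?_).re (.ex (.ex (.and (Rec.eq ?_ ?_).re
      (Rec.iff (.eq ?_ ?_) (.and (.eq ?_ ?_) (.eq ?_ ?_))).re))))))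
    (.ex (.ex (.and (Rec.eq ?_ ?_).re (.and (.ball ?_ (.bex ?_ (Rec.eq ?_ ?_).re))
      (.and (.ball ?_ (.bex ?_ (Rec.eq ?_ ?_).re)) (Rec.iff (.eq ?_ ?_) (.bex (p := fun _ (y : (ECQ × List (ℕ × ℕ)) × Bool) => y.2 = true) ?_ (.eq ?_ ?_))).re))))))) <;>
    fun_prop

theorem Rec.holds {T : γ → TBox} {A : γ → List (Assertion ℕ)} {Q : γ → ECQ}
    {l : γ → List (ℕ × ℕ)} (hT : Eff T) (hA : Eff A) (hQ : Eff Q) (hl : Eff l) :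
    Rec fun x => (Q x).Holds (T x) (A x).toFinset (envFun (l x)) := by
  classical
  -- The truth value of a query is inferred from those of its immediate subqueries; a quantifier
  -- takes a premise for each constant of the active domain.
  have := Rec.of_rules (γ := TBox × List (Assertion ℕ)) (α := ECQ × List (ℕ × ℕ))
    (p := fun c a => a.1.Holds c.1 c.2.toFinset (envFun a.2)) HoldsRule (fun a => sizeOf a.1)
    RE.holdsRule ?_ ?_
  · exact this.comp (f := fun x => ((T x, A x), (Q x, l x))) (by fun_prop)
  · rintro ⟨T, A⟩ ⟨Q, l⟩ b ps h ih
    rcases h with ⟨q, rfl, rfl, h⟩ | ⟨Q, rfl, b', rfl, h⟩ | ⟨Q, Q', rfl, b₁, b₂, rfl, h⟩ |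
      ⟨x, Q, rfl, h1, h2, h3⟩
    · exact h.symm
    · have := ih _ (List.mem_singleton_self _)
      simp only [ECQ.Holds, this]
      cases b <;> cases b' <;> simp_all
    · have h1 := ih ((Q, l), b₁) (by simp)
      have h2 := ih ((Q', l), b₂) (by simp)
      simp only [ECQ.Holds]
      rw [h, ← h1, ← h2]
    · rw [h3]
      simp only [ECQ.Holds]
      constructor
      · rintro ⟨d, hd, h⟩
        obtain ⟨y, hy, hyd⟩ := h1 d (mem_adomList.2 hd)
        refine ⟨y, hy, (ih y hy).1 ?_⟩
        rw [hyd]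
        simpa [envFun_cons] using h
      · rintro ⟨y, hy, h⟩
        obtain ⟨d, hd, hyd⟩ := h2 y hy
        refine ⟨d, mem_adomList.1 hd, ?_⟩
        have := (ih y hy).2 h
        rw [hyd] at this
        simpa [envFun_cons] using this
  · rintro ⟨T, A⟩ ⟨Q, l⟩ b h
    cases Q with
    | ucq q => exact ⟨[], .inl ⟨q, rfl, rfl, h.symm⟩, by simp⟩
    | neg Q =>
      refine ⟨[((Q, l), !b)], .inr (.inl ⟨Q, rfl, _, rfl, by simp⟩), ?_⟩
      simp only [ECQ.Holds] at h
      simp only [List.mem_singleton, forall_eq, ECQ.neg.sizeOf_spec]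
      refine ⟨?_, by omega⟩
      rw [← not_iff_not, h]
      simp
    | and Q Q' =>
      refine ⟨[((Q, l), decide (Q.Holds T A.toFinset (envFun l))),
        ((Q', l), decide (Q'.Holds T A.toFinset (envFun l)))],
        .inr (.inr (.inl ⟨Q, Q', rfl, _, _, rfl, ?_⟩)), ?_⟩
      · simp only [ECQ.Holds] at h
        simp [← h]
      · simp
        omega
    | ex x Q =>
      refine ⟨(adomList A).map fun d => ((Q, (x, d) :: l),
        decide (Q.Holds T A.toFinset (envFun ((x, d) :: l)))),
        .inr (.inr (.inr ⟨x, Q, rfl, ?_, ?_, ?_⟩)), ?_⟩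
      · simp
      · simp
      · simp only [ECQ.Holds] at h
        simp [← h, envFun_cons, mem_adomList]
      · simp

end DecidingQueries

/-! ### Repairs: decidability and invariance under renaming. -/

section Repairs

open Numbered

theorem Consistent.mono {T : TBox} {A B : ABox} (h : Consistent T A) (hBA : B ⊆ A) :
    Consistent T B := by
  obtain ⟨Δ, I, h1, h2⟩ := h
  exact ⟨Δ, I, h1, fun F hF => h2 F (hBA hF)⟩

/-- What is needed of a notion of repair. -/
structure GoodRepair (rep : TBox → ABox → ABox → Prop) : Prop where
  subset : ∀ {T A A'}, rep T A A' → A' ⊆ A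
  rename : ∀ {T A A'} (π : Equiv.Perm ℕ), rep T A A' →
    rep T (A.image (Assertion.map π)) (A'.image (Assertion.map π))
  recursive : Rec fun x : TBox × List (Assertion ℕ) × List (Assertion ℕ) =>
    rep x.1 x.2.1.toFinset x.2.2.toFinset

/-- Consistency passes to subsets, so maximality only has to be tested against the addition of a
single fact. -/
theorem isBRepair_iff {T : TBox} {A A' : ABox} : IsBRepair T A A' ↔
    A' ⊆ A ∧ Consistent T A' ∧ ∀ F ∈ A, Consistent T (insert F A') → F ∈ A' := by
  constructor
  · rintro ⟨⟨h1, h2⟩, h3⟩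
    refine ⟨h1, h2, fun F hF hc => ?_⟩
    exact h3 ⟨Finset.insert_subset hF h1, hc⟩ (Finset.subset_insert _ _) (Finset.mem_insert_self _ _)
  · rintro ⟨h1, h2, h3⟩
    refine ⟨⟨h1, h2⟩, fun B hB hA'B F hF => ?_⟩
    exact h3 F (hB.1 hF) (hB.2.mono (Finset.insert_subset hF hA'B))

theorem Assertion.map_id' {α : Type} (F : Assertion α) : F.map (fun x => x) = F := by
  cases F <;> rfl

theorem Assertion.map_symm_map (π : Equiv.Perm ℕ) (F : Assertion ℕ) :
    (F.map π).map π.symm = F := by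
  rw [Assertion.map_map]
  exact (Assertion.map_congr (g := fun x => x) (by simp)).trans F.map_id'

theorem Assertion.map_map_symm (π : Equiv.Perm ℕ) (F : Assertion ℕ) :
    (F.map π.symm).map π = F := Assertion.map_symm_map π.symm F

theorem Assertion.map_perm_injective (π : Equiv.Perm ℕ) :
    Function.Injective (Assertion.map π : Assertion ℕ → Assertion ℕ) :=
  Function.LeftInverse.injective (Assertion.map_symm_map π)

theorem image_map_symm_image (π : Equiv.Perm ℕ) (A : ABox) :
    (A.image (Assertion.map π)).image (Assertion.map π.symm) = A := by
  rw [Finset.image_image]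
  exact (Finset.image_congr (g := id) fun F _ => Assertion.map_symm_map π F).trans Finset.image_id

theorem image_map_image_symm (π : Equiv.Perm ℕ) (A : ABox) :
    (A.image (Assertion.map π.symm)).image (Assertion.map π) = A :=
  image_map_symm_image π.symm A

/-- The interpretation with constants renamed by `π`. -/
def Interp.rename {Δ : Type} (I : Interp Δ) (π : Equiv.Perm ℕ) : Interp Δ where
  const c := I.const (π c)
  const_injective := I.const_injective.comp π.injective
  conc := I.conc
  role := I.role

theorem Interp.concExt_rename {Δ : Type} (I : Interp Δ) (π : Equiv.Perm ℕ) (B : BConcept) :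
    (I.rename π).concExt B = I.concExt B := by
  rcases B with _ | _ | _ <;> rfl

theorem Interp.roleExt_rename {Δ : Type} (I : Interp Δ) (π : Equiv.Perm ℕ) (R : Role) :
    (I.rename π).roleExt R = I.roleExt R := by
  cases R <;> rfl

theorem Interp.holdsAtom_rename {Δ : Type} (I : Interp Δ) (π : Equiv.Perm ℕ) (F : Assertion Δ) :
    (I.rename π).HoldsAtom F ↔ I.HoldsAtom F := by
  cases F <;> rfl

/-- Renaming an ABox amounts to reassigning the constants; the concepts and roles of the
interpretation stay as they are. -/
theorem Interp.Model.rename {Δ : Type} {I : Interp Δ} {T : TBox} {A : ABox} {π : Equiv.Perm ℕ}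
    (h : I.Model T (A.image (Assertion.map π))) : (I.rename π).Model T A := by
  refine ⟨?_, fun F hF => ?_⟩
  · simpa only [Interp.SatTBox, Interp.concExt_rename, Interp.roleExt_rename] using h.1
  · have := h.2 _ (Finset.mem_image_of_mem _ hF)
    rw [Assertion.map_map] at this
    exact (I.holdsAtom_rename π _).2 this

theorem consistent_image_iff {T : TBox} {A : ABox} (π : Equiv.Perm ℕ) :
    Consistent T (A.image (Assertion.map π)) ↔ Consistent T A := by
  constructor
  · rintro ⟨Δ, I, h⟩
    exact ⟨Δ, _, h.rename⟩
  · rintro ⟨Δ, I, h⟩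
    refine ⟨Δ, I.rename π.symm, Interp.Model.rename ?_⟩
    rwa [image_map_symm_image]

theorem IsBRepair.rename {T : TBox} {A A' : ABox} (π : Equiv.Perm ℕ) (h : IsBRepair T A A') :
    IsBRepair T (A.image (Assertion.map π)) (A'.image (Assertion.map π)) := by
  rw [isBRepair_iff] at h ⊢
  refine ⟨Finset.image_subset_image h.1, (consistent_image_iff π).2 h.2.1, fun F hF hc => ?_⟩
  obtain ⟨G, hG, rfl⟩ := Finset.mem_image.1 hF
  rw [← Finset.image_insert, consistent_image_iff] at hc
  exact Finset.mem_image_of_mem _ (h.2.2 G hG hc)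

theorem consistent_empty (T : TBox) : Consistent T ∅ := by
  refine consistent_iff.2 ⟨fun R _ c d d' h => ?_, fun c w hv i _ h => ?_⟩
  · have := (RoleIn.mem_adom h).1
    simp [adom] at this
  · have := h.mem_adom hv
    simp [adom] at this

theorem exists_isBRepair (T : TBox) (A : ABox) : ∃ B, IsBRepair T A B := by
  have hfin : {B : ABox | B ⊆ A ∧ Consistent T B}.Finite :=
    (A.powerset.finite_toSet).subset fun B hB => Finset.mem_coe.2 (Finset.mem_powerset.2 hB.1)
  obtain ⟨B, hB⟩ := hfin.exists_maximal ⟨∅, Finset.empty_subset _, consistent_empty T⟩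
  exact ⟨B, hB⟩

theorem IsBRepair.exists_sublist {T : TBox} {l : List (Assertion ℕ)} {B : ABox}
    (h : IsBRepair T l.toFinset B) : ∃ s ∈ sublists l, s.toFinset = B := by
  refine ⟨l.filter fun F => F ∈ B, mem_sublists.2 (List.filter_sublist ..), ?_⟩
  ext F
  simp only [List.mem_toFinset, List.mem_filter, decide_eq_true_eq]
  exact ⟨fun h => h.2, fun hF => ⟨List.mem_toFinset.1 (h.1.1 hF), hF⟩⟩

theorem goodRepair_isBRepair : GoodRepair IsBRepair where
  subset h := h.1.1
  rename π h := h.rename π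
  recursive := by
    have : Rec fun x : TBox × List (Assertion ℕ) × List (Assertion ℕ) =>
      (∀ F ∈ x.2.2, F ∈ x.2.1) ∧ Consistent x.1 x.2.2.toFinset ∧
        ∀ F ∈ x.2.1, Consistent x.1 (F :: x.2.2).toFinset → F ∈ x.2.2 := by
      refine .and (.ball ?_ (.mem ?_ ?_)) (.and (.consistent ?_ ?_) (.ball ?_
        (.imp (.consistent ?_ ?_) (.mem ?_ ?_)))) <;> fun_prop
    refine this.of_iff fun x => ?_
    rw [isBRepair_iff]
    simp [Finset.subset_iff]

/-- There is at least one b-repair, so the intersection is not taken over an empty family. -/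
theorem IsCRepair.subset {T : TBox} {A A' : ABox} (h : IsCRepair T A A') : A' ⊆ A := by
  obtain ⟨B, hB⟩ := exists_isBRepair T A
  exact fun F hF => hB.1.1 ((h F).1 hF B hB)

/-- Every b-repair is presented by a sublist of `l`, which bounds the quantifier over repairs. -/
theorem isCRepair_iff {T : TBox} {l : List (Assertion ℕ)} {A' : ABox} :
    IsCRepair T l.toFinset A' ↔ A' ⊆ l.toFinset ∧
      ∀ F ∈ l, (F ∈ A' ↔ ∀ s ∈ sublists l, IsBRepair T l.toFinset s.toFinset → F ∈ s) := by
  have key : ∀ F, (∀ B, IsBRepair T l.toFinset B → F ∈ B) ↔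
      ∀ s ∈ sublists l, IsBRepair T l.toFinset s.toFinset → F ∈ s := by
    intro F
    constructor
    · intro h s _ hs
      exact List.mem_toFinset.1 (h _ hs)
    · intro h B hB
      obtain ⟨s, hs, rfl⟩ := hB.exists_sublist
      exact List.mem_toFinset.2 (h s hs hB)
  constructor
  · intro h
    exact ⟨h.subset, fun F _ => (h F).trans (key F)⟩
  · rintro ⟨h1, h2⟩ F
    rw [key]
    by_cases hF : F ∈ l
    · exact h2 F hF
    · refine ⟨fun h => (hF (List.mem_toFinset.1 (h1 h))).elim, fun h => (hF ?_).elim⟩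
      obtain ⟨B, hB⟩ := exists_isBRepair T l.toFinset
      exact List.mem_toFinset.1 (hB.1.1 ((key F).2 h B hB))

theorem goodRepair_isCRepair : GoodRepair IsCRepair where
  subset h := h.subset
  rename {T A A'} π h := by
    intro F
    obtain ⟨F, rfl⟩ : ∃ F', F = Assertion.map π F' := ⟨_, (Assertion.map_map_symm π F).symm⟩
    rw [(Assertion.map_perm_injective π).mem_finset_image, h F]
    constructor
    · intro h B hB
      have := h _ (by simpa [image_map_symm_image] using hB.rename π.symm)
      have := Finset.mem_image_of_mem (Assertion.map π) this
      rwa [image_map_image_symm] at this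
    · intro h B hB
      exact (Assertion.map_perm_injective π).mem_finset_image.1 (h _ (hB.rename π))
  recursive := by
    have : Rec fun x : TBox × List (Assertion ℕ) × List (Assertion ℕ) =>
      (∀ F ∈ x.2.2, F ∈ x.2.1) ∧ ∀ F ∈ x.2.1, (F ∈ x.2.2 ↔
        ∀ s ∈ sublists x.2.1, IsBRepair x.1 x.2.1.toFinset s.toFinset → F ∈ s) := by
      refine .and (.ball ?_ (.mem ?_ ?_)) (.ball ?_ (.iff (.mem ?_ ?_) (.ball ?_ (.imp
        (goodRepair_isBRepair.recursive.comp (f := fun x : ((TBox × List (Assertion ℕ) ×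
          List (Assertion ℕ)) × Assertion ℕ) × List (Assertion ℕ) => (x.1.1.1, x.1.1.2.1, x.2)) ?_)
          (.mem ?_ ?_))))) <;> fun_prop
    refine this.of_iff fun x => ?_
    rw [isCRepair_iff]
    simp [Finset.subset_iff]

end Repairs

/-! ### Invariance of steps under permutations of the values. -/

section Renaming

variable {π : Equiv.Perm ℕ} {T : TBox} {A : ABox}

theorem Interp.eval_rename {Δ : Type} (I : Interp Δ) {a : Assertion QTerm}
    (ha : ∀ c, QTerm.const c ∈ a.terms → π c = c) (μ : ℕ → Δ) :
    a.map (QTerm.eval (I.rename π) μ) = a.map (QTerm.eval I μ) := by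
  refine Assertion.map_congr ?_
  rintro (c | x) ht
  · exact congrArg I.const (ha c ht)
  · rfl

theorem Certain.rename {q : UCQ} (hq : ∀ d ∈ q, ∀ a ∈ d.atoms, ∀ c, QTerm.const c ∈ a.terms → π c = c)
    {ρ : ℕ → ℕ} (h : Certain T A q ρ) : Certain T (A.image (Assertion.map π)) q (π ∘ ρ) := by
  intro Δ I hI
  obtain ⟨d, hd, μ, h1, h2⟩ := h Δ (I.rename π) hI.rename
  refine ⟨d, hd, μ, h1, fun a ha => ?_⟩
  have := h2 a ha
  rwa [Interp.holdsAtom_rename, Interp.eval_rename I (hq d hd a ha)] at this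

theorem symm_apply_of_fixed {c : ℕ} (h : π c = c) : π.symm c = c := by
  rw [Equiv.symm_apply_eq, h]

theorem certain_rename_iff {q : UCQ}
    (hq : ∀ d ∈ q, ∀ a ∈ d.atoms, ∀ c, QTerm.const c ∈ a.terms → π c = c) {ρ : ℕ → ℕ} :
    Certain T (A.image (Assertion.map π)) q (π ∘ ρ) ↔ Certain T A q ρ := by
  refine ⟨fun h => ?_, fun h => h.rename hq⟩
  have := h.rename (π := π.symm) fun d hd a ha c hc => symm_apply_of_fixed (hq d hd a ha c hc)
  rw [image_map_symm_image, ← Function.comp_assoc] at this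
  simpa using this

theorem mem_adom_image {c : ℕ} : π c ∈ adom (A.image (Assertion.map π)) ↔ c ∈ adom A := by
  constructor
  · rintro ⟨F, hF, hc⟩
    obtain ⟨G, hG, rfl⟩ := Finset.mem_image.1 hF
    rw [Assertion.terms_map, List.mem_map_of_injective π.injective] at hc
    exact ⟨G, hG, hc⟩
  · rintro ⟨F, hF, hc⟩
    refine ⟨_, Finset.mem_image_of_mem _ hF, ?_⟩
    rw [Assertion.terms_map, List.mem_map_of_injective π.injective]
    exact hc

theorem ECQ.holds_rename {Q : ECQ} (hQ : ∀ a ∈ Q.atoms, ∀ c, QTerm.const c ∈ a.terms → π c = c)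
    {ρ : ℕ → ℕ} :
    Q.Holds T (A.image (Assertion.map π)) (π ∘ ρ) ↔ Q.Holds T A ρ := by
  induction Q generalizing ρ with
  | ucq q => exact certain_rename_iff fun d hd a ha => hQ a (List.mem_flatMap.2 ⟨d, hd, ha⟩)
  | neg Q ih => exact not_congr (ih hQ)
  | and Q Q' ih ih' =>
    exact and_congr (ih fun a ha => hQ a (List.mem_append_left _ ha))
      (ih' fun a ha => hQ a (List.mem_append_right _ ha))
  | ex x Q ih =>
    have key : ∀ d, Function.update (π ∘ ρ) x (π d) = π ∘ Function.update ρ x d := fun d =>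
      (Function.comp_update π ρ x d).symm
    constructor
    · rintro ⟨d, hd, h⟩
      obtain ⟨d, rfl⟩ := π.surjective d
      rw [key, ih hQ] at h
      exact ⟨d, mem_adom_image.1 hd, h⟩
    · rintro ⟨d, hd, h⟩
      refine ⟨π d, mem_adom_image.2 hd, ?_⟩
      rw [key, ih hQ]
      exact h

def SCall.map (f : ℕ → ℕ) (t : SCall) : SCall := ⟨t.fn, t.args.map f⟩

def GTerm.map (f : ℕ → ℕ) : GTerm → GTerm
  | .val c => .val (f c)
  | .call t => .call (t.map f)

@[simp]
theorem SCall.map_symm_map (t : SCall) : (t.map π).map π.symm = t := by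
  simp [SCall.map, Function.comp_def]

@[simp]
theorem SCall.map_map_symm (t : SCall) : (t.map π.symm).map π = t := by
  simp [SCall.map, Function.comp_def]

theorem GTerm.map_symm_map (t : GTerm) : (t.map π).map π.symm = t := by
  cases t <;> simp [GTerm.map]

/-- Renaming of values in service call maps. -/
def CallMap.rename (π : Equiv.Perm ℕ) (m : CallMap) : CallMap := fun t =>
  (m (t.map π.symm)).map π

/-- Renaming of values in states. -/
def KState.rename (π : Equiv.Perm ℕ) (s : KState) : KState :=
  ⟨s.abox.image (Assertion.map π), CallMap.rename π s.calls⟩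

theorem CallMap.rename_eq_some_iff {m : CallMap} {t : SCall} {c : ℕ} :
    CallMap.rename π m t = some c ↔ m (t.map π.symm) = some (π.symm c) := by
  simp only [CallMap.rename, Option.map_eq_some_iff]
  constructor
  · rintro ⟨a, h, rfl⟩
    simpa using h
  · exact fun h => ⟨_, h, by simp⟩

theorem CallMap.rename_rename (π π' : Equiv.Perm ℕ) (m : CallMap) :
    CallMap.rename π' (CallMap.rename π m) = CallMap.rename (π' * π) m := by
  funext t
  have : (t.map π'.symm).map π.symm = t.map (π' * π).symm := by
    simp only [SCall.map, List.map_map]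
    rfl
  simp only [CallMap.rename, Option.map_map]
  rw [this]
  rfl

theorem KState.rename_rename (π π' : Equiv.Perm ℕ) (s : KState) :
    (s.rename π).rename π' = s.rename (π' * π) := by
  simp only [KState.rename, CallMap.rename_rename, Finset.image_image]
  congr 2
  funext F
  exact Assertion.map_map _ _ _

theorem KState.rename_one (s : KState) : s.rename 1 = s := by
  obtain ⟨A, m⟩ := s
  simp only [KState.rename]
  congr 1
  · exact (Finset.image_congr (g := id) fun F _ => F.map_id').trans Finset.image_id
  · funext t
    simp only [CallMap.rename]
    have : t.map ⇑(Equiv.symm (1 : Equiv.Perm ℕ)) = t := by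
      simp only [SCall.map]
      congr 1
      exact List.map_id _
    rw [this]
    cases m t <;> rfl

theorem KState.rename_symm_rename (s : KState) : (s.rename π).rename π.symm = s := by
  rw [KState.rename_rename]
  convert s.rename_one
  exact inv_mul_cancel π

/-- All constants in the syntax of `K` are below `n`. -/
structure KAB.ConstsLT (K : KAB) (n : ℕ) : Prop where
  abox : ∀ F ∈ K.abox₀, ∀ c ∈ F.terms, c < n
  pos : ∀ α ∈ K.actions, ∀ e ∈ α.effects, ∀ d ∈ e.pos, ∀ a ∈ d.atoms, ∀ c,
    QTerm.const c ∈ a.terms → c < n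
  neg : ∀ α ∈ K.actions, ∀ e ∈ α.effects, ∀ a ∈ e.neg.atoms, ∀ c, QTerm.const c ∈ a.terms → c < n
  head : ∀ α ∈ K.actions, ∀ e ∈ α.effects, ∀ F ∈ e.head, ∀ c, ETerm.const c ∈ F.terms → c < n
  cond : ∀ r ∈ K.process, ∀ a ∈ r.cond.atoms, ∀ c, QTerm.const c ∈ a.terms → c < n

variable {K : KAB} {n : ℕ}

theorem KAB.Legal.rename (hK : K.ConstsLT n) (hπ : ∀ c < n, π c = c) {α : Action} {σ : ℕ → ℕ}
    (h : K.Legal A α σ) : K.Legal (A.image (Assertion.map π)) α (π ∘ σ) := by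
  obtain ⟨r, hr, hα, h1, h2, h3⟩ := h
  exact ⟨r, hr, hα, by simp, fun x hx hx' => mem_adom_image.2 (h2 x hx hx'),
    (ECQ.holds_rename fun a ha c hc => hπ c (hK.cond r hr a ha c hc)).2 h3⟩

theorem ECQ.mem_ans_rename {Q : ECQ} (hQ : ∀ a ∈ Q.atoms, ∀ c, QTerm.const c ∈ a.terms → π c = c)
    {ps : List ℕ} {σ ρ : ℕ → ℕ} (h : ρ ∈ Q.Ans T A ps σ) :
    π ∘ ρ ∈ Q.Ans T (A.image (Assertion.map π)) ps (π ∘ σ) :=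
  ⟨fun p hp => congrArg π (h.1 p hp), fun x hx hx' => mem_adom_image.2 (h.2.1 x hx hx'),
    (ECQ.holds_rename hQ).2 h.2.2⟩

theorem mem_doFacts_rename (hK : K.ConstsLT n) (hπ : ∀ c < n, π c = c) {α : Action}
    (hα : α ∈ K.actions) {σ : ℕ → ℕ} {g : Assertion GTerm} (h : g ∈ doFacts T A α σ) :
    g.map (GTerm.map π) ∈ doFacts T (A.image (Assertion.map π)) α (π ∘ σ) := by
  obtain ⟨e, he, ρ, hρ, F, hF, rfl⟩ := h
  refine ⟨e, he, π ∘ ρ, ECQ.mem_ans_rename ?_ hρ, F, hF, ?_⟩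
  · intro a ha c hc
    rcases List.mem_append.1 ha with ha | ha
    · obtain ⟨d, hd, ha⟩ := List.mem_flatMap.1 ha
      exact hπ c (hK.pos α hα e he d hd a ha c hc)
    · exact hπ c (hK.neg α hα e he a ha c hc)
  · rw [Assertion.map_map]
    refine Assertion.map_congr ?_
    rintro (c | x | ⟨f, xs⟩) ht
    · exact congrArg GTerm.val (hπ c (hK.head α hα e he F hF c ht))
    · rfl
    · simp [GTerm.map, ETerm.inst, SCall.map, Function.comp_def]

theorem mem_doFacts_rename' (hK : K.ConstsLT n) (hπ : ∀ c < n, π c = c) {α : Action}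
    (hα : α ∈ K.actions) {σ : ℕ → ℕ} {g : Assertion GTerm}
    (h : g ∈ doFacts T (A.image (Assertion.map π)) α (π ∘ σ)) :
    ∃ g' ∈ doFacts T A α σ, g = g'.map (GTerm.map π) := by
  have := mem_doFacts_rename hK (fun c hc => symm_apply_of_fixed (hπ c hc)) hα h
  rw [image_map_symm_image, ← Function.comp_assoc] at this
  refine ⟨_, by simpa using this, ?_⟩
  rw [Assertion.map_map]
  exact ((Assertion.map_congr (g := fun x => x) fun t _ => GTerm.map_symm_map (π := π.symm) t).trans
    g.map_id').symm

theorem mem_callsOf_rename (hK : K.ConstsLT n) (hπ : ∀ c < n, π c = c) {α : Action}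
    (hα : α ∈ K.actions) {σ : ℕ → ℕ} {t : SCall} :
    t ∈ callsOf (doFacts T (A.image (Assertion.map π)) α (π ∘ σ)) ↔
      t.map π.symm ∈ callsOf (doFacts T A α σ) := by
  constructor
  · rintro ⟨g, hg, ht⟩
    obtain ⟨g, hg', rfl⟩ := mem_doFacts_rename' hK hπ hα hg
    rw [Assertion.terms_map, List.mem_map] at ht
    obtain ⟨u, hu, hut⟩ := ht
    cases u with
    | val c => simp [GTerm.map] at hut
    | call u =>
      simp only [GTerm.map, GTerm.call.injEq] at hut
      subst hut
      exact ⟨g, hg', by simpa using hu⟩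
  · rintro ⟨g, hg, ht⟩
    refine ⟨_, mem_doFacts_rename hK hπ hα hg, ?_⟩
    rw [Assertion.terms_map]
    exact List.mem_map.2 ⟨_, ht, by simp [GTerm.map]⟩

/-- Undefined calls are excluded because their dummy value `0` may be moved by `π`. -/
theorem GTerm.ground_map {θ : CallMap} {t : GTerm}
    (ht : ∀ u, t = .call u → ∃ c, θ u = some c) :
    (t.map π).ground (CallMap.rename π θ) = π (t.ground θ) := by
  cases t with
  | val c => rfl
  | call u =>
    obtain ⟨c, hc⟩ := ht u rfl
    simp [GTerm.ground, GTerm.map, CallMap.rename, hc]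

/-- Conjugating the choice `θ` of results by `π` gives an execution between the renamed states. Only
the constants of the syntax tie an execution to particular values, and these are fixed. -/
theorem KAB.Exec.rename (hK : K.ConstsLT n) (hπ : ∀ c < n, π c = c) {α : Action}
    (hα : α ∈ K.actions) {σ : ℕ → ℕ} {s s' : KState} (h : K.Exec s α σ s') :
    K.Exec (s.rename π) α (π ∘ σ) (s'.rename π) := by
  obtain ⟨h1, θ, h2, h3, h4, h5⟩ := h
  refine ⟨h1.rename hK hπ, CallMap.rename π θ, fun t => ?_, fun t c d hc hd => ?_, ?_, fun t c => ?_⟩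
  · refine Iff.trans ?_ (mem_callsOf_rename hK hπ hα).symm
    rw [← h2]
    constructor
    · rintro ⟨c, hc⟩
      exact ⟨_, CallMap.rename_eq_some_iff.1 hc⟩
    · rintro ⟨c, hc⟩
      exact ⟨π c, CallMap.rename_eq_some_iff.2 (by simpa using hc)⟩
  · exact π.symm.injective (h3 _ _ _ (CallMap.rename_eq_some_iff.1 hc)
      (CallMap.rename_eq_some_iff.1 hd))
  · have hg : ∀ g ∈ doFacts K.tbox s.abox α σ, (g.map (GTerm.map π)).map
        (GTerm.ground (CallMap.rename π θ)) = (g.map (GTerm.ground θ)).map π := by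
      intro g hg
      rw [Assertion.map_map, Assertion.map_map]
      exact Assertion.map_congr fun t ht => GTerm.ground_map fun u hu =>
        (h2 u).2 ⟨g, hg, hu ▸ ht⟩
    ext F
    simp only [KState.rename, Finset.coe_image, h4, Set.mem_image, exists_exists_and_eq_and]
    constructor
    · rintro ⟨g, hg', rfl⟩
      exact ⟨_, mem_doFacts_rename hK hπ hα hg', hg g hg'⟩
    · rintro ⟨g, hg', rfl⟩
      obtain ⟨g, hg'', rfl⟩ := mem_doFacts_rename' hK hπ hα hg'
      exact ⟨g, hg'', (hg g hg'').symm⟩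
  · simp only [KState.rename, CallMap.rename_eq_some_iff]
    exact h5 _ _

/-- Genericity of the transition system, on which the abstraction rests: values other than the
constants of the KAB and of the marker are interchangeable. -/
theorem KAB.Step.rename {rep : TBox → ABox → ABox → Prop} (hrep : GoodRepair rep)
    {mk : Assertion ℕ} (hK : K.ConstsLT n) (hπ : ∀ c < n, π c = c) (hmk : ∀ c ∈ mk.terms, c < n)
    {s s' : KState} (h : K.Step rep mk s s') : K.Step rep mk (s.rename π) (s'.rename π) := by
  have hmk' : mk.map π = mk :=
    (Assertion.map_congr (g := fun x => x) fun c hc => hπ c (hmk c hc)).trans mk.map_id'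
  have hmem : ∀ A : ABox, mk ∈ A.image (Assertion.map π) ↔ mk ∈ A := fun A => by
    conv_lhs => rw [← hmk']
    exact (Assertion.map_perm_injective π).mem_finset_image
  cases h with
  | action s' α σ h1 h2 h3 =>
    have := KAB.Step.action (rep := rep) (mk := mk) _ _ α _ (by rwa [KState.rename, hmem]) h2
      (h3.rename hK hπ h2)
    convert this using 1
    simp only [KState.rename, Finset.image_insert, hmk']
  | repair A' h1 h2 =>
    refine KAB.Step.repair (s.rename π) _ ((hmem _).2 h1) ?_
    have := hrep.rename π h2
    rw [Finset.image_erase (Assertion.map_perm_injective π), hmk'] at this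
    exact this

end Renaming

/-! ### A bound on the constants of the syntax. -/

section Constants

open Numbered

theorem le_encode_of_mem {n : ℕ} {l : List ℕ} (h : n ∈ l) : n ≤ Encodable.encode l := by
  induction l with
  | nil => simp at h
  | cons m l ih =>
    rw [Encodable.encode_list_cons, Nat.succ_eq_add_one]
    rcases List.mem_cons.1 h with rfl | h
    · exact (Nat.left_le_pair _ _).trans (Nat.le_succ _)
    · exact (ih h).trans ((Nat.right_le_pair _ _).trans (Nat.le_succ _))

theorem le_listCode {α : Type} {f : α → ℕ} {a : α} {l : List α} (h : a ∈ l) : f a ≤ listCode f l :=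
  le_encode_of_mem (List.mem_map_of_mem h)

theorem Assertion.le_code {α : Type} {f : α → ℕ} {t : α} {F : Assertion α} (h : t ∈ F.terms) :
    f t ≤ F.code f := by
  cases F with
  | conc N u =>
    obtain rfl : t = u := by simpa [Assertion.terms] using h
    exact (Nat.right_le_pair _ _).trans (Nat.right_le_pair _ _)
  | role P u v =>
    simp only [Assertion.terms, List.mem_cons, List.not_mem_nil, or_false] at h
    rcases h with rfl | rfl
    · exact (Nat.left_le_pair _ _).trans ((Nat.right_le_pair _ _).trans (Nat.right_le_pair _ _))
    · exact (Nat.right_le_pair _ _).trans ((Nat.right_le_pair _ _).trans (Nat.right_le_pair _ _))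

theorem CQ.le_code {d : CQ} {a : Assertion QTerm} (ha : a ∈ d.atoms) {c : ℕ}
    (hc : QTerm.const c ∈ a.terms) : c ≤ d.code :=
  calc c ≤ (QTerm.const c).code := Nat.right_le_pair _ _
    _ ≤ a.code QTerm.code := Assertion.le_code hc
    _ ≤ listCode (Assertion.code QTerm.code) d.atoms := le_listCode ha
    _ ≤ d.code := Nat.right_le_pair _ _

theorem ECQ.le_code {Q : ECQ} {a : Assertion QTerm} (ha : a ∈ Q.atoms) {c : ℕ}
    (hc : QTerm.const c ∈ a.terms) : c ≤ Q.code := by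
  induction Q with
  | ucq q =>
    obtain ⟨d, hd, ha⟩ := List.mem_flatMap.1 ha
    exact (d.le_code ha hc).trans ((le_listCode hd).trans (Nat.right_le_pair _ _))
  | neg Q ih => exact (ih ha).trans (Nat.right_le_pair _ _)
  | and Q Q' ih ih' =>
    rcases List.mem_append.1 ha with ha | ha
    · exact (ih ha).trans ((Nat.left_le_pair _ _).trans (Nat.right_le_pair _ _))
    · exact (ih' ha).trans ((Nat.right_le_pair _ _).trans (Nat.right_le_pair _ _))
  | ex x Q ih => exact (ih ha).trans ((Nat.right_le_pair _ _).trans (Nat.right_le_pair _ _))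

theorem Action.code_le {K : KAB} {α : Action} (h : α ∈ K.actions) : α.code ≤ K.code :=
  (le_listCode h).trans ((Nat.left_le_pair _ _).trans ((Nat.right_le_pair _ _).trans
    (Nat.right_le_pair _ _)))

theorem Effect.code_le {α : Action} {e : Effect} (h : e ∈ α.effects) : e.code ≤ α.code :=
  (le_listCode h).trans ((Nat.right_le_pair _ _).trans (Nat.right_le_pair _ _))

/-- Pairing never decreases, so a constant is at most the code of any expression around it. The code
itself is thus a computable bound, and no traversal of the syntax is needed. -/
theorem KAB.constsLT {K : KAB} {n : ℕ} (h : K.code < n) : K.ConstsLT n where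
  abox F hF c hc := lt_of_le_of_lt ((Assertion.le_code (f := id) hc).trans ((le_listCode hF).trans
    ((Nat.left_le_pair _ _).trans (Nat.right_le_pair _ _)))) h
  pos α hα e he d hd a ha c hc := lt_of_le_of_lt ((d.le_code ha hc).trans ((le_listCode hd).trans
    ((Nat.left_le_pair _ _).trans ((Effect.code_le he).trans (Action.code_le hα))))) h
  neg α hα e he a ha c hc := lt_of_le_of_lt ((ECQ.le_code ha hc).trans ((Nat.left_le_pair _ _).trans
    ((Nat.right_le_pair _ _).trans ((Effect.code_le he).trans (Action.code_le hα))))) h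
  head α hα e he F hF c hc := by
    refine lt_of_le_of_lt ?_ h
    calc c ≤ (ETerm.const c).code := Nat.right_le_pair _ _
      _ ≤ F.code ETerm.code := Assertion.le_code hc
      _ ≤ listCode (Assertion.code ETerm.code) e.head := le_listCode hF
      _ ≤ e.code := (Nat.right_le_pair _ _).trans (Nat.right_le_pair _ _)
      _ ≤ K.code := (Effect.code_le he).trans (Action.code_le hα)
  cond r hr a ha c hc := by
    have : r.cond.code ≤ r.code := Nat.left_le_pair _ _
    exact lt_of_le_of_lt ((ECQ.le_code ha hc).trans (this.trans ((le_listCode (f := Rule.code) hr).trans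
      ((Nat.right_le_pair _ _).trans ((Nat.right_le_pair _ _).trans (Nat.right_le_pair _ _)))))) h

end Constants

/-! ### Executing actions on lists. -/

section ListExecution

variable {γ : Type} [Numbered γ]

/-- The variables of a union of conjunctive queries. -/
def qvars (q : List CQ) : List ℕ :=
  q.flatMap fun d => d.atoms.flatMap fun a => a.terms.flatMap fun t =>
    (QTerm.equiv t).elim (fun _ => []) fun x => [x]

theorem mem_qvars {q : List CQ} {x : ℕ} :
    x ∈ qvars q ↔ ∃ d ∈ q, ∃ a ∈ d.atoms, QTerm.var x ∈ a.terms := by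
  simp only [qvars, List.mem_flatMap]
  refine exists_congr fun d => and_congr_right fun _ => exists_congr fun a => and_congr_right
    fun _ => ?_
  constructor
  · rintro ⟨c | y, ht, h⟩
    · simp [QTerm.equiv] at h
    · simp only [QTerm.equiv, Equiv.coe_fn_mk, Sum.elim_inr, List.mem_singleton] at h
      exact h ▸ ht
  · exact fun h => ⟨_, h, by simp [QTerm.equiv]⟩

@[fun_prop]
theorem Eff.qvars {f : γ → List CQ} (hf : Eff f) : Eff fun x => qvars (f x) :=
  .flatMap hf (.flatMap (by fun_prop) (.flatMap (by fun_prop)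
    (.sum_elim (by fun_prop) (by fun_prop) (by fun_prop))))

theorem Rec.mem_ucq_fv {x : γ → ℕ} {q : γ → List CQ} (hx : Eff x) (hq : Eff q) :
    Rec fun y => x y ∈ UCQ.fv (q y) :=
  Rec.bex hq (.and (.not (.mem (by fun_prop) (by fun_prop)))
    (.bex (by fun_prop) (.mem (by fun_prop) (by fun_prop))))

/-- `l` is an answer to the query of the effect `e`, with the values in `l` for the
parameters `ps`. -/
def IsAnswer (T : TBox) (A : List (Assertion ℕ)) (ps : List ℕ) (e : Effect) (l : List (ℕ × ℕ)) :
    Prop :=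
  (∀ x ∈ qvars e.pos, x ∈ UCQ.fv e.pos → x ∉ ps → envFun l x ∈ adom A.toFinset) ∧
    (ECQ.and (.ucq e.pos) e.neg).Holds T A.toFinset (envFun l)

theorem Rec.isAnswer {T : γ → TBox} {A : γ → List (Assertion ℕ)} {ps : γ → List ℕ} {e : γ → Effect}
    {l : γ → List (ℕ × ℕ)} (hT : Eff T) (hA : Eff A) (hps : Eff ps) (he : Eff e) (hl : Eff l) :
    Rec fun x => IsAnswer (T x) (A x) (ps x) (e x) (l x) :=
  .and (.ball (by fun_prop) (.imp (.mem_ucq_fv (by fun_prop) (by fun_prop)) (.imp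
    (.not (.mem (by fun_prop) (by fun_prop))) (.mem_adom (by fun_prop) (by fun_prop)))))
    (.holds (by fun_prop) (by fun_prop) (by fun_prop) (by fun_prop))

/-- The candidates for answers to the query of an effect. -/
def candidates (A : List (Assertion ℕ)) (σ : List (ℕ × ℕ)) (e : Effect) : List (List (ℕ × ℕ)) :=
  (assigns (qvars e.pos) (0 :: adomList A)).map fun ρ => σ ++ ρ

@[fun_prop]
theorem Eff.candidates {A : γ → List (Assertion ℕ)} {σ : γ → List (ℕ × ℕ)} {e : γ → Effect}
    (hA : Eff A) (hσ : Eff σ) (he : Eff e) : Eff fun x => candidates (A x) (σ x) (e x) :=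
  .map (by fun_prop) (by fun_prop)

@[fun_prop]
theorem Eff.inst {l : γ → List (ℕ × ℕ)} {t : γ → ETerm} (hl : Eff l) (ht : Eff t) :
    Eff fun x => ETerm.inst (KABs.envFun (l x)) (t x) := by
  have := Eff.sum_elim (f := fun x => (t x).view) (g := fun _ c => GTerm.val c)
    (h := fun x y => y.elim (fun z => GTerm.val (KABs.envFun (l x) z))
      fun z => GTerm.call ⟨z.1, z.2.map fun z => KABs.envFun (l x) z⟩) (by fun_prop) (by fun_prop)
      (.sum_elim (by fun_prop) (by fun_prop) (.gTerm_call (.sCall_mk (by fun_prop)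
        (.map (by fun_prop) (by fun_prop)))))
  exact this.congr fun x => by cases t x <;> rfl

@[fun_prop]
theorem Eff.ground {m : γ → List (SCall × ℕ)} {t : γ → GTerm} (hm : Eff m) (ht : Eff t) :
    Eff fun x => GTerm.ground (KABs.look (m x)) (t x) := by
  have := Eff.sum_elim (f := fun x => GTerm.equiv (t x)) (g := fun _ c => c)
    (h := fun x t => (KABs.look (m x) t).getD 0) (by fun_prop) (by fun_prop) (by fun_prop)
  exact this.congr fun x => by cases t x <;> rfl

/-- `D` lists the facts that the action `α` with the parameter values `σ` produces. -/
def IsDo (T : TBox) (A : List (Assertion ℕ)) (α : Action) (σ : List (ℕ × ℕ))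
    (D : List (Assertion GTerm)) : Prop :=
  (∀ g ∈ D, ∃ e ∈ α.effects, ∃ l ∈ candidates A σ e, IsAnswer T A α.params e l ∧
    ∃ F ∈ e.head, g = F.map (ETerm.inst (envFun l))) ∧
  ∀ e ∈ α.effects, ∀ l ∈ candidates A σ e, IsAnswer T A α.params e l →
    ∀ F ∈ e.head, F.map (ETerm.inst (envFun l)) ∈ D

theorem Rec.isDo {T : γ → TBox} {A : γ → List (Assertion ℕ)} {α : γ → Action}
    {σ : γ → List (ℕ × ℕ)} {D : γ → List (Assertion GTerm)}
    (hT : Eff T) (hA : Eff A) (hα : Eff α) (hσ : Eff σ) (hD : Eff D) :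
    Rec fun x => IsDo (T x) (A x) (α x) (σ x) (D x) :=
  .and (.ball (by fun_prop) (.bex (by fun_prop) (.bex (by fun_prop) (.and
    (.isAnswer (by fun_prop) (by fun_prop) (by fun_prop) (by fun_prop) (by fun_prop))
    (.bex (by fun_prop) (.eq (by fun_prop) (.assertion_map (by fun_prop) (by fun_prop))))))))
    (.ball (by fun_prop) (.ball (by fun_prop) (.imp
    (.isAnswer (by fun_prop) (by fun_prop) (by fun_prop) (by fun_prop) (by fun_prop))
    (.ball (by fun_prop) (.mem (.assertion_map (by fun_prop) (by fun_prop)) (by fun_prop))))))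

/-- `σ` is legal for `α`, for well-formed `K`. -/
def KAB.IsLegal (K : KAB) (A : List (Assertion ℕ)) (α : Action) (σ : List (ℕ × ℕ)) : Prop :=
  ∃ r ∈ K.process, r.action = α ∧ (∀ p ∈ α.params, envFun σ p ∈ adom A.toFinset) ∧
    r.cond.Holds K.tbox A.toFinset (envFun σ)

theorem Rec.isLegal {K : γ → KAB} {A : γ → List (Assertion ℕ)} {α : γ → Action}
    {σ : γ → List (ℕ × ℕ)} (hK : Eff K) (hA : Eff A) (hα : Eff α) (hσ : Eff σ) :
    Rec fun x => (K x).IsLegal (A x) (α x) (σ x) :=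
  .bex (by fun_prop) (.and (.eq (by fun_prop) (by fun_prop)) (.and
    (.ball (by fun_prop) (.mem_adom (by fun_prop) (by fun_prop)))
    (.holds (by fun_prop) (by fun_prop) (by fun_prop) (by fun_prop))))

variable {K : KAB} {A : List (Assertion ℕ)} {α : Action} {σ : List (ℕ × ℕ)}

theorem KAB.legal_iff (hK : K.WellFormed) {ρ : ℕ → ℕ} : K.Legal A.toFinset α ρ ↔
    ∃ r ∈ K.process, r.action = α ∧ (∀ p ∈ α.params, ρ p ∈ adom A.toFinset) ∧
    r.cond.Holds K.tbox A.toFinset ρ := by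
  refine exists_congr fun r => and_congr_right fun hr => and_congr_right ?_
  rintro rfl
  have hfv := hK.rule_fv r hr
  constructor
  · rintro ⟨-, h1, h2⟩
    exact ⟨fun p hp => h1 p (by rw [hfv]; exact hp) List.not_mem_nil, h2⟩
  · rintro ⟨h1, h2⟩
    exact ⟨by simp, fun p hp _ => h1 p (by rw [hfv] at hp; exact hp), h2⟩

theorem KAB.Legal.congr (hK : K.WellFormed) {ρ ρ' : ℕ → ℕ} (h : ∀ p ∈ α.params, ρ p = ρ' p)
    (hl : K.Legal A.toFinset α ρ) : K.Legal A.toFinset α ρ' := by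
  rw [legal_iff hK] at hl ⊢
  obtain ⟨r, hr, rfl, h1, h2⟩ := hl
  refine ⟨r, hr, rfl, fun p hp => h p hp ▸ h1 p hp, (ECQ.holds_congr fun x hx => h x ?_).1 h2⟩
  rw [hK.rule_fv r hr] at hx
  exact hx

theorem doFacts_congr {T : TBox} {A : ABox} {ρ ρ' : ℕ → ℕ} (h : ∀ p ∈ α.params, ρ p = ρ' p) :
    doFacts T A α ρ = doFacts T A α ρ' := by
  have : ∀ Q, ECQ.Ans T A α.params ρ Q = ECQ.Ans T A α.params ρ' Q := fun Q => by
    ext τ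
    exact and_congr_left' (forall₂_congr fun p hp => by rw [h p hp])
  simp only [doFacts, this]

/-- Parameter values are given by total functions of which only the values on `α.params` matter;
this allows them to be replaced by finite lists. -/
theorem KAB.Exec.congr (hK : K.WellFormed) {s s' : KState} {ρ ρ' : ℕ → ℕ}
    (h : ∀ p ∈ α.params, ρ p = ρ' p) (he : K.Exec s α ρ s') : K.Exec s α ρ' s' := by
  obtain ⟨h1, h2⟩ := he
  rw [doFacts_congr h] at h2
  obtain ⟨A, hA⟩ : ∃ A : List (Assertion ℕ), A.toFinset = s.abox := ⟨_, Finset.toList_toFinset _⟩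
  rw [← hA] at h1
  exact ⟨hA ▸ h1.congr hK h, h2⟩

theorem IsAnswer.mem_ans {T : TBox} {e : Effect} {l : List (ℕ × ℕ)} {ps : List ℕ} {ρ : ℕ → ℕ}
    (he : e.neg.fv ⊆ UCQ.fv e.pos) (hl : IsAnswer T A ps e l) (h : ∀ p ∈ ps, envFun l p = ρ p) :
    envFun l ∈ ECQ.Ans T A.toFinset ps ρ (.and (.ucq e.pos) e.neg) := by
  refine ⟨h, fun x hx hx' => ?_, hl.2⟩
  have hx : x ∈ UCQ.fv e.pos := hx.elim (fun h => h) fun h => he h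
  refine hl.1 x ?_ hx hx'
  obtain ⟨d, hd, -, a, ha, h⟩ := hx
  exact mem_qvars.2 ⟨d, hd, a, ha, h⟩

/-- An answer matters only on the free variables of `e.pos`, so a finite list represents it. In the
concatenation `σ` comes first and overrides the other entries on the parameters. -/
theorem exists_candidate {T : TBox} {e : Effect} {ps : List ℕ} {ρ : ℕ → ℕ}
    (he : e.neg.fv ⊆ UCQ.fv e.pos) (hσ : σ.map Prod.fst = ps)
    (hρ : ρ ∈ ECQ.Ans T A.toFinset ps (envFun σ) (.and (.ucq e.pos) e.neg)) :
    ∃ l ∈ candidates A σ e, IsAnswer T A ps e l ∧ ∀ x ∈ UCQ.fv e.pos, envFun l x = ρ x := by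
  classical
  obtain ⟨h1, h2, h3⟩ := hρ
  -- The list `qvars e.pos` may also contain bound variables and parameters. They get the default
  -- `0`, which is why `candidates` admits `0` besides the active domain.
  let f : ℕ → ℕ := fun x => if x ∈ UCQ.fv e.pos ∧ x ∉ ps then ρ x else 0
  have key : ∀ x ∈ UCQ.fv e.pos, envFun (σ ++ (qvars e.pos).map fun x => (x, f x)) x = ρ x := by
    intro x hx
    have hxq : x ∈ qvars e.pos := by
      obtain ⟨d, hd, -, a, ha, h⟩ := hx
      exact mem_qvars.2 ⟨d, hd, a, ha, h⟩
    rw [envFun, look_append, look_map, if_pos hxq]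
    by_cases hxp : x ∈ ps
    · rw [h1 x hxp, envFun]
      cases hv : look σ x with
      | none => exact (look_eq_none_iff.1 hv (hσ ▸ hxp)).elim
      | some v => rfl
    · rw [look_eq_none_iff.2 (hσ ▸ hxp)]
      simp [f, hx, hxp]
  refine ⟨_, List.mem_map.2 ⟨(qvars e.pos).map fun x => (x, f x), mem_assigns.2 ⟨?_, ?_⟩, rfl⟩,
    ⟨fun x _ hx hx' => ?_, ?_⟩, key⟩
  · simp [Function.comp_def]
  · simp only [List.mem_map, forall_exists_index, and_imp, forall_apply_eq_imp_iff₂, List.mem_cons]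
    intro x _
    by_cases hx : x ∈ UCQ.fv e.pos ∧ x ∉ ps
    · exact .inr (mem_adomList.2 (by simpa [f, hx] using h2 x (.inl hx.1) hx.2))
    · exact .inl (if_neg hx)
  · rw [key x hx]
    exact h2 x (.inl hx) hx'
  · refine (ECQ.holds_congr fun x hx => ?_).1 h3
    exact (key x (hx.elim (fun h => h) fun h => he h)).symm

theorem envFun_append_of_mem {l : List (ℕ × ℕ)} {p : ℕ} (h : p ∈ σ.map Prod.fst) :
    envFun (σ ++ l) p = envFun σ p := by
  rw [envFun, envFun, look_append]
  cases hv : look σ p with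
  | none => exact (look_eq_none_iff.1 hv h).elim
  | some v => rfl

/-- Heads mention only variables that are free in `e.pos`, so the finitely many candidates produce
all facts. -/
theorem isDo_iff (hK : K.WellFormed) (hα : α ∈ K.actions) (hσ : σ.map Prod.fst = α.params)
    {D : List (Assertion GTerm)} : IsDo K.tbox A α σ D ↔
      {g | g ∈ D} = doFacts K.tbox A.toFinset α (envFun σ) := by
  have key : ∀ g, g ∈ doFacts K.tbox A.toFinset α (envFun σ) ↔
      ∃ e ∈ α.effects, ∃ l ∈ candidates A σ e, IsAnswer K.tbox A α.params e l ∧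
      ∃ F ∈ e.head, g = F.map (ETerm.inst (envFun l)) := by
    intro g
    constructor
    · rintro ⟨e, he, ρ, hρ, F, hF, rfl⟩
      obtain ⟨l, hl, hla, heq⟩ := exists_candidate (hK.neg_fv α hα e he) hσ hρ
      refine ⟨e, he, l, hl, hla, F, hF, Assertion.map_congr fun t ht => ?_⟩
      have := hK.head_terms α hα e he F hF t ht
      cases t with
      | const c => rfl
      | var x => exact congrArg GTerm.val (heq x this).symm
      | call f xs =>
        simp only [ETerm.inst, GTerm.call.injEq, SCall.mk.injEq, true_and]
        exact List.map_congr_left fun x hx => (heq x (this x hx)).symm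
    · rintro ⟨e, he, l, hl, hla, F, hF, rfl⟩
      obtain ⟨ρ, hρ, rfl⟩ := List.mem_map.1 hl
      exact ⟨e, he, _, hla.mem_ans (hK.neg_fv α hα e he) fun p hp =>
        envFun_append_of_mem (hσ ▸ hp), F, hF, rfl⟩
  constructor
  · rintro ⟨h1, h2⟩
    ext g
    rw [key]
    constructor
    · exact h1 g
    · rintro ⟨e, he, l, hl, hla, F, hF, rfl⟩
      exact h2 e he l hl hla F hF
  · intro h
    simp only [Set.ext_iff, key] at h
    exact ⟨fun g hg => (h g).1 hg, fun e he l hl hla F hF =>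
      (h _).2 ⟨e, he, l, hl, hla, F, hF, rfl⟩⟩

theorem exists_isDo (T : TBox) (A : List (Assertion ℕ)) (α : Action) (σ : List (ℕ × ℕ)) :
    ∃ D, IsDo T A α σ D := by
  classical
  refine ⟨α.effects.flatMap fun e => (candidates A σ e).flatMap fun l =>
    if IsAnswer T A α.params e l then e.head.map fun F => F.map (ETerm.inst (envFun l)) else [],
    fun g hg => ?_, fun e he l hl hla F hF => ?_⟩
  · obtain ⟨e, he, hg⟩ := List.mem_flatMap.1 hg
    obtain ⟨l, hl, hg⟩ := List.mem_flatMap.1 hg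
    split at hg
    · rename_i h
      obtain ⟨F, hF, rfl⟩ := List.mem_map.1 hg
      exact ⟨e, he, l, hl, h, F, hF, rfl⟩
    · simp at hg
  · refine List.mem_flatMap.2 ⟨e, he, List.mem_flatMap.2 ⟨l, hl, ?_⟩⟩
    rw [if_pos hla]
    exact List.mem_map_of_mem hF

/-- The service calls in a list of facts. -/
def callList (D : List (Assertion GTerm)) : List SCall :=
  D.flatMap fun g => g.terms.flatMap fun t => (GTerm.equiv t).elim (fun _ => []) fun c => [c]

theorem mem_callList {D : List (Assertion GTerm)} {t : SCall} :
    t ∈ callList D ↔ ∃ g ∈ D, GTerm.call t ∈ g.terms := by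
  simp only [callList, List.mem_flatMap]
  refine exists_congr fun g => and_congr_right fun _ => ?_
  constructor
  · rintro ⟨c | y, ht, h⟩
    · simp [GTerm.equiv] at h
    · simp only [GTerm.equiv, Equiv.coe_fn_mk, Sum.elim_inr, List.mem_singleton] at h
      exact h ▸ ht
  · exact fun h => ⟨_, h, by simp [GTerm.equiv]⟩

@[fun_prop]
theorem Eff.callList {f : γ → List (Assertion GTerm)} (hf : Eff f) :
    Eff fun x => callList (f x) :=
  .flatMap hf (.flatMap (by fun_prop) (.sum_elim (by fun_prop) (by fun_prop) (by fun_prop)))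

/-- `C` lists the service calls in `D` that have no value in `m`. -/
def IsNew (m : List (SCall × ℕ)) (D : List (Assertion GTerm)) (C : List SCall) : Prop :=
  (∀ t ∈ C, t ∈ callList D ∧ look m t = none) ∧
    ∀ t ∈ callList D, look m t = none → t ∈ C

theorem Rec.isNew {m : γ → List (SCall × ℕ)} {D : γ → List (Assertion GTerm)} {C : γ → List SCall}
    (hm : Eff m) (hD : Eff D) (hC : Eff C) : Rec fun x => IsNew (m x) (D x) (C x) :=
  .and (.ball (by fun_prop) (.and (.mem (by fun_prop) (by fun_prop))
    (.eq (by fun_prop) (by fun_prop)))) (.ball (by fun_prop) (.imp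
    (.eq (by fun_prop) (by fun_prop)) (.mem (by fun_prop) (by fun_prop))))

theorem exists_isNew (m : List (SCall × ℕ)) (D : List (Assertion GTerm)) :
    ∃ C, IsNew m D C ∧ C.Nodup := by
  refine ⟨((callList D).filter fun t => look m t = none).dedup, ⟨fun t ht => ?_, fun t ht h => ?_⟩,
    List.nodup_dedup _⟩
  · simpa using ht
  · simp [ht, h]

/-- The presentation of states by lists. -/
abbrev StateCode := List (Assertion ℕ) × List (SCall × ℕ)

def toState (t : StateCode) : KState := ⟨t.1.toFinset, look t.2⟩

/-- The successor state for the facts `D`, if the new service calls have the values in `θ`. -/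
def nextState (m : List (SCall × ℕ)) (D : List (Assertion GTerm)) (θ : List (SCall × ℕ)) :
    StateCode :=
  (D.map fun g => g.map (GTerm.ground (look (m ++ θ))), m ++ θ)

@[fun_prop]
theorem Eff.nextState {m θ : γ → List (SCall × ℕ)} {D : γ → List (Assertion GTerm)}
    (hm : Eff m) (hD : Eff D) (hθ : Eff θ) : Eff fun x => nextState (m x) (D x) (θ x) :=
  .pair (.map (by fun_prop) (.assertion_map (by fun_prop) (by fun_prop))) (by fun_prop)

/-- On calls that already have a value, `θ` is forced to agree with the call map. The successor is
therefore determined by values for the new calls `C`. -/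
theorem KAB.Exec.exists_values {t : StateCode} {D : List (Assertion GTerm)} {C : List SCall}
    {s' : KState} (h : K.Exec (toState t) α (envFun σ) s')
    (hD : {g | g ∈ D} = doFacts K.tbox t.1.toFinset α (envFun σ)) (hC : IsNew t.2 D C) :
    ∃ f : SCall → ℕ, s' = toState (nextState t.2 D (C.map fun c => (c, f c))) := by
  obtain ⟨-, θ, h1, h2, h3, h4⟩ := h
  have hcalls : ∀ c, (∃ v, θ c = some v) ↔ c ∈ callList D := fun c => by
    rw [h1, mem_callList]
    change c ∈ callsOf (doFacts K.tbox t.1.toFinset α (envFun σ)) ↔ _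
    rw [← hD]
    rfl
  have hnone : ∀ c, c ∉ callList D → θ c = none := fun c hc => by
    rw [← hcalls] at hc
    push Not at hc
    exact Option.eq_none_iff_forall_ne_some.2 hc
  let f : SCall → ℕ := fun c => (θ c).getD 0
  have hlook : ∀ c, look (t.2 ++ C.map fun c => (c, f c)) c = (look t.2 c).or (θ c) := fun c => by
    rw [look_append, look_map]
    cases hl : look t.2 c with
    | some v => rfl
    | none =>
      split_ifs with hc
      · obtain ⟨v, hv⟩ := (hcalls c).2 (hC.1 c hc).1
        simp [f, hv]
      · simp [hnone c fun h => hc (hC.2 c h hl)]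
  refine ⟨f, ?_⟩
  obtain ⟨A', m'⟩ := s'
  simp only [toState, nextState, KState.mk.injEq]
  constructor
  · apply Finset.coe_injective
    rw [h3]
    change _ '' doFacts K.tbox t.1.toFinset α (envFun σ) = _
    rw [← hD]
    ext F
    simp only [Set.mem_image, List.coe_toFinset, List.mem_map, Set.mem_ofPred_eq]
    refine exists_congr fun g => and_congr_right fun hg => ?_
    rw [Assertion.map_congr fun u hu => ?_]
    cases u with
    | val c => rfl
    | call c =>
      obtain ⟨v, hv⟩ := (hcalls c).2 (mem_callList.2 ⟨g, hg, hu⟩)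
      simp only [GTerm.ground, hlook, hv]
      cases hl : look t.2 c with
      | none => rfl
      | some v' => simp [h2 c v' v hl hv]
  · funext c
    apply Option.ext
    intro v
    rw [hlook]
    refine (h4 c v).trans ?_
    change look t.2 c = some v ∨ θ c = some v ↔ _
    cases hl : look t.2 c with
    | none => simp
    | some v' =>
      simp only [Option.some_or, Option.some.injEq]
      exact or_iff_left_of_imp fun h => h2 c v' v hl h

theorem KAB.exec_nextState {t : StateCode} {D : List (Assertion GTerm)} {C : List SCall}
    (hl : K.Legal t.1.toFinset α (envFun σ))
    (hD : {g | g ∈ D} = doFacts K.tbox t.1.toFinset α (envFun σ)) (hC : IsNew t.2 D C)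
    {θ : List (SCall × ℕ)} (hθ : θ.map Prod.fst = C) :
    K.Exec (toState t) α (envFun σ) (toState (nextState t.2 D θ)) := by
  have hcalls : ∀ c, c ∈ callsOf (doFacts K.tbox t.1.toFinset α (envFun σ)) ↔ c ∈ callList D :=
    fun c => by rw [mem_callList, ← hD]; rfl
  have hdef : ∀ c ∈ callList D, ∃ v, look (t.2 ++ θ) c = some v := fun c hc => by
    rw [look_append]
    cases hv : look t.2 c with
    | some v => exact ⟨v, rfl⟩
    | none =>
      cases hv' : look θ c with
      | some v => exact ⟨v, rfl⟩
      | none => exact (look_eq_none_iff.1 hv' (hθ ▸ hC.2 c hc hv)).elim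
  -- `KAB.Exec` demands a map defined on exactly the calls in `D`, while the old call map may
  -- contain others.
  refine ⟨hl, fun c => if c ∈ callList D then look (t.2 ++ θ) c else none, fun c => ?_,
    fun c v v' hv hv' => ?_, ?_, fun c v => ?_⟩
  · refine Iff.trans ?_ (hcalls c).symm
    by_cases hc : c ∈ callList D
    · simpa [hc] using hdef c hc
    · simp [hc]
  · change look t.2 c = some v at hv
    beta_reduce at hv'
    split_ifs at hv'
    rw [look_append, hv] at hv'
    exact Option.some_inj.1 hv'
  · change _ = _ '' doFacts K.tbox t.1.toFinset α (envFun σ)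
    rw [← hD]
    ext F
    simp only [toState, nextState, List.coe_toFinset, List.mem_map, Set.mem_image,
      Set.mem_ofPred_eq]
    refine exists_congr fun g => and_congr_right fun hg => ?_
    rw [Assertion.map_congr fun u hu => ?_]
    cases u with
    | val c => rfl
    | call c => simp [GTerm.ground, mem_callList.2 ⟨g, hg, hu⟩]
  · change look (t.2 ++ θ) c = some v ↔ look t.2 c = some v ∨ _
    rw [look_append]
    cases hl : look t.2 c with
    | some v' =>
      simp only [Option.some_or, Option.some.injEq]
      refine (or_iff_left_of_imp fun h => ?_).symm
      split_ifs at h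
      simpa [look_append, hl] using h
    | none =>
      by_cases hc : c ∈ callList D
      · simp [hc, look_append, hl]
      · simp only [Option.none_or, reduceCtorEq, hc, if_false, or_false, iff_false]
        have : c ∉ θ.map Prod.fst := fun h => hc (hC.1 c (hθ ▸ h)).1
        rw [look_eq_none_iff.2 this]
        simp

theorem exists_assignment (ps : List ℕ) (ρ : ℕ → ℕ) :
    ∃ σ : List (ℕ × ℕ), σ.map Prod.fst = ps ∧ (∀ p ∈ ps, envFun σ p = ρ p) ∧
      ∀ x ∈ σ, ∃ p ∈ ps, x.2 = ρ p :=
  ⟨ps.map fun p => (p, ρ p), by simp [Function.comp_def], fun p hp => by simp [envFun, look_map, hp],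
    by simpa using fun p hp => ⟨p, hp, rfl⟩⟩

end ListExecution

/-! ### Steps on presentations of states, and certificates of abstractions. -/

section ListSteps

variable {γ : Type} [Numbered γ] {rep : TBox → ABox → ABox → Prop}

/-- Presentations are not unique; two call maps are compared on their finitely many keys, outside of
which both are undefined. -/
theorem toState_eq_iff {t t' : StateCode} : toState t = toState t' ↔
    ((∀ F ∈ t.1, F ∈ t'.1) ∧ ∀ F ∈ t'.1, F ∈ t.1) ∧
      ∀ p ∈ t.2 ++ t'.2, look t.2 p.1 = look t'.2 p.1 := by
  simp only [toState, KState.mk.injEq]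
  refine and_congr ?_ ?_
  · rw [Finset.Subset.antisymm_iff]
    simp [Finset.subset_iff]
  · constructor
    · exact fun h p _ => congrFun h p.1
    · intro h
      funext c
      by_cases hc : c ∈ (t.2 ++ t'.2).map Prod.fst
      · obtain ⟨p, hp, rfl⟩ := List.mem_map.1 hc
        exact h p hp
      · rw [List.map_append, List.mem_append, not_or] at hc
        rw [look_eq_none_iff.2 hc.1, look_eq_none_iff.2 hc.2]

theorem Rec.toState_eq {t t' : γ → StateCode} (ht : Eff t) (ht' : Eff t') :
    Rec fun x => toState (t x) = toState (t' x) := by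
  refine Rec.of_iff ?_ fun _ => toState_eq_iff
  refine .and (.and (.ball ?_ (.mem ?_ ?_)) (.ball ?_ (.mem ?_ ?_)))
    (.ball (p := fun x (p : SCall × ℕ) => look (t x).2 p.1 = look (t' x).2 p.1) ?_ (.eq ?_ ?_)) <;>
    fun_prop

/-- Removal of the marker. -/
def unmark (mk : Assertion ℕ) (l : List (Assertion ℕ)) : List (Assertion ℕ) :=
  l.foldr (fun F l => if F = mk then l else F :: l) []

theorem toFinset_unmark (mk : Assertion ℕ) (l : List (Assertion ℕ)) :
    (unmark mk l).toFinset = l.toFinset.erase mk := by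
  induction l with
  | nil => rfl
  | cons F l ih =>
    have : unmark mk (F :: l) = if F = mk then unmark mk l else F :: unmark mk l := rfl
    rw [this]
    split_ifs with h
    · rw [ih, h, List.toFinset_cons, Finset.erase_insert_eq_erase]
    · rw [List.toFinset_cons, List.toFinset_cons, ih, Finset.erase_insert_of_ne h]

@[fun_prop]
theorem Eff.unmark {mk : γ → Assertion ℕ} {l : γ → List (Assertion ℕ)} (hmk : Eff mk) (hl : Eff l) :
    Eff fun x => unmark (mk x) (l x) :=
  .foldr hl (by fun_prop) (.ite_eq (by fun_prop) (by fun_prop) (by fun_prop) (by fun_prop))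

/-- The marked state. -/
def marked (mk : Assertion ℕ) (t : StateCode) : StateCode := (mk :: t.1, t.2)

@[fun_prop]
theorem Eff.marked {mk : γ → Assertion ℕ} {t : γ → StateCode} (hmk : Eff mk) (ht : Eff t) :
    Eff fun x => marked (mk x) (t x) :=
  .pair (by fun_prop) (by fun_prop)

theorem toState_marked (mk : Assertion ℕ) (t : StateCode) :
    toState (marked mk t) = ⟨insert mk (toState t).abox, (toState t).calls⟩ := by
  simp [toState, marked]

/-- The steps on presentations of states, for well-formed `K`. -/
def KAB.ListStep (K : KAB) (rep : TBox → ABox → ABox → Prop) (mk : Assertion ℕ)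
    (t t' : StateCode) : Prop :=
  (mk ∉ t.1 ∧ ∃ α ∈ K.actions, ∃ σ ∈ assigns α.params (adomList t.1), K.IsLegal t.1 α σ ∧
    ∃ D C, IsDo K.tbox t.1 α σ D ∧ IsNew t.2 D C ∧ ∃ θ, θ.map Prod.fst = C ∧
      toState t' = toState (marked mk (nextState t.2 D θ))) ∨
  (mk ∈ t.1 ∧ rep K.tbox (unmark mk t.1).toFinset t'.1.toFinset ∧
    toState t' = toState (t'.1, t.2))

theorem GoodRepair.rec_rep (h : GoodRepair rep) {T : γ → TBox} {A A' : γ → List (Assertion ℕ)}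
    (hT : Eff T) (hA : Eff A) (hA' : Eff A') :
    Rec fun x => rep (T x) (A x).toFinset (A' x).toFinset :=
  h.recursive.comp (f := fun x => (T x, A x, A' x)) (by fun_prop)

/-- Enumerability is enough, since edges of a guessed abstraction only have to be confirmed; `D`,
`C` and `θ` are guessed. -/
theorem RE.listStep (h : GoodRepair rep) {K : γ → KAB} {mk : γ → Assertion ℕ} {t t' : γ → StateCode}
    (hK : Eff K) (hmk : Eff mk) (ht : Eff t) (ht' : Eff t') :
    RE fun x => (K x).ListStep rep (mk x) (t x) (t' x) := by
  refine .or (.and (Rec.not (.mem ?_ ?_)).re (.bex ?_ (.bex ?_ (.and (Rec.isLegal ?_ ?_ ?_ ?_).re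
    (.ex (.ex (.and (Rec.isDo ?_ ?_ ?_ ?_ ?_).re (.and (Rec.isNew ?_ ?_ ?_).re (.ex (.and
    (Rec.eq (.map ?_ ?_) ?_).re (Rec.toState_eq ?_ ?_).re))))))))))
    (.and (Rec.mem ?_ ?_).re (.and (h.rec_rep ?_ ?_ ?_).re (Rec.toState_eq ?_ ?_).re)) <;> fun_prop

variable {K : KAB} {mk : Assertion ℕ}

theorem KAB.isLegal_iff (hK : K.WellFormed) {A : List (Assertion ℕ)} {α : Action}
    {σ : List (ℕ × ℕ)} : K.IsLegal A α σ ↔ K.Legal A.toFinset α (envFun σ) :=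
  (KAB.legal_iff hK).symm

theorem KAB.Legal.mem_adom (hK : K.WellFormed) {A : ABox} {α : Action} {ρ : ℕ → ℕ}
    (h : K.Legal A α ρ) {p : ℕ} (hp : p ∈ α.params) : ρ p ∈ adom A := by
  obtain ⟨r, hr, rfl, -, h1, -⟩ := h
  exact h1 p (by rw [hK.rule_fv r hr]; exact hp) List.not_mem_nil

/-- Executions with parameter values that are given by lists. -/
theorem KAB.Exec.exists_assignment (hK : K.WellFormed) {t : StateCode} {α : Action} {ρ : ℕ → ℕ}
    {s' : KState} (h : K.Exec (toState t) α ρ s') :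
    ∃ σ ∈ assigns α.params (adomList t.1), (∀ p ∈ α.params, envFun σ p = ρ p) ∧
      K.IsLegal t.1 α σ ∧ K.Exec (toState t) α (envFun σ) s' := by
  obtain ⟨σ, h1, h2, h3⟩ := KABs.exists_assignment α.params ρ
  have he := h.congr hK (fun p hp => (h2 p hp).symm)
  refine ⟨σ, mem_assigns.2 ⟨h1, fun x hx => ?_⟩, h2, (isLegal_iff hK).2 he.1, he⟩
  obtain ⟨p, hp, hpx⟩ := h3 x hx
  rw [hpx]
  exact mem_adomList.2 (h.1.mem_adom hK hp)

theorem KAB.listStep_iff (hK : K.WellFormed) {t t' : StateCode} :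
    K.ListStep rep mk t t' ↔ K.Step rep mk (toState t) (toState t') := by
  constructor
  · rintro (⟨h1, α, hα, σ, hσ, hl, D, C, hD, hC, θ, hθ, h⟩ | ⟨h1, h2, h3⟩)
    · rw [h, toState_marked]
      rw [isLegal_iff hK] at hl
      have hσ := (mem_assigns.1 hσ).1
      exact .action _ _ α (envFun σ) (by simpa [toState] using h1) hα
        (exec_nextState hl ((isDo_iff hK hα hσ).1 hD) hC hθ)
    · rw [h3]
      rw [toFinset_unmark] at h2
      exact .repair _ _ (List.mem_toFinset.2 h1) h2
  · intro h
    generalize hs' : toState t' = s' at h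
    cases h with
    | action s' α ρ h1 hα he =>
      obtain ⟨σ, hσ, -, hl, he⟩ := he.exists_assignment hK
      obtain ⟨D, hD⟩ := exists_isDo K.tbox t.1 α σ
      obtain ⟨C, hC, -⟩ := exists_isNew t.2 D
      obtain ⟨f, rfl⟩ := he.exists_values ((isDo_iff hK hα (mem_assigns.1 hσ).1).1 hD) hC
      refine .inl ⟨fun h => h1 (List.mem_toFinset.2 h), α, hα, σ, hσ, hl, D, C, hD, hC,
        C.map fun c => (c, f c), ?_, ?_⟩
      · simp [Function.comp_def]
      · rw [hs', toState_marked]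
    | repair A' h1 h2 =>
      simp only [toState, KState.mk.injEq] at hs'
      refine .inr ⟨List.mem_toFinset.1 h1, ?_, ?_⟩
      · rw [toFinset_unmark, hs'.1]
        exact h2
      · simp [toState, hs'.2]

/-- The values in a state. -/
def valueList (t : StateCode) : List ℕ :=
  adomList t.1 ++ t.2.flatMap fun p => p.1.args ++ [(look t.2 p.1).getD 0]

@[fun_prop]
theorem Eff.valueList {t : γ → StateCode} (ht : Eff t) : Eff fun x => valueList (t x) :=
  .append (by fun_prop) (.flatMap (by fun_prop) (by fun_prop))

/-- The values in a state. -/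
def KState.values (s : KState) : Set ℕ :=
  adom s.abox ∪ {c | ∃ t v, s.calls t = some v ∧ (c ∈ t.args ∨ c = v)}

theorem mem_valueList {t : StateCode} {c : ℕ} : c ∈ valueList t ↔ c ∈ (toState t).values := by
  rw [valueList, List.mem_append, mem_adomList]
  refine or_congr_right ?_
  simp only [List.mem_flatMap, List.mem_append, List.mem_singleton]
  constructor
  · rintro ⟨p, hp, h⟩
    cases hl : look t.2 p.1 with
    | none => exact (look_eq_none_iff.1 hl (List.mem_map_of_mem hp)).elim
    | some v =>
      rw [hl] at h
      exact ⟨p.1, v, hl, h⟩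
  · rintro ⟨u, v, hv, h⟩
    refine ⟨_, mem_of_look hv, ?_⟩
    simp only [toState] at hv
    simpa [hv] using h

/-- `S` and `E` are the states and steps of a finite abstraction with values below `N`, with room
for `k` further values, of the transition system of `K`; values below `n` are treated as
constants. -/
def IsAbstraction (rep : TBox → ABox → ABox → Prop) (K : KAB) (mk : Assertion ℕ) (n k : ℕ)
    (S : List StateCode) (E : List (StateCode × StateCode)) (N : ℕ) (t₀ : StateCode) : Prop :=
  n < N + 1 ∧ (t₀ ∈ S ∧ toState t₀ = toState (K.abox₀, [])) ∧
  (∀ t ∈ S, ∀ c ∈ valueList t, c < N) ∧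
  (∀ p ∈ E, p.1 ∈ S ∧ p.2 ∈ S ∧ K.ListStep rep mk p.1 p.2) ∧
  (∀ t ∈ S, mk ∉ t.1 → ∀ α ∈ K.actions, ∀ σ ∈ assigns α.params (adomList t.1), K.IsLegal t.1 α σ →
    ∃ D C, IsDo K.tbox t.1 α σ D ∧ IsNew t.2 D C ∧ (∃ F : List ℕ,
      (∀ c ∈ List.range n ++ valueList t, c ∈ F) ∧ (∀ c ∈ F, c < N) ∧
      F.length + k + C.length < N + 1) ∧
      ∀ θ ∈ assigns C (List.range N), ∃ p ∈ E, p.1 = t ∧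
        toState p.2 = toState (marked mk (nextState t.2 D θ))) ∧
  ∀ t ∈ S, mk ∈ t.1 → ∀ B ∈ sublists (unmark mk t.1),
    rep K.tbox (unmark mk t.1).toFinset B.toFinset →
    ∃ p ∈ E, p.1 = t ∧ toState p.2 = toState (B, t.2)

/-- All quantifiers are existential or range over lists. The guessed list `F` only serves for
counting: it contains the constants below `n` and the values in use, so its length bounds their
number, and the inequality leaves values below `N` for the new calls and for `k` remembered values.
-/
theorem RE.isAbstraction (h : GoodRepair rep) {K : γ → KAB} {mk : γ → Assertion ℕ} {n k N : γ → ℕ}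
    {S : γ → List StateCode} {E : γ → List (StateCode × StateCode)} {t₀ : γ → StateCode}
    (hK : Eff K) (hmk : Eff mk) (hn : Eff n) (hk : Eff k) (hS : Eff S) (hE : Eff E) (hN : Eff N)
    (ht₀ : Eff t₀) :
    RE fun x => IsAbstraction rep (K x) (mk x) (n x) (k x) (S x) (E x) (N x) (t₀ x) := by
  refine .and ?_ (.and ?_ (.and ?_ (.and ?_ (.and ?_ ?_))))
  · exact (Rec.lt (by fun_prop) (by fun_prop)).re
  · exact .and (Rec.mem (by fun_prop) (by fun_prop)).re
      (Rec.toState_eq (by fun_prop) (by fun_prop)).re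
  · exact .ball (by fun_prop) (.ball (by fun_prop) (Rec.lt (by fun_prop) (by fun_prop)).re)
  · refine .ball hE (.and (Rec.mem ?_ ?_).re (.and (Rec.mem ?_ ?_).re (.listStep h ?_ ?_ ?_ ?_))) <;>
      fun_prop
  · refine .ball hS (.imp (Rec.not (.mem ?_ ?_)) (.ball ?_ (.ball ?_ (.imp
      (Rec.isLegal ?_ ?_ ?_ ?_) (.ex (.ex (.and (Rec.isDo ?_ ?_ ?_ ?_ ?_).re
      (.and (Rec.isNew ?_ ?_ ?_).re (.and ?_ ?_)))))))))
    rotate_right 2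
    · refine .ex (.and (.ball ?_ (Rec.mem ?_ ?_).re) (.and (.ball ?_ (Rec.lt ?_ ?_).re)
        (Rec.lt ?_ ?_).re)) <;> fun_prop
    · refine .ball ?_ (.bex ?_ (.and (Rec.eq ?_ ?_).re (Rec.toState_eq ?_ ?_).re)) <;> fun_prop
    all_goals fun_prop
  · refine .ball hS (.imp (Rec.mem ?_ ?_) (.ball ?_ (.imp (h.rec_rep ?_ ?_ ?_)
      (.bex ?_ (.and (Rec.eq ?_ ?_).re (Rec.toState_eq ?_ ?_).re))))) <;> fun_prop

end ListSteps

/-! ### Values in reachable states. -/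

section Values

variable {rep : TBox → ABox → ABox → Prop} {K : KAB} {mk : Assertion ℕ} {n : ℕ}

theorem doFacts_terms (hK : K.WellFormed) (hn : K.ConstsLT n) {α : Action} (hα : α ∈ K.actions)
    {A : ABox} {ρ : ℕ → ℕ} (hl : K.Legal A α ρ) {g : Assertion GTerm}
    (hg : g ∈ doFacts K.tbox A α ρ) {u : GTerm} (hu : u ∈ g.terms) :
    (∃ c, u = .val c ∧ (c < n ∨ c ∈ adom A)) ∨ ∃ t, u = .call t ∧ ∀ c ∈ t.args, c ∈ adom A := by
  obtain ⟨e, he, τ, hτ, F, hF, rfl⟩ := hg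
  rw [Assertion.terms_map, List.mem_map] at hu
  obtain ⟨v, hv, rfl⟩ := hu
  have hfv : ∀ x ∈ UCQ.fv e.pos, τ x ∈ adom A := fun x hx => by
    by_cases hp : x ∈ α.params
    · rw [hτ.1 x hp]
      exact hl.mem_adom hK hp
    · exact hτ.2.1 x (.inl hx) hp
  have := hK.head_terms α hα e he F hF v hv
  cases v with
  | const c => exact .inl ⟨c, rfl, .inl (hn.head α hα e he F hF c hv)⟩
  | var x => exact .inl ⟨_, rfl, .inr (hfv x this)⟩
  | call f xs =>
    refine .inr ⟨_, rfl, fun c hc => ?_⟩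
    obtain ⟨x, hx, rfl⟩ := List.mem_map.1 hc
    exact hfv x (this x hx)

theorem args_mem_adom (hK : K.WellFormed) {α : Action} (hα : α ∈ K.actions)
    {A : ABox} {ρ : ℕ → ℕ} (hl : K.Legal A α ρ) {t : SCall}
    (ht : t ∈ callsOf (doFacts K.tbox A α ρ)) {c : ℕ} (hc : c ∈ t.args) : c ∈ adom A := by
  obtain ⟨g, hg, ht⟩ := ht
  rcases doFacts_terms hK (KAB.constsLT (Nat.lt_succ_self _)) hα hl hg ht with ⟨_, h, _⟩ | ⟨_, h, h'⟩
  · simp at h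
  · cases h
    exact h' c hc

/-- The arguments of a new call belong to the ABox before the step, and its result appears in the
ABox after it. -/
theorem KAB.Step.values_subset (hK : K.WellFormed) {s s' : KState} (h : K.Step rep mk s s') :
    s'.values ⊆ s.values ∪ adom s'.abox := by
  rintro c (hc | ⟨t, v, htv, hc⟩)
  · exact .inr hc
  · cases h with
    | action s' α ρ h1 hα he =>
      obtain ⟨hl, θ, h1, h2, h3, h4⟩ := he
      rcases (h4 t v).1 htv with h | h
      · exact .inl (.inr ⟨t, v, h, hc⟩)
      · have ht := (h1 t).1 ⟨v, h⟩
        rcases hc with hc | rfl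
        · exact .inl (.inl (args_mem_adom hK hα hl ht hc))
        · obtain ⟨g, hg, ht⟩ := ht
          refine .inr ⟨g.map (GTerm.ground θ), Finset.mem_insert_of_mem ?_, ?_⟩
          · rw [← Finset.mem_coe, h3]
            exact ⟨g, hg, rfl⟩
          · rw [Assertion.terms_map]
            exact List.mem_map.2 ⟨_, ht, by simp [GTerm.ground, h]⟩
    | repair A' h1 h2 => exact .inl (.inr ⟨t, v, htv, hc⟩)

theorem values_nextState (hK : K.WellFormed) (hn : K.ConstsLT n) (hmk : ∀ c ∈ mk.terms, c < n)
    {t : StateCode} {α : Action} {σ : List (ℕ × ℕ)} {D : List (Assertion GTerm)} {C : List SCall}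
    (hα : α ∈ K.actions) (hl : K.Legal t.1.toFinset α (envFun σ))
    (hD : {g | g ∈ D} = doFacts K.tbox t.1.toFinset α (envFun σ)) (hC : IsNew t.2 D C)
    {θ : List (SCall × ℕ)} (hθ : θ.map Prod.fst = C) {c : ℕ}
    (hc : c ∈ (toState (marked mk (nextState t.2 D θ))).values) :
    c < n ∨ c ∈ (toState t).values ∨ c ∈ θ.map Prod.snd := by
  have hsnd : ∀ {u v}, look θ u = some v → v ∈ θ.map Prod.snd := fun h =>
    List.mem_map.2 ⟨_, mem_of_look h, rfl⟩
  rcases hc with ⟨F, hF, hc⟩ | ⟨u, v, huv, hc⟩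
  · rw [toState_marked] at hF
    rcases Finset.mem_insert.1 hF with rfl | hF
    · exact .inl (hmk c hc)
    · obtain ⟨g, hg, rfl⟩ := List.mem_map.1 (List.mem_toFinset.1 hF)
      rw [Assertion.terms_map, List.mem_map] at hc
      obtain ⟨u, hu, rfl⟩ := hc
      have hg' : g ∈ doFacts K.tbox t.1.toFinset α (envFun σ) := by rw [← hD]; exact hg
      rcases doFacts_terms hK hn hα hl hg' hu with ⟨c, rfl, hc | hc⟩ | ⟨u, rfl, -⟩
      · exact .inl hc
      · exact .inr (.inl (.inl hc))
      · simp only [GTerm.ground, look_append]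
        cases hv : look t.2 u with
        | some v => exact .inr (.inl (.inr ⟨u, v, hv, .inr rfl⟩))
        | none =>
          cases hv' : look θ u with
          | some v => exact .inr (.inr (hsnd hv'))
          | none =>
            exact (look_eq_none_iff.1 hv' (hθ ▸ hC.2 u (mem_callList.2 ⟨g, hg, hu⟩) hv)).elim
  · change look (t.2 ++ θ) u = some v at huv
    rw [look_append] at huv
    cases hv : look t.2 u with
    | some v' =>
      rw [hv] at huv
      exact .inr (.inl (.inr ⟨u, v, hv.trans huv, hc⟩))
    | none =>
      rw [hv, Option.none_or] at huv
      rcases hc with hc | rfl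
      · have : u ∈ callList D := (hC.1 u (hθ ▸ List.mem_map.2 ⟨_, mem_of_look huv, rfl⟩)).1
        refine .inr (.inl (.inl (args_mem_adom hK hα hl ?_ hc)))
        rw [← hD]
        exact mem_callList.1 this
      · exact .inr (.inr (hsnd huv))

/-- Run-boundedness counts values of ABoxes only. The call map accumulates values that were in some
earlier or present ABox, so a run leading to the state extends the bound to its call map. -/
theorem KAB.exists_run (hK : K.WellFormed) (s : (K.repairTS rep mk).State) :
    ∃ (m : ℕ) (τ : ℕ → (K.repairTS rep mk).State), (K.repairTS rep mk).IsRun m τ ∧ τ m = s ∧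
      ∀ c ∈ s.1.values, ∃ i : ℕ, i ≤ m ∧ c ∈ adom ((K.repairTS rep mk).abox (τ i)) := by
  obtain ⟨s, hs⟩ := s
  induction hs with
  | refl =>
    refine ⟨0, fun _ => (K.repairTS rep mk).init, ⟨rfl, by simp⟩, rfl, ?_⟩
    rintro c (hc | ⟨t, v, h, -⟩)
    · exact ⟨0, le_rfl, hc⟩
    · simp at h
  | @tail s s' h1 h2 ih =>
    obtain ⟨m, τ, hr, hm, hv⟩ := ih
    let z : (K.repairTS rep mk).State := ⟨s', h1.tail h2⟩
    obtain ⟨τ', h3, h4⟩ : ∃ τ', (∀ i ≤ m, τ' i = τ i) ∧ τ' (m + 1) = z :=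
      ⟨fun i => if i ≤ m then τ i else z, fun i hi => if_pos hi, if_neg (Nat.not_succ_le_self m)⟩
    refine ⟨m + 1, τ', ⟨(h3 0 (Nat.zero_le _)).trans hr.1, fun i hi => ?_⟩, h4, fun c hc => ?_⟩
    · have hi : i ≤ m := Nat.lt_succ_iff.1 (by exact_mod_cast hi)
      rw [h3 i hi]
      rcases hi.lt_or_eq with hi | rfl
      · rw [h3 _ hi]
        exact hr.2 i (by exact_mod_cast hi)
      · rw [hm, h4]
        exact h2
    · rcases h2.values_subset hK hc with hc | hc
      · obtain ⟨i, hi, hc⟩ := hv c hc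
        exact ⟨i, hi.trans (Nat.le_succ _), by rwa [h3 i hi]⟩
      · exact ⟨m + 1, le_rfl, by rw [h4]; exact hc⟩

theorem KAB.encard_values_lt (hK : K.WellFormed) {b : ℕ}
    (hb : ∀ (m : ℕ∞) (τ : ℕ → (K.repairTS rep mk).State), (K.repairTS rep mk).IsRun m τ →
      {c | ∃ i : ℕ, (i : ℕ∞) ≤ m ∧ c ∈ adom ((K.repairTS rep mk).abox (τ i))}.encard < b)
    (s : (K.repairTS rep mk).State) : s.1.values.encard < b := by
  obtain ⟨m, τ, hr, -, hv⟩ := K.exists_run hK s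
  refine (Set.encard_le_encard fun c hc => ?_).trans_lt (hb m τ hr)
  obtain ⟨i, hi, hc⟩ := hv c hc
  exact ⟨i, by exact_mod_cast hi, hc⟩

end Values

/-! ### Finitely many states over finitely many values. -/

section Shapes

variable {rep : TBox → ABox → ABox → Prop} {K : KAB} {mk : Assertion ℕ}

/-- The predicates of the facts in the syntax of a KAB. -/
def KAB.factShapes (K : KAB) (mk : Assertion ℕ) : List (Assertion Unit) :=
  ((mk :: K.abox₀).map (Assertion.map fun _ => ())) ++
    K.actions.flatMap fun α => α.effects.flatMap fun e => e.head.map (Assertion.map fun _ => ())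

def ETerm.callShape : ETerm → List (ℕ × ℕ)
  | .call f xs => [(f, xs.length)]
  | _ => []

/-- The function symbols in the syntax of a KAB. -/
def KAB.callShapes (K : KAB) : List (ℕ × ℕ) :=
  K.actions.flatMap fun α => α.effects.flatMap fun e => e.head.flatMap fun F =>
    F.terms.flatMap ETerm.callShape

/-- The state uses only predicates and function symbols that occur in `K`. -/
structure KState.Shaped (K : KAB) (mk : Assertion ℕ) (s : KState) : Prop where
  abox : ∀ F ∈ s.abox, F.map (fun _ => ()) ∈ K.factShapes mk
  calls : ∀ t v, s.calls t = some v → (t.fn, t.args.length) ∈ K.callShapes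

/-- New facts and calls are instances of effect heads, and repairs only delete facts. With bounded
values this leaves finitely many states. -/
theorem KAB.Step.shaped (hrep : GoodRepair rep) {s s' : KState} (h : K.Step rep mk s s')
    (hs : s.Shaped K mk) : s'.Shaped K mk := by
  cases h with
  | action s' α ρ h1 hα he =>
    obtain ⟨-, θ, h1, -, h3, h4⟩ := he
    refine ⟨fun F hF => ?_, fun t v htv => ?_⟩
    · rcases Finset.mem_insert.1 hF with rfl | hF
      · exact List.mem_append_left _ (by simp)
      · rw [← Finset.mem_coe, h3] at hF
        obtain ⟨_, ⟨e, he, _, -, G, hG, rfl⟩, rfl⟩ := hF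
        rw [Assertion.map_map, Assertion.map_map]
        exact List.mem_append_right _ (List.mem_flatMap.2 ⟨α, hα, List.mem_flatMap.2 ⟨e, he,
          List.mem_map.2 ⟨G, hG, rfl⟩⟩⟩)
    · rcases (h4 t v).1 htv with h | h
      · exact hs.calls t v h
      · obtain ⟨_, ⟨e, he, τ, -, F, hF, rfl⟩, ht⟩ := (h1 t).1 ⟨v, h⟩
        rw [Assertion.terms_map, List.mem_map] at ht
        obtain ⟨u, hu, hut⟩ := ht
        refine List.mem_flatMap.2 ⟨α, hα, List.mem_flatMap.2 ⟨e, he, List.mem_flatMap.2 ⟨F, hF,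
          List.mem_flatMap.2 ⟨u, hu, ?_⟩⟩⟩⟩
        cases u with
        | const c => simp [ETerm.inst] at hut
        | var x => simp [ETerm.inst] at hut
        | call f xs =>
          simp only [ETerm.inst, GTerm.call.injEq] at hut
          simp [← hut, ETerm.callShape]
  | repair A' h1 h2 =>
    exact ⟨fun F hF => hs.abox F (Finset.mem_of_mem_erase (hrep.subset h2 hF)), hs.calls⟩

theorem KAB.shaped_of_reachable (hrep : GoodRepair rep) {s : KState}
    (h : Relation.ReflTransGen (K.Step rep mk) ⟨K.initABox, fun _ => none⟩ s) : s.Shaped K mk := by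
  induction h with
  | refl =>
    refine ⟨fun F hF => List.mem_append_left _ (List.mem_map_of_mem (List.mem_cons_of_mem _
      (List.mem_toFinset.1 hF))), fun t v h => by simp at h⟩
  | tail _ h ih => exact h.shaped hrep ih

theorem finite_facts (L : List (Assertion Unit)) (N : ℕ) :
    {F : Assertion ℕ | F.map (fun _ => ()) ∈ L ∧ ∀ c ∈ F.terms, c < N}.Finite := by
  have hfin := L.finite_toSet.prod (finite_lists (Set.finite_Iio N) 2)
  refine (hfin.preimage (f := fun F : Assertion ℕ => (F.map (fun _ => ()), F.terms)) ?_).subset ?_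
  · rintro (⟨N, c⟩ | ⟨P, c, d⟩) - (⟨N', c'⟩ | ⟨P', c', d'⟩) - h <;>
      simp_all [Assertion.map, Assertion.terms]
  · rintro F ⟨h1, h2⟩
    exact ⟨h1, by cases F <;> simp [Assertion.terms], h2⟩

theorem finite_calls (L : List (ℕ × ℕ)) (N : ℕ) :
    {p : SCall × ℕ | (p.1.fn, p.1.args.length) ∈ L ∧ (∀ c ∈ p.1.args, c < N) ∧ p.2 < N}.Finite := by
  obtain ⟨M, hM⟩ := (L.map Prod.snd).finite_toSet.bddAbove
  have hfin := ((L.map Prod.fst).finite_toSet.prod (finite_lists (Set.finite_Iio N) M)).prod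
    (Set.finite_Iio N)
  refine (hfin.preimage (f := fun p : SCall × ℕ => ((p.1.fn, p.1.args), p.2)) ?_).subset ?_
  · rintro ⟨⟨f, xs⟩, v⟩ - ⟨⟨f', xs'⟩, v'⟩ - h
    simpa using h
  · rintro p ⟨h1, h2, h3⟩
    exact ⟨⟨List.mem_map.2 ⟨_, h1, rfl⟩, hM (List.mem_map.2 ⟨_, h1, rfl⟩), h2⟩, h3⟩

/-- A finite list of presentations for all states with given predicates, function symbols
and values. -/
theorem exists_presentations (K : KAB) (mk : Assertion ℕ) (N : ℕ) :
    ∃ S : List StateCode, (∀ t ∈ S, ∀ c ∈ valueList t, c < N) ∧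
      ∀ s : KState, s.Shaped K mk → (∀ c ∈ s.values, c < N) → ∃ t ∈ S, toState t = s := by
  classical
  let FL := (finite_facts (K.factShapes mk) N).toFinset.toList
  let CL := (finite_calls K.callShapes N).toFinset.toList
  have hFL : ∀ F, F ∈ FL ↔ F.map (fun _ => ()) ∈ K.factShapes mk ∧ ∀ c ∈ F.terms, c < N := by
    simp [FL]
  have hCL : ∀ p, p ∈ CL ↔ (p.1.fn, p.1.args.length) ∈ K.callShapes ∧ (∀ c ∈ p.1.args, c < N) ∧
      p.2 < N := by
    simp [CL]
  refine ⟨sublists FL ×ˢ sublists CL, fun t ht c hc => ?_, fun s h1 h2 => ?_⟩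
  · obtain ⟨A, m⟩ := t
    rw [List.mem_product, mem_sublists, mem_sublists] at ht
    rw [mem_valueList] at hc
    rcases hc with ⟨F, hF, hc⟩ | ⟨u, v, hv, hc⟩
    · exact ((hFL F).1 (ht.1.subset (List.mem_toFinset.1 hF))).2 c hc
    · have := (hCL _).1 (ht.2.subset (mem_of_look hv))
      rcases hc with hc | rfl
      · exact this.2.1 c hc
      · exact this.2.2
  · refine ⟨(FL.filter (· ∈ s.abox), CL.filter fun p => s.calls p.1 = some p.2), ?_, ?_⟩
    · rw [List.mem_product, mem_sublists, mem_sublists]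
      exact ⟨List.filter_sublist, List.filter_sublist⟩
    · obtain ⟨A, m⟩ := s
      simp only [toState, KState.mk.injEq]
      constructor
      · ext F
        simp only [List.mem_toFinset, List.mem_filter, hFL, decide_eq_true_eq]
        exact and_iff_right_of_imp fun hF => ⟨h1.abox F hF, fun c hc => h2 c (.inl ⟨F, hF, hc⟩)⟩
      · funext u
        cases hu : look _ u with
        | some v => simpa using (of_decide_eq_true (List.mem_filter.1 (mem_of_look hu)).2).symm
        | none =>
          rw [look_eq_none_iff] at hu
          cases hv : m u with
          | none => rfl
          | some v =>
            refine (hu (List.mem_map.2 ⟨(u, v), List.mem_filter.2 ⟨(hCL _).2 ⟨h1.calls u v hv,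
              fun c hc => ?_, ?_⟩, by simpa using hv⟩, rfl⟩)).elim
            · exact h2 c (.inr ⟨u, v, hv, .inl hc⟩)
            · exact h2 v (.inr ⟨u, v, hv, .inr rfl⟩)

end Shapes

/-! ### Existence of abstractions. -/

section Existence

variable {rep : TBox → ABox → ABox → Prop} {K : KAB} {mk : Assertion ℕ} {n : ℕ}

/-- Presentations of the reachable states with values below a large `N`, with all steps between
them, form an abstraction. -/
theorem exists_isAbstraction (hrep : GoodRepair rep) (hK : K.WellFormed) (hn : K.ConstsLT n)
    (hmk : ∀ c ∈ mk.terms, c < n) (hb : (K.repairTS rep mk).RunBounded) (k : ℕ) :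
    ∃ S E N t₀, IsAbstraction rep K mk n k S E N t₀ := by
  classical
  obtain ⟨b, hb⟩ := hb
  let R : KState → Prop := Relation.ReflTransGen (K.Step rep mk) ⟨K.initABox, fun _ => none⟩
  have hcard : ∀ s, R s → s.values.encard < b := fun s hs => K.encard_values_lt hK hb ⟨s, hs⟩
  -- Room for the constants below `n`, for fewer than `b` values of a state, for fewer than `b` new
  -- calls, and for `k` remembered values.
  let N := n + 2 * b + k
  obtain ⟨S₀, hS₀, hS₀'⟩ := exists_presentations K mk N
  let S := S₀.filter fun t => R (toState t)
  let E := (S ×ˢ S).filter fun p => K.ListStep rep mk p.1 p.2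
  have hS : ∀ t, t ∈ S ↔ t ∈ S₀ ∧ R (toState t) := by simp [S]
  have hE : ∀ t t', (t, t') ∈ E ↔ (t ∈ S ∧ t' ∈ S) ∧ K.ListStep rep mk t t' := by simp [E]
  have hSv : ∀ t ∈ S, ∀ c ∈ (toState t).values, c < N := fun t ht c hc =>
    hS₀ t ((hS t).1 ht).1 c (mem_valueList.2 hc)
  have hex : ∀ s, R s → (∀ c ∈ s.values, c < N) → ∃ t ∈ S, toState t = s := by
    intro s hs hv
    obtain ⟨t, ht, rfl⟩ := hS₀' s (KAB.shaped_of_reachable hrep hs) hv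
    exact ⟨t, (hS t).2 ⟨ht, hs⟩, rfl⟩
  have hstep : ∀ t ∈ S, ∀ s, K.Step rep mk (toState t) s → (∀ c ∈ s.values, c < N) →
      ∃ p ∈ E, p.1 = t ∧ toState p.2 = s := by
    intro t ht s hs hv
    obtain ⟨t', ht', rfl⟩ := hex s (((hS t).1 ht).2.tail hs) hv
    exact ⟨(t, t'), (hE t t').2 ⟨⟨ht, ht'⟩, (KAB.listStep_iff hK).2 hs⟩, rfl, rfl⟩
  obtain ⟨t₀, ht₀, ht₀'⟩ := hex ⟨K.initABox, fun _ => none⟩ .refl (by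
    rintro c (⟨F, hF, hc⟩ | ⟨u, v, h, -⟩)
    · have := hn.abox F (List.mem_toFinset.1 hF) c hc
      omega
    · simp at h)
  refine ⟨S, E, N, t₀, by omega, ⟨ht₀, ht₀'⟩, fun t ht c hc => hSv t ht c (mem_valueList.1 hc),
    fun p hp => ?_, fun t ht hm α hα σ hσ hl => ?_, fun t ht hm B hB hr => ?_⟩
  · have := (hE p.1 p.2).1 hp
    exact ⟨this.1.1, this.1.2, this.2⟩
  · rw [KAB.isLegal_iff hK] at hl
    have htR := ((hS t).1 ht).2
    obtain ⟨D, hD⟩ := exists_isDo K.tbox t.1 α σ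
    have hD' := (isDo_iff hK hα (mem_assigns.1 hσ).1).1 hD
    obtain ⟨C, hC, hCn⟩ := exists_isNew t.2 D
    have hnext : ∀ θ : List (SCall × ℕ), θ.map Prod.fst = C →
        K.Step rep mk (toState t) (toState (marked mk (nextState t.2 D θ))) := by
      intro θ hθ
      rw [toState_marked]
      exact .action _ _ α _ (fun h => hm (List.mem_toFinset.1 h)) hα (KAB.exec_nextState hl hD' hC hθ)
    have hfin : (toState t).values.Finite := Set.encard_lt_top_iff.1 ((hcard _ htR).trans (by simp))
    have hcardt : hfin.toFinset.card < b := by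
      have := hcard _ htR
      rw [hfin.encard_eq_coe_toFinset_card] at this
      exact_mod_cast this
    refine ⟨D, C, hD, hC, ⟨List.range n ++ hfin.toFinset.toList, fun c hc => ?_, fun c hc => ?_, ?_⟩,
      fun θ hθ => ?_⟩
    · rw [List.mem_append, mem_valueList] at hc
      simpa using hc
    · rw [List.mem_append] at hc
      rcases hc with hc | hc
      · have := List.mem_range.1 hc
        omega
      · exact hSv t ht c (by simpa using hc)
    -- Giving pairwise distinct results to the new calls, namely their codes, leads to a reachable
    -- state with at least `C.length` values. Hence there are fewer than `b` new calls.
    · let θ : List (SCall × ℕ) := C.map fun c => (c, Numbered.code c)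
      have h1 := hcard _ (htR.tail (hnext θ (by simp [θ, Function.comp_def])))
      have h2 : ((C.map Numbered.code).toFinset : Set ℕ) ⊆
          (toState (marked mk (nextState t.2 D θ))).values := by
        intro v hv
        rw [List.coe_toFinset] at hv
        obtain ⟨c, hc, rfl⟩ := List.mem_map.1 hv
        refine .inr ⟨c, _, ?_, .inr rfl⟩
        change look (t.2 ++ θ) c = _
        rw [look_append, (hC.1 c hc).2, look_map, if_pos hc]
        rfl
      have h3 := (Set.encard_le_encard h2).trans_lt h1
      rw [Set.encard_coe_eq_coe_finsetCard, List.toFinset_card_of_nodup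
        (hCn.map Numbered.code_injective), List.length_map] at h3
      have h3 : C.length < b := by exact_mod_cast h3
      simp only [List.length_append, List.length_range, Finset.length_toList]
      omega
    · have hθ := mem_assigns.1 hθ
      refine hstep t ht _ (hnext θ hθ.1) fun c hc => ?_
      rcases values_nextState hK hn hmk hα hl hD' hC hθ.1 hc with h | h | h
      · omega
      · exact hSv t ht c h
      · obtain ⟨p, hp, rfl⟩ := List.mem_map.1 h
        exact List.mem_range.1 (hθ.2 p hp)
  · rw [toFinset_unmark] at hr
    refine hstep t ht _ (.repair (toState t) B.toFinset (List.mem_toFinset.2 hm) hr) ?_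
    rintro c (⟨F, hF, hc⟩ | hc)
    · exact hSv t ht c (.inl ⟨F, Finset.mem_of_mem_erase (hrep.subset hr hF), hc⟩)
    · exact hSv t ht c (.inr hc)

end Existence

/-! ### Matching steps inside an abstraction. -/

section Closure

/-- The entries of `W` are moved below `N` one at a time, by a transposition with a value that is
neither in `X` nor the image of an entry already treated. The cardinality condition guarantees such
a value. -/
theorem exists_perm {N : ℕ} (X : Finset ℕ) (hX : ∀ x ∈ X, x < N) (W : List ℕ)
    (h : X.card + W.length ≤ N) :
    ∃ τ : Equiv.Perm ℕ, (∀ x ∈ X, τ x = x) ∧ ∀ w ∈ W, τ w < N := by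
  induction W with
  | nil => exact ⟨1, fun _ _ => rfl, by simp⟩
  | cons w W ih =>
    simp only [List.length_cons] at h
    obtain ⟨τ, h1, h2⟩ := ih (by omega)
    by_cases hw : τ w < N
    · exact ⟨τ, h1, fun w' hw' => (List.mem_cons.1 hw').elim (fun h => h ▸ hw) (h2 w')⟩
    · have hc : (X ∪ (W.map τ).toFinset).card < (Finset.range N).card := by
        have h3 := Finset.card_union_le X (W.map τ).toFinset
        have h4 := List.toFinset_card_le (W.map τ)
        rw [List.length_map] at h4
        rw [Finset.card_range]
        omega
      obtain ⟨y, hy, hy'⟩ := Finset.exists_mem_notMem_of_card_lt_card hc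
      simp only [Finset.mem_range, Finset.mem_union, List.mem_toFinset, not_or] at hy hy'
      refine ⟨Equiv.swap (τ w) y * τ, fun x hx => ?_, fun w' hw' => ?_⟩
      · rw [Equiv.Perm.mul_apply, h1 x hx, Equiv.swap_apply_of_ne_of_ne]
        · rintro rfl
          exact hw (hX _ hx)
        · rintro rfl
          exact hy'.1 hx
      · rw [Equiv.Perm.mul_apply]
        by_cases hww : τ w' = τ w
        · rw [hww, Equiv.swap_apply_left]
          exact hy
        · have hw' : w' ∈ W := (List.mem_cons.1 hw').resolve_left fun h => hww (h ▸ rfl)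
          rw [Equiv.swap_apply_of_ne_of_ne hww]
          · exact h2 w' hw'
          · exact fun h => hy'.2 (h ▸ List.mem_map_of_mem hw')

theorem Assertion.map_eq_self {τ : ℕ → ℕ} {F : Assertion ℕ} (h : ∀ c ∈ F.terms, τ c = c) :
    F.map τ = F :=
  (Assertion.map_congr (g := fun x => x) h).trans F.map_id'

theorem KState.rename_of_fixed {τ : Equiv.Perm ℕ} {s : KState} (h : ∀ c ∈ s.values, τ c = c) :
    s.rename τ = s := by
  obtain ⟨A, m⟩ := s
  simp only [KState.rename, KState.mk.injEq]
  constructor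
  · have : A.image (Assertion.map τ) = A.image id := Finset.image_congr fun F hF =>
      Assertion.map_eq_self fun c hc => h c (.inl ⟨F, hF, hc⟩)
    rw [this, Finset.image_id]
  · funext t
    refine Option.ext fun v => ?_
    rw [CallMap.rename_eq_some_iff]
    constructor
    · intro hv
      have h1 : τ.symm v = v := by
        simpa using (h _ (.inr ⟨_, _, hv, .inr rfl⟩)).symm
      have h2 : t.map τ.symm = t := by
        obtain ⟨f, xs⟩ := t
        simp only [SCall.map, SCall.mk.injEq, true_and]
        conv_rhs => rw [← List.map_id xs]
        refine List.map_congr_left fun x hx => ?_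
        simpa using (h _ (.inr ⟨_, _, hv, .inl (List.mem_map_of_mem hx)⟩)).symm
      rwa [h1, h2] at hv
    · intro hv
      have h2 : t.map τ.symm = t := by
        obtain ⟨f, xs⟩ := t
        simp only [SCall.map, SCall.mk.injEq, true_and]
        conv_rhs => rw [← List.map_id xs]
        exact List.map_congr_left fun x hx => symm_apply_of_fixed (h x (.inr ⟨_, _, hv, .inl hx⟩))
      rw [h2, symm_apply_of_fixed (h v (.inr ⟨_, _, hv, .inr rfl⟩))]
      exact hv

variable {rep : TBox → ABox → ABox → Prop} {K : KAB} {mk : Assertion ℕ} {n k N : ℕ}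
  {S : List StateCode} {E : List (StateCode × StateCode)} {t₀ : StateCode}

/-- The results of new calls in `u` may be arbitrarily large. A permutation moves them below `N`
while fixing the constants, the values of `t` and the values in `G`. By invariance the renamed step
starts in `t` again, and now the abstraction contains it. Repair steps introduce no values and need
no renaming. -/
theorem IsAbstraction.exists_step (h : IsAbstraction rep K mk n k S E N t₀) (hrep : GoodRepair rep)
    (hK : K.WellFormed) (hn : K.ConstsLT n) (hmk : ∀ c ∈ mk.terms, c < n) {t : StateCode}
    (ht : t ∈ S) {u : KState} (hu : K.Step rep mk (toState t) u) (G : List ℕ)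
    (hG : ∀ c ∈ G, c < N) (hGk : G.length ≤ k) :
    ∃ τ : Equiv.Perm ℕ, (∀ c < n, τ c = c) ∧ (∀ c ∈ (toState t).values, τ c = c) ∧
      (∀ c ∈ G, τ c = c) ∧ ∃ t', (t, t') ∈ E ∧ toState t' = u.rename τ := by
  classical
  obtain ⟨-, -, -, -, hact, hrepair⟩ := h
  cases hu with
  | action s' α ρ h1 hα he =>
    obtain ⟨σ, hσ, -, hl, he⟩ := he.exists_assignment hK
    obtain ⟨D, C, hD, hC, ⟨F, hF, hFN, hcard⟩, hθ⟩ :=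
      hact t ht (fun h => h1 (List.mem_toFinset.2 h)) α hα σ hσ hl
    have hD := (isDo_iff hK hα (mem_assigns.1 hσ).1).1 hD
    obtain ⟨f, rfl⟩ := he.exists_values hD hC
    have hX : (F.toFinset ∪ G.toFinset).card + (C.map f).length ≤ N := by
      have h2 := Finset.card_union_le F.toFinset G.toFinset
      have h3 := F.toFinset_card_le
      have h4 := G.toFinset_card_le
      rw [List.length_map]
      omega
    obtain ⟨τ, hτ, hτN⟩ := exists_perm (N := N) _ (fun x hx => by
      rcases Finset.mem_union.1 hx with hx | hx
      · exact hFN x (List.mem_toFinset.1 hx)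
      · exact hG x (List.mem_toFinset.1 hx)) (C.map f) hX
    have hτF : ∀ c ∈ F, τ c = c := fun c hc =>
      hτ c (Finset.mem_union_left _ (List.mem_toFinset.2 hc))
    have hτn : ∀ c < n, τ c = c := fun c hc =>
      hτF c (hF c (List.mem_append_left _ (List.mem_range.2 hc)))
    have hτv : ∀ c ∈ (toState t).values, τ c = c := fun c hc =>
      hτF c (hF c (List.mem_append_right _ (mem_valueList.2 hc)))
    refine ⟨τ, hτn, hτv, fun c hc => hτ c (Finset.mem_union_right _ (List.mem_toFinset.2 hc)), ?_⟩
    -- The values of `t` are fixed, so the renamed execution starts from the same state with the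
    -- same parameter values, and the same `D` and `C` describe it.
    have he' := he.rename hn hτn hα
    rw [KState.rename_of_fixed hτv] at he'
    have he' := he'.congr hK (ρ' := envFun σ) fun p hp => hτv _ (.inl (he.1.mem_adom hK hp))
    obtain ⟨f', hf'⟩ := he'.exists_values hD hC
    have hmem : (C.map fun c => (c, f' c)) ∈ assigns C (List.range N) := by
      refine mem_assigns.2 ⟨by simp [Function.comp_def], fun p hp => ?_⟩
      obtain ⟨c, hc, rfl⟩ := List.mem_map.1 hp
      rw [List.mem_range]
      have h1 : (toState (nextState t.2 D (C.map fun c => (c, f' c)))).calls c = some (f' c) := by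
        change look (t.2 ++ _) c = _
        rw [look_append, (hC.1 c hc).2, look_map, if_pos hc]
        rfl
      rw [← hf'] at h1
      have h2 := CallMap.rename_eq_some_iff.1 h1
      change look (t.2 ++ _) _ = _ at h2
      rw [look_append] at h2
      -- The result of `c` is the image under `τ` of the result of the call renamed back. That
      -- result is either an old value, which is fixed, or the result of a new call, which is moved
      -- below `N`.
      cases hl : look t.2 (c.map τ.symm) with
      | some w =>
        rw [hl, Option.some_or, Option.some_inj] at h2
        have hw : w ∈ (toState t).values := .inr ⟨_, w, hl, .inr rfl⟩
        have h3 : f' c = w := by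
          rw [← hτv w hw, h2, Equiv.apply_symm_apply]
        rw [h3]
        exact hFN w (hF w (List.mem_append_right _ (mem_valueList.2 hw)))
      | none =>
        rw [hl, Option.none_or, look_map] at h2
        split_ifs at h2 with hc'
        rw [Option.some_inj] at h2
        have h3 : f' c = τ (f (c.map τ.symm)) := by rw [h2, Equiv.apply_symm_apply]
        rw [h3]
        exact hτN _ (List.mem_map_of_mem hc')
    obtain ⟨⟨t, t'⟩, hp, rfl, ht'⟩ := hθ _ hmem
    refine ⟨t', hp, ?_⟩
    rw [ht', toState_marked, ← hf']
    have hmk' : mk.map τ = mk := Assertion.map_eq_self fun c hc => hτn c (hmk c hc)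
    simp only [KState.rename, Finset.image_insert, hmk']
  | repair A' h1 h2 =>
    refine ⟨1, fun _ _ => rfl, fun _ _ => rfl, fun _ _ => rfl, ?_⟩
    let B := (unmark mk t.1).filter (· ∈ A')
    have hB : B.toFinset = A' := by
      ext F
      simp only [B, List.mem_toFinset, List.mem_filter, decide_eq_true_eq]
      refine and_iff_right_of_imp fun hF => ?_
      rw [← List.mem_toFinset, toFinset_unmark]
      exact hrep.subset h2 hF
    obtain ⟨⟨t, t'⟩, hp, rfl, ht'⟩ := hrepair t ht (List.mem_toFinset.1 h1) B
      (mem_sublists.2 List.filter_sublist) (by rw [toFinset_unmark, hB]; exact h2)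
    refine ⟨t', hp, ?_⟩
    rw [ht', KState.rename_one]
    simp only [toState, hB]

end Closure

/-! ### Preservation of truth by abstractions. -/

section Bisimulation

/-- The truth of formulae in the states of a finite transition system with steps `E`, under
valuations that are given by lists. -/
def ITForm.Eval (T : TBox) (S : List StateCode) (E : List (StateCode × StateCode)) :
    ITForm → List (ℕ × ℕ) → List (ℕ × List StateCode) → StateCode → Prop
  | .query Q, w, _, t => Q.Holds T t.1.toFinset (envFun w)
  | .neg Φ, w, W, t => ¬ Φ.Eval T S E w W t
  | .and Φ Ψ, w, W, t => Φ.Eval T S E w W t ∧ Ψ.Eval T S E w W t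
  | .ex x Φ, w, W, t => ∃ d ∈ adomList t.1, Φ.Eval T S E ((x, d) :: w) W t
  | .diaBox Φ, w, W, t => ∃ p ∈ E, p.1 = t ∧ ∀ q ∈ E, q.1 = p.2 → Φ.Eval T S E w W q.2
  | .boxBox Φ, w, W, t => ∀ p ∈ E, p.1 = t → ∀ q ∈ E, q.1 = p.2 → Φ.Eval T S E w W q.2
  | .pvar Z, _, W, t => t ∈ (look W Z).getD []
  | .mu Z Φ, w, W, t => ∀ L ∈ sublists S, (∀ u ∈ S, Φ.Eval T S E w ((Z, L) :: W) u → u ∈ L) → t ∈ L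

/-- The state `t` is a renaming of the state `s`, which is the identity on the constants below `n`
and is given by `g` on the values in `g`. -/
def Related (n N : ℕ) (g : List (ℕ × ℕ)) (s : KState) (t : StateCode) : Prop :=
  ∃ π : Equiv.Perm ℕ, (∀ c < n, π c = c) ∧ s.rename π = toState t ∧ ∀ p ∈ g, π p.1 = p.2 ∧ p.2 < N

theorem Related.of_cons {n N : ℕ} {p : ℕ × ℕ} {g : List (ℕ × ℕ)} {s : KState} {t : StateCode}
    (h : Related n N (p :: g) s t) : Related n N g s t := by
  obtain ⟨π, h1, h2, h3⟩ := h
  exact ⟨π, h1, h2, fun q hq => h3 q (List.mem_cons_of_mem _ hq)⟩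

variable {rep : TBox → ABox → ABox → Prop} {K : KAB} {mk : Assertion ℕ} {n k N : ℕ}
  {S : List StateCode} {E : List (StateCode × StateCode)} {t₀ : StateCode} {g : List (ℕ × ℕ)}

/-- The step is first copied to `t` along the renaming and then corrected by
`IsAbstraction.exists_step`. The values that `g` remembers must be fixed by the correction; the room
for `k` values pays for this. -/
theorem IsAbstraction.forth (h : IsAbstraction rep K mk n k S E N t₀) (hrep : GoodRepair rep)
    (hK : K.WellFormed) (hn : K.ConstsLT n) (hmk : ∀ c ∈ mk.terms, c < n) {s s' : KState}
    {t : StateCode} (ht : t ∈ S) (hst : Related n N g s t) (hg : g.length ≤ k)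
    (hs : K.Step rep mk s s') : ∃ t', (t, t') ∈ E ∧ Related n N g s' t' := by
  obtain ⟨π, h1, h2, h3⟩ := hst
  have hs' := hs.rename hrep hn h1 hmk
  rw [h2] at hs'
  obtain ⟨τ, h4, -, h5, t', ht', h6⟩ := h.exists_step hrep hK hn hmk ht hs' (g.map Prod.snd)
    (fun c hc => by
      obtain ⟨p, hp, rfl⟩ := List.mem_map.1 hc
      exact (h3 p hp).2) (by simpa using hg)
  refine ⟨t', ht', τ * π, fun c hc => ?_, ?_, fun p hp => ⟨?_, (h3 p hp).2⟩⟩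
  · rw [Equiv.Perm.mul_apply, h1 c hc, h4 c hc]
  · rw [h6, KState.rename_rename]
  · rw [Equiv.Perm.mul_apply, (h3 p hp).1, h5 _ (List.mem_map_of_mem hp)]

/-- Edges of the abstraction are genuine steps, so renaming them back is enough. -/
theorem IsAbstraction.back (h : IsAbstraction rep K mk n k S E N t₀) (hrep : GoodRepair rep)
    (hK : K.WellFormed) (hn : K.ConstsLT n) (hmk : ∀ c ∈ mk.terms, c < n) {s : KState}
    {t t' : StateCode} (hst : Related n N g s t) (ht : (t, t') ∈ E) :
    ∃ s', K.Step rep mk s s' ∧ Related n N g s' t' := by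
  obtain ⟨π, h1, h2, h3⟩ := hst
  have hs := (KAB.listStep_iff hK).1 (h.2.2.2.1 _ ht).2.2
  have hs' := hs.rename (π := π.symm) hrep hn (fun c hc => symm_apply_of_fixed (h1 c hc)) hmk
  rw [← h2, KState.rename_symm_rename] at hs'
  refine ⟨_, hs', π, h1, ?_, h3⟩
  have := (toState t').rename_symm_rename (π := π.symm)
  rwa [Equiv.symm_symm] at this

/-- Implication between two propositions in one of the two directions. -/
def Transfer : Bool → Prop → Prop → Prop
  | false, p, q => p → q
  | true, p, q => q → p

theorem Transfer.of_iff {p q : Prop} (h : p ↔ q) (d : Bool) : Transfer d p q := by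
  cases d
  · exact h.1
  · exact h.2

theorem Transfer.not {p q : Prop} {d : Bool} (h : Transfer (!d) p q) : Transfer d (¬ p) (¬ q) := by
  cases d <;> exact mt h

theorem Transfer.and {p q p' q' : Prop} {d : Bool} (h : Transfer d p q) (h' : Transfer d p' q') :
    Transfer d (p ∧ p') (q ∧ q') := by
  cases d <;> exact And.imp h h'

theorem mem_ext_diaBox {Υ : TS} {Φ : ITForm} {v : ℕ → ℕ} {V : ℕ → Set Υ.State} {s : Υ.State} :
    s ∈ (ITForm.diaBox Φ).toMu.ext Υ v V ↔
      ∃ s', Υ.step s s' ∧ ∀ s'', Υ.step s' s'' → s'' ∈ Φ.toMu.ext Υ v V := by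
  simp [ITForm.toMu, MuForm.box, MuForm.ext]

theorem mem_ext_boxBox {Υ : TS} {Φ : ITForm} {v : ℕ → ℕ} {V : ℕ → Set Υ.State} {s : Υ.State} :
    s ∈ (ITForm.boxBox Φ).toMu.ext Υ v V ↔
      ∀ s', Υ.step s s' → ∀ s'', Υ.step s' s'' → s'' ∈ Φ.toMu.ext Υ v V := by
  simp [ITForm.toMu, MuForm.box, MuForm.ext]

/-- A bisimulation argument with bounded memory. The list `g` pairs the values of the variables on
both sides; such values may have left the active domain but must still be renamed consistently. Only
`∃` adds a pair, and there the code of the formula drops, so the inequality between `g.length +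
Φ.code` and `k` persists. The implications are treated separately because of fixpoint variables:
sets of states are compared with lists in one direction only, reversed under each negation, and by
syntactic monotonicity the comparison for a bound variable is needed in just this direction. -/
theorem IsAbstraction.transfer (h : IsAbstraction rep K mk n k S E N t₀) (hrep : GoodRepair rep)
    (hK : K.WellFormed) (hn : K.ConstsLT n) (hmk : ∀ c ∈ mk.terms, c < n) (hkn : k < n) (Φ : ITForm)
    (d : Bool) (g : List (ℕ × ℕ)) (v : ℕ → ℕ) (w : List (ℕ × ℕ))
    (V : ℕ → Set (K.repairTS rep mk).State) (W : List (ℕ × List StateCode))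
    (hvw : ∀ x ∈ Φ.toMu.fv, (v x, envFun w x) ∈ g) (hm : Φ.toMu.Mono) (hg : g.length + Φ.code ≤ k)
    (hVW : ∀ Z odd, Φ.toMu.FreeIn Z odd → ∀ (s : (K.repairTS rep mk).State), ∀ t ∈ S,
      Related n N g s.1 t → Transfer (xor d odd) (s ∈ V Z) (t ∈ (look W Z).getD []))
    (s : (K.repairTS rep mk).State) (t : StateCode) (ht : t ∈ S) (hst : Related n N g s.1 t) :
    Transfer d (s ∈ Φ.toMu.ext (K.repairTS rep mk) v V) (Φ.Eval K.tbox S E w W t) := by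
  classical
  have hE1 : ∀ {t t'}, (t, t') ∈ E → t' ∈ S := fun ht => (h.2.2.2.1 _ ht).2.1
  have hforth : ∀ {g : List (ℕ × ℕ)} (_ : g.length ≤ k) {s s' : (K.repairTS rep mk).State}
      {t : StateCode} (_ : t ∈ S) (_ : Related n N g s.1 t) (_ : (K.repairTS rep mk).step s s'),
      ∃ p ∈ E, p.1 = t ∧ p.2 ∈ S ∧ Related n N g s'.1 p.2 := by
    intro g hg s s' t ht hst hs
    obtain ⟨t', h1, h2⟩ := h.forth hrep hK hn hmk ht hst hg hs
    exact ⟨_, h1, rfl, hE1 h1, h2⟩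
  have hback : ∀ {g : List (ℕ × ℕ)} {s : (K.repairTS rep mk).State} {p : StateCode × StateCode}
      (_ : Related n N g s.1 p.1) (_ : p ∈ E),
      ∃ s', (K.repairTS rep mk).step s s' ∧ p.2 ∈ S ∧ Related n N g s'.1 p.2 := by
    intro g s p hst hp
    obtain ⟨s', h1, h2⟩ := h.back hrep hK hn hmk hst hp
    exact ⟨⟨s', s.2.tail h1⟩, h1, hE1 hp, h2⟩
  induction Φ generalizing d g v w V W s t with
  | query Q =>
    obtain ⟨π, h1, h2, h3⟩ := hst
    have hA : t.1.toFinset = s.1.abox.image (Assertion.map π) := (congrArg KState.abox h2).symm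
    refine .of_iff ?_ d
    change Q.Holds K.tbox s.1.abox v ↔ Q.Holds K.tbox t.1.toFinset (envFun w)
    rw [hA, ← ECQ.holds_rename (π := π) fun a ha c hc => h1 c ?_]
    · exact ECQ.holds_congr fun x hx => (h3 _ (hvw x hx)).1
    -- The constants of the formula are at most its code, hence at most `k` and below `n`, so the
    -- renaming fixes them.
    · have h4 := ECQ.le_code ha hc
      have h5 : Q.code ≤ (ITForm.query Q).code := Nat.right_le_pair _ _
      omega
  | neg Φ ih =>
    have hc : Φ.code ≤ (ITForm.neg Φ).code := Nat.right_le_pair _ _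
    refine .not (ih (!d) g v w V W hvw hm (by omega) (fun Z odd hZ s t ht hst => ?_) s t ht hst)
    have := hVW Z (!odd) (by simpa [ITForm.toMu, MuForm.FreeIn] using hZ) s t ht hst
    cases d <;> cases odd <;> exact this
  | and Φ Ψ ih ih' =>
    have hc : Φ.code ≤ (ITForm.and Φ Ψ).code := (Nat.left_le_pair _ _).trans (Nat.right_le_pair _ _)
    have hc' : Ψ.code ≤ (ITForm.and Φ Ψ).code :=
      (Nat.right_le_pair _ _).trans (Nat.right_le_pair _ _)
    exact .and (ih d g v w V W (fun x hx => hvw x (.inl hx)) hm.1 (by omega)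
        (fun Z odd hZ => hVW Z odd (.inl hZ)) s t ht hst)
      (ih' d g v w V W (fun x hx => hvw x (.inr hx)) hm.2 (by omega)
        (fun Z odd hZ => hVW Z odd (.inr hZ)) s t ht hst)
  | ex x Φ ih =>
    -- The strict descent of the code pays for the pair that is added to `g`.
    have hc : 3 + Φ.code ≤ (ITForm.ex x Φ).code :=
      (Nat.add_le_add_left (Nat.right_le_pair x Φ.code) 3).trans (Nat.add_le_pair _ _)
    obtain ⟨π, h1, h2, h3⟩ := hst
    have hA : t.1.toFinset = s.1.abox.image (Assertion.map π) := (congrArg KState.abox h2).symm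
    have key : ∀ c ∈ adom s.1.abox, π c ∈ adomList t.1 ∧
        Transfer d (s ∈ Φ.toMu.ext (K.repairTS rep mk) (Function.update v x c) V)
          (Φ.Eval K.tbox S E ((x, π c) :: w) W t) := by
      intro c hc'
      have hc'' : π c ∈ adomList t.1 := by
        rw [mem_adomList, hA]
        exact mem_adom_image.2 hc'
      refine ⟨hc'', ih d ((c, π c) :: g) _ _ V W (fun y hy => ?_) hm ?_
        (fun Z odd hZ s t ht hst => hVW Z odd hZ s t ht hst.of_cons) s t ht ⟨π, h1, h2, ?_⟩⟩
      · rw [envFun_cons]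
        by_cases hyx : y = x
        · simp [hyx]
        · simpa [hyx] using .inr (hvw y ⟨hy, hyx⟩)
      · simp only [List.length_cons]
        omega
      · intro p hp
        rcases List.mem_cons.1 hp with rfl | hp
        · exact ⟨rfl, h.2.2.1 t ht _ (List.mem_append_left _ hc'')⟩
        · exact h3 p hp
    cases d
    · rintro ⟨c, hc, hs⟩
      exact ⟨π c, (key c hc).1, (key c hc).2 hs⟩
    · rintro ⟨c, hc, hs⟩
      obtain ⟨c, rfl⟩ := π.surjective c
      rw [mem_adomList, hA, mem_adom_image] at hc
      exact ⟨c, hc, (key c hc).2 hs⟩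
  | diaBox Φ ih =>
    have hc : Φ.code ≤ (ITForm.diaBox Φ).code := Nat.right_le_pair _ _
    have ih := ih d g v w V W hvw hm (by omega) fun Z odd hZ => hVW Z odd
      (by simpa [ITForm.toMu, MuForm.FreeIn, MuForm.box] using hZ)
    rw [mem_ext_diaBox]
    have hgk : g.length ≤ k := by omega
    cases d
    · rintro ⟨s', h1, h2⟩
      obtain ⟨p, hp, rfl, hpS, hsp⟩ := hforth hgk ht hst h1
      refine ⟨p, hp, rfl, fun q hq hqp => ?_⟩
      obtain ⟨s'', h3, hqS, hsq⟩ := hback (hqp ▸ hsp) hq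
      exact ih s'' q.2 hqS hsq (h2 s'' h3)
    · rintro ⟨p, hp, rfl, h2⟩
      obtain ⟨s', h1, hpS, hsp⟩ := hback hst hp
      refine ⟨s', h1, fun s'' h3 => ?_⟩
      obtain ⟨q, hq, hqp, hqS, hsq⟩ := hforth hgk hpS hsp h3
      exact ih s'' q.2 hqS hsq (h2 q hq hqp)
  | boxBox Φ ih =>
    have hc : Φ.code ≤ (ITForm.boxBox Φ).code := Nat.right_le_pair _ _
    have ih := ih d g v w V W hvw hm (by omega) fun Z odd hZ => hVW Z odd
      (by simpa [ITForm.toMu, MuForm.FreeIn, MuForm.box] using hZ)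
    rw [mem_ext_boxBox]
    have hgk : g.length ≤ k := by omega
    cases d
    · intro h2 p hp hpt q hq hqp
      obtain ⟨s', h1, hpS, hsp⟩ := hback (hpt ▸ hst) hp
      obtain ⟨s'', h3, hqS, hsq⟩ := hback (hqp ▸ hsp) hq
      exact ih s'' q.2 hqS hsq (h2 s' h1 s'' h3)
    · intro h2 s' h1 s'' h3
      obtain ⟨p, hp, hpt, hpS, hsp⟩ := hforth hgk ht hst h1
      obtain ⟨q, hq, hqp, hqS, hsq⟩ := hforth hgk hpS hsp h3
      exact ih s'' q.2 hqS hsq (h2 p hp hpt q hq hqp)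
  | pvar Z =>
    have := hVW Z false ⟨rfl, rfl⟩ s t ht hst
    cases d <;> exact this
  | mu Z Φ ih =>
    have hc : Φ.code ≤ (ITForm.mu Z Φ).code := (Nat.right_le_pair _ _).trans (Nat.right_le_pair _ _)
    have key : ∀ (X : Set (K.repairTS rep mk).State) (L : List StateCode),
        (∀ s : (K.repairTS rep mk).State, ∀ t ∈ S, Related n N g s.1 t →
          Transfer d (s ∈ X) (t ∈ L)) → ∀ s : (K.repairTS rep mk).State, ∀ t ∈ S,
        Related n N g s.1 t → Transfer d
          (s ∈ Φ.toMu.ext (K.repairTS rep mk) v (Function.update V Z X))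
          (Φ.Eval K.tbox S E w ((Z, L) :: W) t) := by
      intro X L hXL
      refine ih d g v w _ _ hvw hm.2 (by omega) fun Y odd hY s t ht hst => ?_
      rw [look_cons]
      by_cases hYZ : Z = Y
      · subst hYZ
        cases odd
        · simpa using hXL s t ht hst
        · exact (hm.1 hY).elim
      · simpa [hYZ, Ne.symm hYZ] using hVW Y odd ⟨hYZ, hY⟩ s t ht hst
    cases d
    · intro hs L hL hpre
      -- A pre-fixpoint `L` is pulled back to the states all of whose related presentations lie in
      -- `L`; the induction hypothesis makes this set a pre-fixpoint.
      refine hs {s | ∀ t ∈ S, Related n N g s.1 t → t ∈ L} (fun s hs t ht hst => ?_) t ht hst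
      exact hpre t ht (key {s | ∀ t ∈ S, Related n N g s.1 t → t ∈ L} L
        (fun s t ht hst hs => hs t ht hst) s t ht hst hs)
    · intro hev X hX
      -- Dually, a pre-fixpoint `X` yields the presentations in `S` all of whose related states lie
      -- in `X`.
      have := hev (S.filter fun t => ∀ s : (K.repairTS rep mk).State, Related n N g s.1 t → s ∈ X)
        (mem_sublists.2 List.filter_sublist) fun u hu heu => by
          simp only [List.mem_filter, hu, decide_eq_true_eq, true_and]
          intro s hsu
          refine hX (key X _ (fun s t ht hst ht' => ?_) s u hu hsu heu)
          exact of_decide_eq_true (List.mem_filter.1 ht').2 s hst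
      exact of_decide_eq_true (List.mem_filter.1 this).2 s hst

/-- The identity relates the initial state to `t₀`, and nothing is remembered yet. -/
theorem IsAbstraction.models_iff (h : IsAbstraction rep K mk n k S E N t₀) (hrep : GoodRepair rep)
    (hK : K.WellFormed) (hn : K.ConstsLT n) (hmk : ∀ c ∈ mk.terms, c < n) (hkn : k < n) {Φ : ITForm}
    (hc : Φ.toMu.Closed) (hm : Φ.toMu.Mono) (hk : Φ.code ≤ k) :
    (K.repairTS rep mk).Models Φ.toMu ↔ Φ.Eval K.tbox S E [] [] t₀ := by
  have key : ∀ d v V, Transfer d ((K.repairTS rep mk).init ∈ Φ.toMu.ext (K.repairTS rep mk) v V)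
      (Φ.Eval K.tbox S E [] [] t₀) := by
    intro d v V
    refine h.transfer hrep hK hn hmk hkn Φ d [] v [] V [] (by simp [hc.1]) hm (by simpa using hk)
      (fun Z odd hZ => (hc.2 Z odd hZ).elim) _ t₀ h.2.1.1 ⟨1, fun _ _ => rfl, ?_, by simp⟩
    rw [KState.rename_one, h.2.1.2]
    rfl
  exact ⟨fun H => key false (fun _ => 0) (fun _ => ∅) (H _ _), fun H v V => key true v V H⟩

end Bisimulation

/-! ### Model checking in a finite system. -/

section Evaluation

variable {γ α : Type} [Numbered γ] [Numbered α]

/-- The list of truth values `ps` has an entry for `j`. -/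
def Covered {α : Type} (ps : List (α × Bool)) (j : α) : Prop := ∃ y ∈ ps, y.1 = j

theorem Rec.covered {ps : γ → List (α × Bool)} {j : γ → α} (hps : Eff ps) (hj : Eff j) :
    Rec fun x => Covered (ps x) (j x) :=
  .bex (p := fun x (y : α × Bool) => y.1 = j x) hps (.eq (by fun_prop) (by fun_prop))

/-- Absence of `(j, true)` from the premises means falsity only if they contain a judgement on `j`
at all, hence the covering conditions in the rules. -/
theorem Covered.mem_iff {α : Type} {p : α → Prop} {ps : List (α × Bool)} {j : α} (h : Covered ps j)
    (hps : ∀ x ∈ ps, (p x.1 ↔ x.2 = true)) : (j, true) ∈ ps ↔ p j := by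
  constructor
  · exact fun hj => (hps _ hj).2 rfl
  · intro hp
    obtain ⟨⟨j, b⟩, hy, rfl⟩ := h
    obtain rfl : b = true := (hps _ hy).1 hp
    exact hy

theorem exists_covered {α : Type} (p : α → Prop) (js : List α) : ∃ ps : List (α × Bool),
    (∀ j ∈ js, Covered ps j) ∧ (∀ x ∈ ps, (p x.1 ↔ x.2 = true)) ∧ ∀ x ∈ ps, x.1 ∈ js := by
  classical
  exact ⟨js.map fun j => (j, decide (p j)), fun j hj => ⟨_, List.mem_map_of_mem hj, rfl⟩, by simp,
    by simp⟩

/-- The data of an evaluation: a formula, valuations, and a state. -/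
abbrev EvalTask := ITForm × List (ℕ × ℕ) × List (ℕ × List StateCode) × StateCode

/-- The rules for the truth values of formulae. -/
def EvalRule (c : TBox × List StateCode × List (StateCode × StateCode)) (a : EvalTask) (b : Bool)
    (ps : List (EvalTask × Bool)) : Prop :=
  (∃ Q, a.1 = .query Q ∧ (b = true ↔ Q.Holds c.1 a.2.2.2.1.toFinset (envFun a.2.1))) ∨
  (∃ Φ, a.1 = .neg Φ ∧ Covered ps (Φ, a.2) ∧ (b = true ↔ ¬ ((Φ, a.2), true) ∈ ps)) ∨
  (∃ Φ Ψ, a.1 = .and Φ Ψ ∧ (Covered ps (Φ, a.2) ∧ Covered ps (Ψ, a.2)) ∧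
    (b = true ↔ ((Φ, a.2), true) ∈ ps ∧ ((Ψ, a.2), true) ∈ ps)) ∨
  (∃ x Φ, a.1 = .ex x Φ ∧
    (∀ d ∈ adomList a.2.2.2.1, Covered ps (Φ, (x, d) :: a.2.1, a.2.2)) ∧
    (b = true ↔ ∃ d ∈ adomList a.2.2.2.1, ((Φ, (x, d) :: a.2.1, a.2.2), true) ∈ ps)) ∨
  (∃ Φ, a.1 = .diaBox Φ ∧ (∀ q ∈ c.2.2, Covered ps (Φ, a.2.1, a.2.2.1, q.2)) ∧
    (b = true ↔ ∃ p ∈ c.2.2, p.1 = a.2.2.2 ∧ ∀ q ∈ c.2.2, q.1 = p.2 →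
      ((Φ, a.2.1, a.2.2.1, q.2), true) ∈ ps)) ∨
  (∃ Φ, a.1 = .boxBox Φ ∧ (∀ q ∈ c.2.2, Covered ps (Φ, a.2.1, a.2.2.1, q.2)) ∧
    (b = true ↔ ∀ p ∈ c.2.2, p.1 = a.2.2.2 → ∀ q ∈ c.2.2, q.1 = p.2 →
      ((Φ, a.2.1, a.2.2.1, q.2), true) ∈ ps)) ∨
  (∃ Z, a.1 = .pvar Z ∧ (b = true ↔ a.2.2.2 ∈ (look a.2.2.1 Z).getD [])) ∨
  ∃ Z Φ, a.1 = .mu Z Φ ∧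
    (∀ L ∈ sublists c.2.1, ∀ u ∈ c.2.1, Covered ps (Φ, a.2.1, (Z, L) :: a.2.2.1, u)) ∧
    (b = true ↔ ∀ L ∈ sublists c.2.1, (∀ u ∈ c.2.1,
      ((Φ, a.2.1, (Z, L) :: a.2.2.1, u), true) ∈ ps → u ∈ L) → a.2.2.2 ∈ L)

theorem RE.evalRule {c : γ → TBox × List StateCode × List (StateCode × StateCode)}
    {a : γ → EvalTask} {b : γ → Bool} {ps : γ → List (EvalTask × Bool)} (hc : Eff c) (ha : Eff a)
    (hb : Eff b) (hps : Eff ps) : RE fun x => EvalRule (c x) (a x) (b x) (ps x) := by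
  refine .or ?_ (.or ?_ (.or ?_ (.or ?_ (.or ?_ (.or ?_ (.or ?_ ?_))))))
  · refine .ex (Rec.re (.and (.eq ?_ ?_) (.iff (.eq ?_ ?_) (.holds ?_ ?_ ?_ ?_)))) <;> fun_prop
  · refine .ex (Rec.re (.and (.eq ?_ ?_) (.and (.covered ?_ ?_)
      (.iff (.eq ?_ ?_) (.not (.mem ?_ ?_)))))) <;> fun_prop
  · refine .ex (.ex (Rec.re (.and (.eq ?_ ?_) (.and (.and (.covered ?_ ?_) (.covered ?_ ?_))
      (.iff (.eq ?_ ?_) (.and (.mem ?_ ?_) (.mem ?_ ?_))))))) <;> fun_prop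
  · refine .ex (.ex (Rec.re (.and (.eq ?_ ?_) (.and (.ball ?_ (.covered ?_ ?_))
      (.iff (.eq ?_ ?_) (.bex ?_ (.mem ?_ ?_))))))) <;> fun_prop
  · refine .ex (Rec.re (.and (.eq ?_ ?_) (.and (.ball ?_ (.covered ?_ ?_)) (.iff (.eq ?_ ?_)
      (.bex ?_ (.and (.eq ?_ ?_) (.ball ?_ (.imp (.eq ?_ ?_) (.mem ?_ ?_))))))))) <;> fun_prop
  · refine .ex (Rec.re (.and (.eq ?_ ?_) (.and (.ball ?_ (.covered ?_ ?_)) (.iff (.eq ?_ ?_)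
      (.ball ?_ (.imp (.eq ?_ ?_) (.ball ?_ (.imp (.eq ?_ ?_) (.mem ?_ ?_))))))))) <;> fun_prop
  · refine .ex (Rec.re (.and (.eq ?_ ?_) (.iff (.eq ?_ ?_) (.mem ?_ ?_)))) <;> fun_prop
  · refine .ex (.ex (Rec.re (.and (.eq ?_ ?_) (.and (.ball ?_ (.ball ?_ (.covered ?_ ?_)))
      (.iff (.eq ?_ ?_) (.ball ?_ (.imp (.ball ?_ (.imp (.mem ?_ ?_) (.mem ?_ ?_)))
      (.mem ?_ ?_)))))))) <;> fun_prop

/-- A least fixpoint is evaluated as the intersection of the pre-fixpoints among the sublists of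
`S`, with premises for all of these; no iteration is involved. -/
theorem Rec.eval {T : γ → TBox} {S : γ → List StateCode} {E : γ → List (StateCode × StateCode)}
    {Φ : γ → ITForm} {w : γ → List (ℕ × ℕ)} {W : γ → List (ℕ × List StateCode)} {t : γ → StateCode}
    (hT : Eff T) (hS : Eff S) (hE : Eff E) (hΦ : Eff Φ) (hw : Eff w) (hW : Eff W) (ht : Eff t) :
    Rec fun x => (Φ x).Eval (T x) (S x) (E x) (w x) (W x) (t x) := by
  have := Rec.of_rules (γ := TBox × List StateCode × List (StateCode × StateCode)) (α := EvalTask)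
    (p := fun c a => a.1.Eval c.1 c.2.1 c.2.2 a.2.1 a.2.2.1 a.2.2.2) EvalRule (fun a => sizeOf a.1)
    (.evalRule (by fun_prop) (by fun_prop) (by fun_prop) (by fun_prop)) ?_ ?_
  · exact this.comp (f := fun x => ((T x, S x, E x), (Φ x, w x, W x, t x))) (by fun_prop)
  · rintro ⟨T, S, E⟩ ⟨Φ, w, W, t⟩ b ps h ih
    have key : ∀ Φ w W t, Covered ps (Φ, w, W, t) →
        (((Φ, w, W, t), true) ∈ ps ↔ Φ.Eval T S E w W t) := fun Φ w W t hj =>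
      hj.mem_iff (p := fun a => a.1.Eval T S E a.2.1 a.2.2.1 a.2.2.2) ih
    rcases h with ⟨Q, rfl, h⟩ | ⟨Φ, rfl, h1, h⟩ | ⟨Φ, Ψ, rfl, ⟨h1, h2⟩, h⟩ | ⟨x, Φ, rfl, h1, h⟩ |
      ⟨Φ, rfl, h1, h⟩ | ⟨Φ, rfl, h1, h⟩ | ⟨Z, rfl, h⟩ | ⟨Z, Φ, rfl, h1, h⟩
    · exact h.symm
    · exact (h.trans (not_congr (key _ _ _ _ h1))).symm
    · exact (h.trans (and_congr (key _ _ _ _ h1) (key _ _ _ _ h2))).symm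
    · exact (h.trans (exists_congr fun d => and_congr_right fun hd => key _ _ _ _ (h1 d hd))).symm
    · exact (h.trans (exists_congr fun p => and_congr_right fun _ => and_congr_right fun _ =>
        forall₂_congr fun q hq => imp_congr_right fun _ => key _ _ _ _ (h1 q hq))).symm
    · exact (h.trans (forall₂_congr fun p _ => imp_congr_right fun _ =>
        forall₂_congr fun q hq => imp_congr_right fun _ => key _ _ _ _ (h1 q hq))).symm
    · exact h.symm
    · exact (h.trans (forall₂_congr fun L hL => imp_congr (forall₂_congr fun u hu =>
        imp_congr_left (key _ _ _ _ (h1 L hL u hu))) Iff.rfl)).symm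
  · rintro ⟨T, S, E⟩ ⟨Φ, w, W, t⟩ b h
    -- For totality it is enough to name finitely many smaller tasks `js`; their truth values are
    -- then the premises.
    have main : ∀ js : List EvalTask, (∀ j ∈ js, sizeOf j.1 < sizeOf Φ) →
        (∀ ps : List (EvalTask × Bool), (∀ j ∈ js, Covered ps j) →
          (∀ j ∈ js, ((j, true) ∈ ps ↔ j.1.Eval T S E j.2.1 j.2.2.1 j.2.2.2)) →
          EvalRule (T, S, E) (Φ, w, W, t) b ps) →
        ∃ ps, EvalRule (T, S, E) (Φ, w, W, t) b ps ∧
          ∀ x ∈ ps, (x.1.1.Eval T S E x.1.2.1 x.1.2.2.1 x.1.2.2.2 ↔ x.2 = true) ∧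
            sizeOf x.1.1 < sizeOf Φ := by
      intro js hsize hrule
      obtain ⟨ps, h1, h2, h3⟩ := exists_covered
        (fun j : EvalTask => j.1.Eval T S E j.2.1 j.2.2.1 j.2.2.2) js
      exact ⟨ps, hrule ps h1 fun j hj => (h1 j hj).mem_iff
          (p := fun j : EvalTask => j.1.Eval T S E j.2.1 j.2.2.1 j.2.2.2) h2,
        fun x hx => ⟨h2 x hx, hsize _ (h3 x hx)⟩⟩
    cases Φ with
    | query Q => exact main [] (by simp) fun ps _ _ => .inl ⟨Q, rfl, h.symm⟩
    | neg Φ =>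
      refine main [(Φ, w, W, t)] (by simp) fun ps h1 h2 => .inr (.inl ⟨Φ, rfl, h1 _ (by simp), ?_⟩)
      exact h.symm.trans (not_congr (h2 (Φ, w, W, t) (by simp)).symm)
    | and Φ Ψ =>
      refine main [(Φ, w, W, t), (Ψ, w, W, t)] (by simp; omega) fun ps h1 h2 =>
        .inr (.inr (.inl ⟨Φ, Ψ, rfl, ⟨h1 _ (by simp), h1 _ (by simp)⟩, ?_⟩))
      exact h.symm.trans (and_congr (h2 (Φ, w, W, t) (by simp)).symm
        (h2 (Ψ, w, W, t) (by simp)).symm)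
    | ex x Φ =>
      refine main ((adomList t.1).map fun d => (Φ, (x, d) :: w, W, t)) (by simp) fun ps h1 h2 =>
        .inr (.inr (.inr (.inl ⟨x, Φ, rfl, fun d hd => h1 _ (List.mem_map.2 ⟨d, hd, rfl⟩), ?_⟩)))
      exact h.symm.trans (exists_congr fun d => and_congr_right fun hd =>
        (h2 (Φ, (x, d) :: w, W, t) (List.mem_map.2 ⟨d, hd, rfl⟩)).symm)
    | diaBox Φ =>
      refine main (E.map fun q => (Φ, w, W, q.2)) (by simp +contextual) fun ps h1 h2 =>
        .inr (.inr (.inr (.inr (.inl ⟨Φ, rfl, fun q hq => h1 _ (List.mem_map.2 ⟨q, hq, rfl⟩), ?_⟩))))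
      exact h.symm.trans (exists_congr fun p => and_congr_right fun _ => and_congr_right fun _ =>
        forall₂_congr fun q hq => imp_congr_right fun _ =>
        (h2 (Φ, w, W, q.2) (List.mem_map.2 ⟨q, hq, rfl⟩)).symm)
    | boxBox Φ =>
      refine main (E.map fun q => (Φ, w, W, q.2)) (by simp +contextual) fun ps h1 h2 =>
        .inr (.inr (.inr (.inr (.inr (.inl
          ⟨Φ, rfl, fun q hq => h1 _ (List.mem_map.2 ⟨q, hq, rfl⟩), ?_⟩)))))
      exact h.symm.trans (forall₂_congr fun p _ => imp_congr_right fun _ =>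
        forall₂_congr fun q hq => imp_congr_right fun _ =>
        (h2 (Φ, w, W, q.2) (List.mem_map.2 ⟨q, hq, rfl⟩)).symm)
    | pvar Z =>
      exact main [] (by simp) fun ps _ _ =>
        .inr (.inr (.inr (.inr (.inr (.inr (.inl ⟨Z, rfl, h.symm⟩))))))
    | mu Z Φ =>
      have hmem : ∀ L ∈ sublists S, ∀ u ∈ S, (Φ, w, (Z, L) :: W, u) ∈
          (sublists S).flatMap fun L => S.map fun u => (Φ, w, (Z, L) :: W, u) := fun L hL u hu =>
        List.mem_flatMap.2 ⟨L, hL, List.mem_map.2 ⟨u, hu, rfl⟩⟩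
      refine main ((sublists S).flatMap fun L => S.map fun u => (Φ, w, (Z, L) :: W, u)) ?_
        fun ps h1 h2 => .inr (.inr (.inr (.inr (.inr (.inr (.inr
          ⟨Z, Φ, rfl, fun L hL u hu => h1 _ (hmem L hL u hu), ?_⟩))))))
      · intro j hj
        obtain ⟨L, -, hj⟩ := List.mem_flatMap.1 hj
        obtain ⟨u, -, rfl⟩ := List.mem_map.1 hj
        simp
      · exact h.symm.trans (forall₂_congr fun L hL => imp_congr (forall₂_congr fun u hu =>
          imp_congr_left (h2 _ (hmem L hL u hu)).symm) Iff.rfl)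

end Evaluation

/-! ### The decision procedure. -/

section Decidability

/-- The marker assertion of an instance. -/
def Instance.marker (P : Instance) : Assertion ℕ := .conc P.st P.tmp

/-- Verification over run-bounded transition systems is decidable, for every suitable notion
of repair. -/
theorem GoodRepair.decidableOn {rep : TBox → ABox → ABox → Prop} (hrep : GoodRepair rep) :
    DecidableOn Instance.code
      (fun P => P.Valid ∧ (P.kab.repairTS rep P.marker).RunBounded)
      (fun P => (P.kab.repairTS rep P.marker).Models P.formula.toMu) := by
  have hmarker : Eff Instance.marker := .conc (.instance_st .id) (.instance_tmp .id)
  -- The code of the instance serves for every purpose: it bounds the constants of the KAB and the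
  -- marker, and the code of the formula, hence also its constants and the number of values it can
  -- remember.
  have hconst : ∀ P : Instance, P.kab.ConstsLT (P.code + 1) ∧
      (∀ c ∈ P.marker.terms, c < P.code + 1) ∧ P.formula.code ≤ P.code := fun P => by
    refine ⟨KAB.constsLT (Nat.lt_succ_of_le (Nat.left_le_pair _ _)), fun c hc => ?_, ?_⟩
    · obtain rfl : c = P.tmp := by simpa [Instance.marker, Assertion.terms] using hc
      exact Nat.lt_succ_of_le ((Nat.left_le_pair _ _).trans ((Nat.right_le_pair _ _).trans
        (Nat.right_le_pair _ _)))
    · exact (Nat.right_le_pair _ _).trans ((Nat.right_le_pair _ _).trans (Nat.right_le_pair _ _))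
  have hcode : Eff Instance.code := Eff.code .id
  -- The object of the search is an abstraction together with the truth value of the formula in it;
  -- the bound on the runs does not have to be known.
  refine decidableOn_of_re
    (py := fun P => ∃ S E N t₀,
      IsAbstraction rep P.kab P.marker (P.code + 1) P.code S E N t₀ ∧
        P.formula.Eval P.kab.tbox S E [] [] t₀)
    (pn := fun P => ∃ S E N t₀,
      IsAbstraction rep P.kab P.marker (P.code + 1) P.code S E N t₀ ∧
        ¬ P.formula.Eval P.kab.tbox S E [] [] t₀) ?_ ?_ ?_ ?_ ?_
  · refine .ex (.ex (.ex (.ex (.and (.isAbstraction hrep ?_ (hmarker.comp ?_)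
      (.succ (hcode.comp ?_)) (hcode.comp ?_) ?_ ?_ ?_ ?_) (Rec.eval ?_ ?_ ?_ ?_ ?_ ?_ ?_).re)))) <;>
      fun_prop
  · refine .ex (.ex (.ex (.ex (.and (.isAbstraction hrep ?_ (hmarker.comp ?_)
      (.succ (hcode.comp ?_)) (hcode.comp ?_) ?_ ?_ ?_ ?_)
      (Rec.eval ?_ ?_ ?_ ?_ ?_ ?_ ?_).not.re)))) <;> fun_prop
  -- Run-boundedness provides an abstraction, so one of the two searches succeeds.
  · rintro P ⟨⟨hK, -, -, -⟩, hb⟩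
    obtain ⟨S, E, N, t₀, h⟩ := exists_isAbstraction hrep hK (hconst P).1 (hconst P).2.1 hb P.code
    by_cases hΦ : P.formula.Eval P.kab.tbox S E [] [] t₀
    · exact .inl ⟨S, E, N, t₀, h, hΦ⟩
    · exact .inr ⟨S, E, N, t₀, h, hΦ⟩
  · rintro P ⟨⟨hK, -, hc, hm⟩, -⟩ ⟨S, E, N, t₀, h, hΦ⟩
    exact (h.models_iff hrep hK (hconst P).1 (hconst P).2.1 (Nat.lt_succ_self _) hc hm
      (hconst P).2.2).2 hΦ
  · rintro P ⟨⟨hK, -, hc, hm⟩, -⟩ ⟨S, E, N, t₀, h, hΦ⟩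
    exact fun H => hΦ ((h.models_iff hrep hK (hconst P).1 (hconst P).2.1 (Nat.lt_succ_self _) hc hm
      (hconst P).2.2).1 H)

end Decidability

end KABs

theorem theorem2 :
    KABs.DecidableOn KABs.Instance.code
      (fun P => P.Valid ∧ (P.kab.bTS P.st P.tmp).RunBounded)
      (fun P => (P.kab.bTS P.st P.tmp).Models P.formula.toMu) ∧
    KABs.DecidableOn KABs.Instance.code
      (fun P => P.Valid ∧ (P.kab.cTS P.st P.tmp).RunBounded)
      (fun P => (P.kab.cTS P.st P.tmp).Models P.formula.toMu) :=
  ⟨KABs.goodRepair_isBRepair.decidableOn, KABs.goodRepair_isCRepair.decidableOn⟩
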